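/- **Theorem (Renormalizable traps).** For $z\in\mathbb C$ with $0<|z|<1$ let $f(x)=zx$ and $g(x)=z(x-1)+1$, let $\Lambda_z$ be the limit set of the semigroup generated by $f,g$ (the closure of the set of fixed points of its elements), and let $\Gamma_z$ be the limit set of the semigroup generated by the three maps $x\mapsto z(x-c)+c$, $c\in\{-1,0,1\}$. For a finite word $u$ in the letters $f,g$ write $u(z,\cdot)$ for the corresponding composition and $p_u(z)=u(z,0)$, so that $u(z,x)=xz^{|u|}+p_u(z)$. For an infinite word $U$ with prefixes $U_n$ of length $n$ let $\pi(U,z)=\lim_n U_n(z,x)$ (for any $x$). A *trap* for $z$ consists of a closed topological disk $D\subset\mathbb C$ with $\Lambda_z\subset\mathrm{int}\,D$ and finite words $u,v$ such that (i) $u$ starts with $f$ and $v$ starts with $g$; (ii) there are points $p^\pm\in u\Lambda_z\setminus vD$ and $q^\pm\in v\Lambda_z\setminus uD$ and paths $\alpha\subset uD$ with endpoints $p^\pm$ and $\beta\subset vD$ with endpoints $q^\pm$ whose algebraic intersection number is nonzero; (iii) for some $\epsilon>0$ there are points of $f\Lambda_z$ and $g\Lambda_z$ within distance $\epsilon$ of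 each other, and the $\epsilon/2$-neighborhood of $\Lambda_z$ is contained in $D$. Let $\omega\in\mathbb C$ with $0<|\omega|<1$ be a renormalization point for finite words $u,v,s,t$: that is, $|u|=|v|=a$, $|s|=|t|=b\ge 1$, $us^\infty\neq vt^\infty$, and $\pi(us^\infty,\omega)=\pi(vt^\infty,\omega)$. Put $P(z)=\pi(us^\infty,z)-\pi(vt^\infty,z)$, assume $P'(\omega)\neq 0$, and let $$T_\omega=-\frac{p_u(\omega)-p_v(\omega)}{P'(\omega)}-\frac{\omega^a}{P'(\omega)}\,\Gamma_\omega .$$ 1. If $\omega\notin\mathbb R$, then for every $C\in T_\omega$ and every $\epsilon>0$ there is $C'\in\mathbb C$ with $|C-C'|<\epsilon$ such that for all sufficiently large $n$ there is a trap for $\omega+C'\omega^{bn}$. 2. If $(us^\infty,vt^\infty)$ is the unique pair $(U,V)$ of infinite words such that $U$ starts with $f$, $V$ starts with $g$ and $\pi(U,\omega)=\pi(V,\omega)$, then there is $\delta>0$ such that for every $C\notin T_\omega$ with $|C|<\delta$ the limit set $\Lambda_{\omega+C\omega^{bn}}$ is disconnected for all sufficiently large $n$. -/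

import Mathlib

open Filter Topology

/-! ## Semigroups of similarities and their limit sets -/

/-- The similarity `x ↦ z (x - c) + c` with centre `c` and dilation `z`. -/
def dilation (z c x : ℂ) : ℂ := z * (x - c) + c

/-- The composition of the dilations by `z` centred at the entries of a list;
the first entry of the list is the outermost map. -/
def dilationWord (z : ℂ) : List ℂ → ℂ → ℂ
  | [], x => x
  | c :: w, x => dilation z c (dilationWord z w x)

/-- The limit set of the semigroup generated by the dilations by `z` centred at the points of `S`:
the closure of the set of fixed points of its elements. -/
def limitSet (z : ℂ) (S : Set ℂ) : Set ℂ :=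
  closure {x | ∃ w : List ℂ, w ≠ [] ∧ (∀ c ∈ w, c ∈ S) ∧ dilationWord z w x = x}

/-- `Λ_z`, the limit set of the semigroup generated by `f : x ↦ z x` and `g : x ↦ z (x - 1) + 1`. -/
def LambdaSet (z : ℂ) : Set ℂ := limitSet z {0, 1}

/-- `Γ_z`, the limit set of the semigroup generated by the dilations by `z` centred at `-1, 0, 1`. -/
def GammaSet (z : ℂ) : Set ℂ := limitSet z {-1, 0, 1}

/-! ## Words -/

/-- The alphabet `{f, g}`. -/
inductive Letter : Type
  | f
  | g

/-- `f` has centre `0` and `g` has centre `1`. -/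
def Letter.center : Letter → ℂ
  | .f => 0
  | .g => 1

/-- The similarity `u(z, ·)` of a finite word `u`. -/
def wordMap (z : ℂ) (u : List Letter) (x : ℂ) : ℂ := dilationWord z (u.map Letter.center) x

/-- The polynomial `p_u(z)`, defined by `u(z, x) = x z ^ |u| + p_u(z)`. -/
def wordPoly (u : List Letter) (z : ℂ) : ℂ := wordMap z u 0

/-- The prefix of length `n` of an infinite word. -/
def wordPrefix (U : ℕ → Letter) (n : ℕ) : List Letter := (List.range n).map U

/-- The coding map: `π(U, z)` is the limit of `U_n(z, x)`, where `U_n` is the prefix of `U` of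
length `n`; for `|z| < 1` it exists and does not depend on `x`, see `tendsto_codingMap`. -/
noncomputable def codingMap (U : ℕ → Letter) (z : ℂ) : ℂ :=
  limUnder atTop (fun n : ℕ => wordMap z (wordPrefix U n) 0)

/-- The infinite word `u s s s ⋯` (for a nonempty word `s`). -/
def periodicWord (u s : List Letter) (n : ℕ) : Letter :=
  if n < u.length then u.getD n .f else s.getD ((n - u.length) % s.length) .f

theorem wordMap_eq (z : ℂ) (u : List Letter) (x : ℂ) :
    wordMap z u x = x * z ^ u.length + wordPoly u z := by
  induction u with
  | nil => simp [wordMap, wordPoly, dilationWord]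
  | cons c u ih =>
    simp only [wordPoly, wordMap, List.map_cons, dilationWord, dilation, List.length_cons] at ih ⊢
    rw [ih]; ring

theorem wordMap_prefix (z : ℂ) (U : ℕ → Letter) (n : ℕ) (x : ℂ) :
    wordMap z (wordPrefix U n) x =
      x * z ^ n + ∑ j ∈ Finset.range n, (1 - z) * (U j).center * z ^ j := by
  have happ : ∀ (w : List Letter) (c : Letter) (y : ℂ),
      wordMap z (w ++ [c]) y = wordMap z w (dilation z c.center y) := by
    intro w c y
    induction w with
    | nil => simp [wordMap, dilationWord]
    | cons d w ih =>
      simp only [wordMap, List.cons_append, List.map_cons, dilationWord] at ih ⊢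
      rw [ih]
  induction n generalizing x with
  | zero => simp [wordPrefix, wordMap, dilationWord]
  | succ n ih =>
    have h : wordPrefix U (n + 1) = wordPrefix U n ++ [U n] := by
      simp [wordPrefix, List.range_succ]
    rw [h, happ, ih, Finset.sum_range_succ, dilation]
    ring

/-- For `|z| < 1` the limit that defines `π(U, z)` exists, for every base point `x`. -/
theorem tendsto_codingMap {z : ℂ} (hz : ‖z‖ < 1) (U : ℕ → Letter) (x : ℂ) :
    Tendsto (fun n : ℕ => wordMap z (wordPrefix U n) x) atTop (𝓝 (codingMap U z)) := by
  have hs : Summable (fun j : ℕ => (1 - z) * (U j).center * z ^ j) := by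
    refine Summable.of_norm_bounded (g := fun j : ℕ => ‖1 - z‖ * ‖z‖ ^ j)
      ((summable_geometric_of_lt_one (norm_nonneg z) hz).mul_left _) (fun j => ?_)
    rw [norm_mul, norm_mul, norm_pow]
    refine mul_le_mul_of_nonneg_right ?_ (by positivity)
    refine mul_le_of_le_one_right (norm_nonneg _) ?_
    cases U j <;> simp [Letter.center]
  have key : ∀ y : ℂ, Tendsto (fun n : ℕ => wordMap z (wordPrefix U n) y) atTop
      (𝓝 (∑' j : ℕ, (1 - z) * (U j).center * z ^ j)) := by
    intro y
    have h1 : Tendsto (fun n : ℕ => y * z ^ n) atTop (𝓝 (y * 0)) :=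
      (tendsto_pow_atTop_nhds_zero_of_norm_lt_one hz).const_mul y
    have h2 := h1.add hs.hasSum.tendsto_sum_nat
    simpa [wordMap_prefix] using h2
  have hlim : codingMap U z = ∑' j : ℕ, (1 - z) * (U j).center * z ^ j := (key 0).limUnder_eq
  rw [hlim]
  exact key x

/-! ## Algebraic intersection numbers of paths in the plane -/

/-- The loop `γ` avoids `0` and has winding number `k` about `0`: along `γ` there is a continuous
logarithm, whose total increment is `2 π i k`. -/
def HasWindingNumber {x : ℂ} (γ : Path x x) (k : ℤ) : Prop :=
  ∃ θ : C(unitInterval, ℂ), (∀ τ, Complex.exp (θ τ) = γ τ) ∧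
    θ 1 - θ 0 = 2 * Real.pi * Complex.I * k

/-- The map `(σ, τ) ↦ α σ - β τ`, restricted to the boundary of the unit square; the boundary is
traversed along the sides `σ = 0`, `τ = 1`, `σ = 1`, `τ = 0`, in this order. -/
noncomputable def differenceLoop {p₀ p₁ q₀ q₁ : ℂ} (α : Path p₀ p₁) (β : Path q₀ q₁) :
    Path (p₀ - q₀) (p₀ - q₀) :=
  ((β.map (f := fun y : ℂ => p₀ - y) (by fun_prop)).trans
    (α.map (f := fun x : ℂ => x - q₁) (by fun_prop))).trans
  ((β.map (f := fun y : ℂ => p₁ - y) (by fun_prop)).symm.trans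
    (α.map (f := fun x : ℂ => x - q₀) (by fun_prop)).symm)

/-- The algebraic intersection number of two paths in the plane, neither of which meets the
endpoints of the other, is `k`. It is the degree about `0` of the difference map
`(σ, τ) ↦ α σ - β τ` on the unit square, with the sign for which the oriented horizontal axis meets
the oriented vertical axis with number `1`. -/
def HasIntersectionNumber {p₀ p₁ q₀ q₁ : ℂ} (α : Path p₀ p₁) (β : Path q₀ q₁) (k : ℤ) : Prop :=
  HasWindingNumber (differenceLoop α β) k

/-! ## Traps -/

/-- The words `u, v` are a trap for `(z, D)`. -/
structure IsTrap (z : ℂ) (D : Set ℂ) (u v : List Letter) : Prop where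
  /-- `D` is a closed topological disk. -/
  disk : Nonempty (D ≃ₜ Metric.closedBall (0 : ℂ) 1)
  subset_interior : LambdaSet z ⊆ interior D
  head_left : u.head? = some Letter.f
  head_right : v.head? = some Letter.g
  linked : ∃ p₀ ∈ (wordMap z u '' LambdaSet z) \ (wordMap z v '' D),
    ∃ p₁ ∈ (wordMap z u '' LambdaSet z) \ (wordMap z v '' D),
    ∃ q₀ ∈ (wordMap z v '' LambdaSet z) \ (wordMap z u '' D),
    ∃ q₁ ∈ (wordMap z v '' LambdaSet z) \ (wordMap z u '' D),
    ∃ (α : Path p₀ p₁) (β : Path q₀ q₁),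
      Set.range α ⊆ wordMap z u '' D ∧ Set.range β ⊆ wordMap z v '' D ∧
      ∃ k : ℤ, k ≠ 0 ∧ HasIntersectionNumber α β k
  close : ∃ ε : ℝ, 0 < ε ∧
    (∃ x ∈ wordMap z [Letter.f] '' LambdaSet z, ∃ y ∈ wordMap z [Letter.g] '' LambdaSet z,
      dist x y ≤ ε) ∧
    Metric.thickening (ε / 2) (LambdaSet z) ⊆ D

/-- There is a trap for the parameter `z`. -/
def HasTrap (z : ℂ) : Prop := ∃ (D : Set ℂ) (u v : List Letter), IsTrap z D u v

/-! ## Renormalization points -/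

/-- `ω` is a renormalization point for the words `u, v, s, t`: the two distinct infinite words
`u s^∞` and `v t^∞` code the same point of `Λ_ω`. -/
structure IsRenormalizationPoint (ω : ℂ) (u v s t : List Letter) : Prop where
  pos : 0 < ‖ω‖
  lt_one : ‖ω‖ < 1
  length_prefix : u.length = v.length
  length_period : s.length = t.length
  period_pos : 0 < s.length
  ne : periodicWord u s ≠ periodicWord v t
  coincide : codingMap (periodicWord u s) ω = codingMap (periodicWord v t) ω

/-- The function `P(z) = p_{us^∞}(z) - p_{vt^∞}(z) = π(us^∞, z) - π(vt^∞, z)`. -/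
noncomputable def coincidenceFun (u v s t : List Letter) (z : ℂ) : ℂ :=
  codingMap (periodicWord u s) z - codingMap (periodicWord v t) z

/-- `T_ω = -(p_u(ω) - p_v(ω)) / P'(ω) - (ω ^ a / P'(ω)) Γ_ω`, where `a = |u|`. -/
noncomputable def similaritySet (ω : ℂ) (u v s t : List Letter) : Set ℂ :=
  (fun γ : ℂ => -((wordPoly u ω - wordPoly v ω) / deriv (coincidenceFun u v s t) ω)
    - ω ^ u.length / deriv (coincidenceFun u v s t) ω * γ) '' GammaSet ω

/-! Everything is translated into power series with digits. For $|z|<1$, $\Lambda_z$ is $(1-z)$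
times the set of values $\sum a_jz^j$ with $a_j\in\{0,1\}$, and $\Gamma_z$ is the same with digits
in $\{-1,0,1\}$ (`limitSet_eq`). The pieces $f\Lambda_z$ and $g\Lambda_z$ meet exactly when a series
with digits in $\{-1,0,1\}$ and constant term $-1$ vanishes at $z$ (`IsCoincident`). A
renormalization point supplies digits $\delta$, periodic from index $a$ on, whose series $Q$
vanishes at $\omega$, and $P=(1-z)Q$.

Let $R$ be the series of the periodic part and $Z=\omega+C\omega^{bn}$. The series that follows
$\delta$ for $a+bn$ digits and continues with $\gamma$ vanishes at $Z$ iff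
$\sum\gamma_jZ^j=R(Z)-Q(Z)/Z^{a+bn}$. The right side tends to $R(\omega)-Q'(\omega)C/\omega^a$
(`IsRenormDigits.tendsto_defect`), and $T_\omega$ is the set of $C$ for which this limit is a value
at $\omega$ of a series with digits in $\{-1,0,1\}$ (`mem_similaritySet_iff`).

Disconnectedness: if $\delta$ is the only coincidence at $\omega$ and $|C|$ is small, every
coincidence at $Z$ must follow $\delta$ for $n$ periods (`IsRenormDigits.eq_of_digitSum_eq_zero`).
Its remaining digits then solve the equation above, and compactness rules this out for $C\notin
T_\omega$ and large $n$.

Traps: words of equal length satisfy $v(x)=u(x+c)$ with $c$ given by `offset`, so a trap arises from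
a linking of $\Lambda_z$ with $\Lambda_z+c$ inside a disk (`Crossing`), an open condition on
$(z,c)$. Such a $c$ exists at a coincidence if no real power $z^q$, $q>0$, has modulus at least
$1/2$: the top face of the hull of $\Lambda_z$ then has its points of $\Lambda_z$ in two separated
clusters, and a small horizontal translate has peaks alternating with the original ones
(`exists_linked_of_peaks`). If $\omega$ has this property, cut $\gamma$ after $k$ digits and tune
$C'$ so that the offset at $Z$ tends to $c$ (`IsRenormDigits.exists_isGood_of_edges`).

If instead some real power of $\omega$ has modulus at least $1/2$, the digit series robustly cover
open sets. Near a suitable $C_1$ close to $C$ all parameters $Z$ with large $n$ are then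
coincidences; parameters with traps are open and dense among these, and Baire's theorem gives one
$C'$ for all large $n$ (`IsRenormDigits.exists_isGood_of_overlap`). -/

namespace RenormalizableTraps

open Metric Set

/-! ## Power series with bounded coefficients -/

/-- The power series `∑ d_j z ^ j`. -/
noncomputable def digitSum (d : ℕ → ℂ) (z : ℂ) : ℂ := ∑' j : ℕ, d j * z ^ j

/-- The sequences all of whose terms have norm at most `1`. -/
def unitSeq : Set (ℕ → ℂ) := {d | ∀ j, ‖d j‖ ≤ 1}

theorem norm_mul_pow_le {d : ℕ → ℂ} (hd : d ∈ unitSeq) (z : ℂ) (j : ℕ) :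
    ‖d j * z ^ j‖ ≤ ‖z‖ ^ j := by
  rw [norm_mul, norm_pow]
  exact mul_le_of_le_one_left (by positivity) (hd j)

theorem summable_digit {d : ℕ → ℂ} (hd : d ∈ unitSeq) {z : ℂ} (hz : ‖z‖ < 1) :
    Summable fun j : ℕ => d j * z ^ j :=
  Summable.of_norm_bounded (summable_geometric_of_lt_one (norm_nonneg z) hz)
    (norm_mul_pow_le hd z)

theorem unitSeq_shift {d : ℕ → ℂ} (hd : d ∈ unitSeq) (n : ℕ) : (fun j => d (n + j)) ∈ unitSeq :=
  fun j => hd (n + j)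

theorem digitSum_split {d : ℕ → ℂ} (hd : d ∈ unitSeq) {z : ℂ} (hz : ‖z‖ < 1) (n : ℕ) :
    digitSum d z =
      ∑ j ∈ Finset.range n, d j * z ^ j + z ^ n * digitSum (fun j => d (n + j)) z := by
  have h := (summable_digit hd hz).sum_add_tsum_nat_add n
  rw [digitSum, ← h, digitSum, ← tsum_mul_left]
  congr 1
  refine tsum_congr fun j => ?_
  rw [add_comm j n, pow_add]; ring

theorem norm_digitSum_le {d : ℕ → ℂ} (hd : d ∈ unitSeq) {z : ℂ} (hz : ‖z‖ < 1) :
    ‖digitSum d z‖ ≤ (1 - ‖z‖)⁻¹ := by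
  rw [← tsum_geometric_of_lt_one (norm_nonneg z) hz]
  exact tsum_of_norm_bounded (summable_geometric_of_lt_one (norm_nonneg z) hz).hasSum
    (norm_mul_pow_le hd z)

theorem tendsto_sum_digit {d : ℕ → ℂ} (hd : d ∈ unitSeq) {z : ℂ} (hz : ‖z‖ < 1) :
    Tendsto (fun n => ∑ j ∈ Finset.range n, d j * z ^ j) atTop (𝓝 (digitSum d z)) :=
  (summable_digit hd hz).hasSum.tendsto_sum_nat

theorem digitSum_neg (d : ℕ → ℂ) (z : ℂ) : digitSum (fun j => -d j) z = -digitSum d z := by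
  simp [digitSum, tsum_neg]

theorem digitSum_sub {d e : ℕ → ℂ} (hd : d ∈ unitSeq) (he : e ∈ unitSeq) {z : ℂ} (hz : ‖z‖ < 1) :
    digitSum (fun j => d j - e j) z = digitSum d z - digitSum e z := by
  rw [digitSum, digitSum, digitSum, ← (summable_digit hd hz).tsum_sub (summable_digit he hz)]
  exact tsum_congr fun j => by ring

/-- Replace the terms from index `n` on by another sequence. -/
def splice (n : ℕ) (d e : ℕ → ℂ) (j : ℕ) : ℂ := if j < n then d j else e (j - n)

theorem splice_mem {S : Set ℂ} {n : ℕ} {d e : ℕ → ℂ} (hd : ∀ j, d j ∈ S) (he : ∀ j, e j ∈ S)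
    (j : ℕ) : splice n d e j ∈ S := by
  unfold splice; split_ifs
  exacts [hd j, he _]

theorem splice_mem_unitSeq {n : ℕ} {d e : ℕ → ℂ} (hd : d ∈ unitSeq) (he : e ∈ unitSeq) :
    splice n d e ∈ unitSeq := fun j => by
  unfold splice; split_ifs
  exacts [hd j, he _]

theorem splice_of_lt {n j : ℕ} (h : j < n) (d e : ℕ → ℂ) : splice n d e j = d j := by
  simp [splice, h]

theorem splice_add (n j : ℕ) (d e : ℕ → ℂ) : splice n d e (n + j) = e j := by
  simp [splice]

theorem sum_range_splice (n : ℕ) (d e : ℕ → ℂ) (z : ℂ) :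
    ∑ j ∈ Finset.range n, splice n d e j * z ^ j = ∑ j ∈ Finset.range n, d j * z ^ j :=
  Finset.sum_congr rfl fun j hj => by rw [splice_of_lt (Finset.mem_range.1 hj)]

theorem sum_range_add_splice (n k : ℕ) (d e : ℕ → ℂ) (z : ℂ) :
    ∑ j ∈ Finset.range (n + k), splice n d e j * z ^ j =
      ∑ j ∈ Finset.range n, d j * z ^ j + z ^ n * ∑ j ∈ Finset.range k, e j * z ^ j := by
  rw [Finset.sum_range_add, sum_range_splice, Finset.mul_sum]
  congr 1
  refine Finset.sum_congr rfl fun j _ => ?_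
  rw [splice_add, pow_add]; ring

theorem digitSum_splice {n : ℕ} {d e : ℕ → ℂ} (hd : d ∈ unitSeq) (he : e ∈ unitSeq) {z : ℂ}
    (hz : ‖z‖ < 1) :
    digitSum (splice n d e) z = ∑ j ∈ Finset.range n, d j * z ^ j + z ^ n * digitSum e z := by
  rw [digitSum_split (splice_mem_unitSeq hd he) hz n, sum_range_splice]
  simp only [splice_add]

theorem eventually_norm_lt {ω : ℂ} {r : ℝ} (h : ‖ω‖ < r) : ∀ᶠ z in 𝓝 ω, ‖z‖ < r :=
  continuous_norm.continuousAt.eventually_lt_const h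

theorem eventually_norm_pos {ω : ℂ} (h : 0 < ‖ω‖) : ∀ᶠ z in 𝓝 ω, 0 < ‖z‖ :=
  continuous_norm.continuousAt.eventually_const_lt h

/-- `digitSum d` is continuous in `z`, uniformly in the sequence `d`. -/
theorem digitSum_equicontinuousAt {ω : ℂ} (hω : ‖ω‖ < 1) {η : ℝ} (hη : 0 < η) :
    ∀ᶠ z in 𝓝 ω, ‖z‖ < 1 ∧ ∀ d ∈ unitSeq, ‖digitSum d z - digitSum d ω‖ < η := by
  obtain ⟨r, hr, hr1⟩ := exists_between hω
  have hr0 : 0 ≤ r := (norm_nonneg ω).trans hr.le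
  have hs : Summable fun j : ℕ => 2 * r ^ j := (summable_geometric_of_lt_one hr0 hr1).mul_left 2
  have hb : ∀ z : ℂ, ‖z‖ < r → ∀ j : ℕ, ‖z ^ j - ω ^ j‖ ≤ 2 * r ^ j := fun z hz j => by
    have h1 : ‖z‖ ^ j ≤ r ^ j := by gcongr
    have h2 : ‖ω‖ ^ j ≤ r ^ j := by gcongr
    calc ‖z ^ j - ω ^ j‖ ≤ ‖z ^ j‖ + ‖ω ^ j‖ := norm_sub_le _ _
      _ ≤ 2 * r ^ j := by rw [norm_pow, norm_pow]; linarith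
  have ht : Tendsto (fun z : ℂ => ∑' j : ℕ, ‖z ^ j - ω ^ j‖) (𝓝 ω)
      (𝓝 (∑' j : ℕ, ‖ω ^ j - ω ^ j‖)) := by
    refine tendsto_tsum_of_dominated_convergence hs (fun j => ?_) ?_
    · exact ((continuous_pow j).sub continuous_const).norm.tendsto ω
    · filter_upwards [eventually_norm_lt hr] with z hz j
      rw [norm_norm]; exact hb z hz j
  simp only [sub_self, norm_zero, tsum_zero] at ht
  filter_upwards [ht.eventually (gt_mem_nhds hη), eventually_norm_lt hr] with z hz hzr
  refine ⟨hzr.trans hr1, fun d hd => lt_of_le_of_lt ?_ hz⟩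
  rw [digitSum, digitSum,
    ← (summable_digit hd (hzr.trans hr1)).tsum_sub (summable_digit hd hω)]
  refine tsum_of_norm_bounded
    (Summable.of_nonneg_of_le (fun _ => norm_nonneg _) (hb z hzr) hs).hasSum fun j => ?_
  rw [← mul_sub, norm_mul]
  exact mul_le_of_le_one_left (norm_nonneg _) (hd j)

theorem tendsto_digitSum_of_mem {ι : Type*} {l : Filter ι} {ω : ℂ} (hω : ‖ω‖ < 1) {Z : ι → ℂ}
    (hZ : Tendsto Z l (𝓝 ω)) {d : ℕ → ℂ} (hd : d ∈ unitSeq) :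
    Tendsto (fun i => digitSum d (Z i)) l (𝓝 (digitSum d ω)) := by
  rw [Metric.tendsto_nhds]
  intro η hη
  filter_upwards [hZ.eventually (digitSum_equicontinuousAt hω hη)] with i hi
  rw [dist_eq_norm]
  exact hi.2 d hd

theorem continuousOn_digitSum_seq {z : ℂ} (hz : ‖z‖ < 1) :
    ContinuousOn (fun d : ℕ → ℂ => digitSum d z) unitSeq :=
  continuousOn_tsum (u := fun j => ‖z‖ ^ j)
    (fun j => ((continuous_apply j).mul continuous_const).continuousOn)
    (summable_geometric_of_lt_one (norm_nonneg z) hz) fun j _ hd => norm_mul_pow_le hd z j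

theorem differentiableOn_digitSum {d : ℕ → ℂ} (hd : d ∈ unitSeq) :
    DifferentiableOn ℂ (digitSum d) (ball 0 1) := by
  intro z hz
  rw [mem_ball_zero_iff] at hz
  obtain ⟨r, hr, hr1⟩ := exists_between hz
  have h : DifferentiableOn ℂ (digitSum d) (ball 0 r) := by
    refine Complex.differentiableOn_tsum_of_summable_norm (u := fun j : ℕ => r ^ j)
      (summable_geometric_of_lt_one ((norm_nonneg z).trans hr.le) hr1)
      (fun j => by fun_prop) isOpen_ball fun j w hw => ?_
    rw [mem_ball_zero_iff] at hw
    refine (norm_mul_pow_le hd w j).trans ?_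
    gcongr
  exact (h.differentiableAt (isOpen_ball.mem_nhds (by simpa using hr))).differentiableWithinAt

theorem differentiableAt_digitSum {d : ℕ → ℂ} (hd : d ∈ unitSeq) {z : ℂ} (hz : ‖z‖ < 1) :
    DifferentiableAt ℂ (digitSum d) z :=
  (differentiableOn_digitSum hd).differentiableAt (isOpen_ball.mem_nhds (by simpa using hz))

/-! ## Limit sets as sets of power series -/

/-- The sequences with terms in `S`. -/
def seqIn (S : Set ℂ) : Set (ℕ → ℂ) := {d | ∀ j, d j ∈ S}

theorem isCompact_seqIn {S : Set ℂ} (hS : S.Finite) : IsCompact (seqIn S) := by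
  have h := isCompact_univ_pi (s := fun _ : ℕ => S) fun _ => hS.isCompact
  convert h using 1
  ext d; simp [seqIn]

theorem dilationWord_eq (z : ℂ) (w : List ℂ) (x : ℂ) :
    dilationWord z w x =
      x * z ^ w.length + (1 - z) * ∑ j ∈ Finset.range w.length, w.getD j 0 * z ^ j := by
  induction w with
  | nil => simp [dilationWord]
  | cons c w ih =>
    rw [dilationWord, ih, dilation, List.length_cons, Finset.sum_range_succ']
    simp only [List.getD_cons_succ, List.getD_cons_zero, pow_succ, pow_zero]
    simp only [← mul_assoc, ← Finset.sum_mul]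
    ring

/-- The fixed point of a word is the value of the series whose digits repeat that word. Periodic
sequences are dense in the compact space of all sequences, on which the value depends continuously.
-/
theorem limitSet_eq {z : ℂ} (hz : ‖z‖ < 1) {S : Set ℂ} (hS : S.Finite)
    (hS1 : ∀ c ∈ S, ‖c‖ ≤ 1) :
    limitSet z S = (fun d => (1 - z) * digitSum d z) '' seqIn S := by
  have hsub : seqIn S ⊆ unitSeq := fun d hd j => hS1 _ (hd j)
  have hcpt : IsCompact ((fun d => (1 - z) * digitSum d z) '' seqIn S) :=
    (isCompact_seqIn hS).image_of_continuousOn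
      (continuousOn_const.mul ((continuousOn_digitSum_seq hz).mono hsub))
  apply Subset.antisymm
  · refine closure_minimal ?_ hcpt.isClosed
    rintro x ⟨w, hw, hwS, hx⟩
    have hlen : 0 < w.length := List.length_pos_iff.2 hw
    set d : ℕ → ℂ := fun j => w.getD (j % w.length) 0 with hd
    have hdS : d ∈ seqIn S := fun j => by
      have hj := Nat.mod_lt j hlen
      simp only [hd, List.getD_eq_getElem _ _ hj]
      exact hwS _ (List.getElem_mem hj)
    refine ⟨d, hdS, ?_⟩
    have hsp := digitSum_split (hsub hdS) hz w.length
    have h1 : (fun j => d (w.length + j)) = d := by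
      funext j; simp [hd]
    have h2 : ∑ j ∈ Finset.range w.length, d j * z ^ j =
        ∑ j ∈ Finset.range w.length, w.getD j 0 * z ^ j :=
      Finset.sum_congr rfl fun j hj => by
        simp only [hd, Nat.mod_eq_of_lt (Finset.mem_range.1 hj)]
    rw [h1, h2] at hsp
    rw [dilationWord_eq] at hx
    have hne : (1 : ℂ) - z ^ w.length ≠ 0 := by
      intro h
      have : ‖z ^ w.length‖ < 1 := by
        rw [norm_pow]; exact pow_lt_one₀ (norm_nonneg z) hz hlen.ne'
      rw [← sub_eq_zero.1 h] at this
      simp at this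
    apply mul_right_cancel₀ hne
    show (1 - z) * digitSum d z * _ = _
    linear_combination (1 - z) * hsp + hx
  · rintro _ ⟨d, hd, rfl⟩
    have hdu := hsub hd
    -- The approximants are the fixed points of the words $d_0\cdots d_n$; using $n+1$ letters keeps
    -- the words nonempty.
    have hlim : Tendsto (fun n : ℕ => (1 - z) * (∑ j ∈ Finset.range (n + 1), d j * z ^ j) /
        (1 - z ^ (n + 1))) atTop (𝓝 ((1 - z) * digitSum d z / (1 - 0))) := by
      refine ((tendsto_const_nhds.mul ((tendsto_sum_digit hdu hz).comp (tendsto_add_atTop_nat 1))).div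
        (tendsto_const_nhds.sub ?_) (by simp))
      exact (tendsto_pow_atTop_nhds_zero_of_norm_lt_one hz).comp (tendsto_add_atTop_nat 1)
    rw [sub_zero, div_one] at hlim
    refine mem_closure_of_tendsto hlim (Eventually.of_forall fun n => ?_)
    refine ⟨(List.range (n + 1)).map d, by simp, ?_, ?_⟩
    · intro c hc
      obtain ⟨j, -, rfl⟩ := List.mem_map.1 hc
      exact hd j
    · have hne : (1 : ℂ) - z ^ (n + 1) ≠ 0 := by
        intro h
        have : ‖z ^ (n + 1)‖ < 1 := by
          rw [norm_pow]; exact pow_lt_one₀ (norm_nonneg z) hz n.succ_ne_zero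
        rw [← sub_eq_zero.1 h] at this
        simp at this
      rw [dilationWord_eq]
      have h2 : ∑ j ∈ Finset.range ((List.range (n + 1)).map d).length,
          ((List.range (n + 1)).map d).getD j 0 * z ^ j =
          ∑ j ∈ Finset.range (n + 1), d j * z ^ j := by
        simp only [List.length_map, List.length_range]
        refine Finset.sum_congr rfl fun j hj => ?_
        rw [List.getD_eq_getElem _ _ (by simpa using hj)]
        simp
      rw [h2, List.length_map, List.length_range]
      field_simp
      ring

/-- The digits of `Γ_z`. -/
def signs : Set ℂ := {-1, 0, 1}

theorem signs_finite : signs.Finite := by simp [signs]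

theorem norm_le_one_of_mem_signs {c : ℂ} (hc : c ∈ signs) : ‖c‖ ≤ 1 := by
  simp only [signs, mem_insert_iff, mem_singleton_iff] at hc
  rcases hc with rfl | rfl | rfl <;> simp

theorem seqIn_signs_subset : seqIn signs ⊆ unitSeq := fun _ hd j => norm_le_one_of_mem_signs (hd j)

theorem neg_mem_signs {c : ℂ} (hc : c ∈ signs) : -c ∈ signs := by
  simp only [signs, mem_insert_iff, mem_singleton_iff] at hc ⊢
  rcases hc with rfl | rfl | rfl <;> simp

theorem gammaSet_eq {z : ℂ} (hz : ‖z‖ < 1) :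
    GammaSet z = (fun d => (1 - z) * digitSum d z) '' seqIn signs :=
  limitSet_eq hz signs_finite fun _ => norm_le_one_of_mem_signs

/-- The sequence of centres of an infinite word. -/
def centers (U : ℕ → Letter) (j : ℕ) : ℂ := (U j).center

theorem centers_mem_unitSeq (U : ℕ → Letter) : centers U ∈ unitSeq := fun j => by
  unfold centers; cases U j <;> simp [Letter.center]

theorem codingMap_eq {z : ℂ} (hz : ‖z‖ < 1) (U : ℕ → Letter) :
    codingMap U z = (1 - z) * digitSum (centers U) z := by
  refine tendsto_nhds_unique (tendsto_codingMap hz U 0) ?_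
  have h := (tendsto_sum_digit (centers_mem_unitSeq U) hz).const_mul (1 - z)
  refine h.congr fun n => ?_
  rw [wordMap_prefix, zero_mul, zero_add, Finset.mul_sum]
  exact Finset.sum_congr rfl fun j _ => by rw [centers]; ring

theorem range_centers : range centers = seqIn {0, 1} := by
  ext d
  constructor
  · rintro ⟨U, rfl⟩ j
    unfold centers; cases U j <;> simp [Letter.center]
  · intro hd
    classical
    refine ⟨fun j => if d j = 0 then .f else .g, ?_⟩
    funext j
    have := hd j
    simp only [mem_insert_iff, mem_singleton_iff] at this
    rcases this with h | h <;> simp [centers, h, Letter.center]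

theorem lambdaSet_eq {z : ℂ} (hz : ‖z‖ < 1) : LambdaSet z = range fun U => codingMap U z := by
  have h := limitSet_eq hz (S := {0, 1}) (by simp) (by simp)
  rw [LambdaSet, h, ← range_centers, ← range_comp]
  congr 1
  funext U
  exact (codingMap_eq hz U).symm

theorem codingMap_mem_lambdaSet {z : ℂ} (hz : ‖z‖ < 1) (U : ℕ → Letter) :
    codingMap U z ∈ LambdaSet z := by
  rw [lambdaSet_eq hz]; exact mem_range_self U

theorem isCompact_lambdaSet {z : ℂ} (hz : ‖z‖ < 1) : IsCompact (LambdaSet z) := by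
  have h := limitSet_eq hz (S := {0, 1}) (by simp) (by simp)
  rw [LambdaSet, h]
  refine (isCompact_seqIn (by simp)).image_of_continuousOn
      (continuousOn_const.mul ((continuousOn_digitSum_seq hz).mono ?_))
  rw [← range_centers]
  rintro _ ⟨U, rfl⟩
  exact centers_mem_unitSeq U

theorem wordPoly_wordPrefix (z : ℂ) (U : ℕ → Letter) (n : ℕ) :
    wordPoly (wordPrefix U n) z = (1 - z) * ∑ j ∈ Finset.range n, centers U j * z ^ j := by
  rw [wordPoly, wordMap_prefix, zero_mul, zero_add, Finset.mul_sum]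
  exact Finset.sum_congr rfl fun j _ => by rw [centers]; ring

/-- The differences of the centres of two infinite words. -/
def centerDiff (U V : ℕ → Letter) (j : ℕ) : ℂ := centers U j - centers V j

theorem centerDiff_mem (U V : ℕ → Letter) : centerDiff U V ∈ seqIn signs := fun j => by
  unfold centerDiff centers
  cases U j <;> cases V j <;> simp [Letter.center, signs]

theorem codingMap_sub_codingMap {z : ℂ} (hz : ‖z‖ < 1) (U V : ℕ → Letter) :
    codingMap U z - codingMap V z = (1 - z) * digitSum (centerDiff U V) z := by
  rw [codingMap_eq hz, codingMap_eq hz, ← mul_sub,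
    ← digitSum_sub (centers_mem_unitSeq U) (centers_mem_unitSeq V) hz]
  rfl

/-- The digit $0$ is realized by the pair $(f,f)$, while $-1$ and $1$ leave no choice. The last
clause lets a constant term $-1$ be read as the heads $f$ and $g$. -/
theorem exists_centerDiff_eq {d : ℕ → ℂ} (hd : d ∈ seqIn signs) :
    ∃ U V : ℕ → Letter, centerDiff U V = d ∧
      ∀ j, d j = -1 → U j = Letter.f ∧ V j = Letter.g := by
  classical
  refine ⟨fun j => if d j = 1 then .g else .f, fun j => if d j = -1 then .g else .f, ?_, ?_⟩
  · funext j
    have := hd j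
    simp only [signs, mem_insert_iff, mem_singleton_iff] at this
    have h1 : (-1 : ℂ) ≠ 1 := by norm_num
    rcases this with h | h | h <;> simp [centerDiff, centers, h, Letter.center, h1, h1.symm]
  · intro j hj
    have h1 : (-1 : ℂ) ≠ 1 := by norm_num
    simp [hj, h1]

theorem one_sub_ne_zero {z : ℂ} (hz : ‖z‖ < 1) : (1 : ℂ) - z ≠ 0 := fun h => by
  rw [← sub_eq_zero.1 h] at hz; simp at hz

/-- `z` is a zero of a power series with coefficients in `{-1, 0, 1}` and constant term `-1`. -/
def IsCoincident (z : ℂ) : Prop := ∃ d ∈ seqIn signs, d 0 = -1 ∧ digitSum d z = 0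

/-! ## Winding numbers -/

/-- Along the path `γ` there is a continuous logarithm with increment `Δ`. -/
def HasLogIncrement {x y : ℂ} (γ : Path x y) (Δ : ℂ) : Prop :=
  ∃ θ : C(unitInterval, ℂ), (∀ τ, Complex.exp (θ τ) = γ τ) ∧ θ 1 - θ 0 = Δ

theorem HasLogIncrement.trans {x y w : ℂ} {γ : Path x y} {γ' : Path y w} {Δ Δ' : ℂ}
    (h : HasLogIncrement γ Δ) (h' : HasLogIncrement γ' Δ') :
    HasLogIncrement (γ.trans γ') (Δ + Δ') := by
  obtain ⟨θ, hθ, hΔ⟩ := h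
  obtain ⟨θ', hθ', hΔ'⟩ := h'
  have hexp : Complex.exp (θ 1) = Complex.exp (θ' 0) := by rw [hθ, hθ']; simp
  let ρ : Path (θ 0) (θ 1) := ⟨θ, rfl, rfl⟩
  -- At the junction the two logarithms have equal exponentials, so shifting the second by the
  -- constant $\theta(1)-\theta'(0)$ makes them match without changing its exponential.
  let ρ' : Path (θ 1) (θ' 1 + (θ 1 - θ' 0)) :=
    ⟨⟨fun τ => θ' τ + (θ 1 - θ' 0), by fun_prop⟩, by simp, rfl⟩
  have hρ : ∀ τ, Complex.exp (ρ τ) = γ τ := hθ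
  have hρ' : ∀ τ, Complex.exp (ρ' τ) = γ' τ := fun τ => by
    show Complex.exp (θ' τ + (θ 1 - θ' 0)) = γ' τ
    rw [Complex.exp_add, Complex.exp_sub, hexp, div_self (Complex.exp_ne_zero _), mul_one, hθ']
  refine ⟨(ρ.trans ρ').toContinuousMap, fun τ => ?_, ?_⟩
  · show Complex.exp ((ρ.trans ρ') τ) = _
    rw [Path.trans_apply, Path.trans_apply]
    split_ifs
    exacts [hρ _, hρ' _]
  · show (ρ.trans ρ') 1 - (ρ.trans ρ') 0 = _
    rw [Path.target, Path.source, ← hΔ, ← hΔ']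
    ring

theorem HasLogIncrement.symm {x y : ℂ} {γ : Path x y} {Δ : ℂ} (h : HasLogIncrement γ Δ) :
    HasLogIncrement γ.symm (-Δ) := by
  obtain ⟨θ, hθ, hΔ⟩ := h
  refine ⟨⟨fun τ => θ (unitInterval.symm τ), by fun_prop⟩, fun τ => ?_, ?_⟩
  · exact hθ _
  · simp [← hΔ]

/-- The factor $u$ rotates the path into the domain of the principal logarithm, and $e$ undoes the
rotation. This gives a branch of the logarithm on either closed half-plane without $0$, including
both real half-lines. -/
theorem hasLogIncrement_of_rotated {x y : ℂ} {γ : Path x y} (u e : ℂ) (hu : Complex.exp e * u = 1)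
    (h : ∀ τ, u * γ τ ∈ Complex.slitPlane) :
    HasLogIncrement γ ((Complex.log (u * y) + e) - (Complex.log (u * x) + e)) := by
  refine ⟨⟨fun τ => Complex.log (u * γ τ) + e, ?_⟩, fun τ => ?_, ?_⟩
  · refine Continuous.add (continuous_iff_continuousAt.2 fun τ => ?_) continuous_const
    exact ContinuousAt.clog (by fun_prop) (h τ)
  · show Complex.exp (Complex.log (u * γ τ) + e) = γ τ
    rw [Complex.exp_add, Complex.exp_log (Complex.slitPlane_ne_zero (h τ))]
    linear_combination (γ τ) * hu
  · show Complex.log (u * γ 1) + e - (Complex.log (u * γ 0) + e) = _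
    rw [γ.target, γ.source]

theorem hasLogIncrement_upper {x y : ℂ} {γ : Path x y} (h : ∀ τ, 0 ≤ (γ τ).im)
    (h0 : ∀ τ, γ τ ≠ 0) :
    HasLogIncrement γ ((Complex.log (-Complex.I * y) + Real.pi / 2 * Complex.I) -
      (Complex.log (-Complex.I * x) + Real.pi / 2 * Complex.I)) := by
  refine hasLogIncrement_of_rotated _ _ (by simp [Complex.exp_pi_div_two_mul_I]) fun τ => ?_
  rw [Complex.mem_slitPlane_iff]
  rcases (h τ).lt_or_eq with h1 | h1
  · left; simpa using h1
  · right
    have : (γ τ).re ≠ 0 := fun h2 => h0 τ (Complex.ext h2 h1.symm)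
    simpa using this

theorem hasLogIncrement_lower {x y : ℂ} {γ : Path x y} (h : ∀ τ, (γ τ).im ≤ 0)
    (h0 : ∀ τ, γ τ ≠ 0) :
    HasLogIncrement γ ((Complex.log (Complex.I * y) + -(Real.pi / 2 * Complex.I)) -
      (Complex.log (Complex.I * x) + -(Real.pi / 2 * Complex.I))) := by
  refine hasLogIncrement_of_rotated _ _
    (by simp [Complex.exp_neg, Complex.exp_pi_div_two_mul_I]) fun τ => ?_
  rw [Complex.mem_slitPlane_iff]
  rcases (h τ).lt_or_eq with h1 | h1
  · left; simpa using h1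
  · right
    have : (γ τ).re ≠ 0 := fun h2 => h0 τ (Complex.ext h2 h1)
    simpa using this

theorem log_I_mul_pos {x : ℝ} (hx : 0 < x) :
    Complex.log (Complex.I * x) = Real.log x + Real.pi / 2 * Complex.I := by
  rw [mul_comm, Complex.log_ofReal_mul hx Complex.I_ne_zero, Complex.log_I]

theorem log_neg_I_mul_pos {x : ℝ} (hx : 0 < x) :
    Complex.log (-Complex.I * x) = Real.log x - Real.pi / 2 * Complex.I := by
  rw [mul_comm, Complex.log_ofReal_mul hx (neg_ne_zero.2 Complex.I_ne_zero), Complex.log_neg_I]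
  ring

/-- Two paths in the lower half-plane whose endpoints alternate on the real axis have intersection
number `-1`. -/
theorem hasIntersectionNumber_of_alternating {p₀ q₀ p₁ q₁ : ℝ} (h₁ : p₀ < q₀) (h₂ : q₀ < p₁)
    (h₃ : p₁ < q₁) (α : Path (p₀ : ℂ) p₁) (β : Path (q₀ : ℂ) q₁)
    (hα : ∀ τ, (α τ).im ≤ 0) (hβ : ∀ τ, (β τ).im ≤ 0)
    (hα₀ : ∀ τ, α τ ≠ q₀) (hα₁ : ∀ τ, α τ ≠ q₁) (hβ₀ : ∀ τ, β τ ≠ p₀) (hβ₁ : ∀ τ, β τ ≠ p₁) :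
    HasIntersectionNumber α β (-1) := by
  -- Since the endpoints are real and the paths lie in the lower half-plane, each side of the
  -- difference loop stays in one closed half-plane. Its increment therefore depends only on the
  -- signs of the endpoint differences.
  have A := hasLogIncrement_upper (γ := β.map (f := fun y : ℂ => p₀ - y) (by fun_prop))
    (fun τ => by simpa using hβ τ) (fun τ => by simpa [sub_eq_zero] using (hβ₀ τ).symm)
  have B := hasLogIncrement_lower (γ := α.map (f := fun x : ℂ => x - q₁) (by fun_prop))
    (fun τ => by simpa using hα τ) (fun τ => by simpa [sub_eq_zero] using (hα₁ τ))
  have C := hasLogIncrement_upper (γ := β.map (f := fun y : ℂ => p₁ - y) (by fun_prop))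
    (fun τ => by simpa using hβ τ) (fun τ => by simpa [sub_eq_zero] using (hβ₁ τ).symm)
  have D := hasLogIncrement_lower (γ := α.map (f := fun x : ℂ => x - q₀) (by fun_prop))
    (fun τ => by simpa using hα τ) (fun τ => by simpa [sub_eq_zero] using (hα₀ τ))
  obtain ⟨θ, hθ, hΔ⟩ := (A.trans B).trans (C.symm.trans D.symm)
  refine ⟨θ, hθ, hΔ.trans ?_⟩
  have e1 : Complex.log (-Complex.I * (p₁ - q₀)) =
      Real.log (p₁ - q₀) - Real.pi / 2 * Complex.I := by
    rw [← log_neg_I_mul_pos (by linarith : 0 < p₁ - q₀)]; push_cast; rfl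
  have e2 : Complex.log (Complex.I * (p₁ - q₀)) =
      Real.log (p₁ - q₀) + Real.pi / 2 * Complex.I := by
    rw [← log_I_mul_pos (by linarith : 0 < p₁ - q₀)]; push_cast; rfl
  have f1 : ∀ a b : ℝ, a < b → Complex.log (-Complex.I * (a - b)) =
      Real.log (b - a) + Real.pi / 2 * Complex.I := fun a b hab => by
    rw [← log_I_mul_pos (by linarith : 0 < b - a)]; push_cast; ring_nf
  have f2 : ∀ a b : ℝ, a < b → Complex.log (Complex.I * (a - b)) =
      Real.log (b - a) - Real.pi / 2 * Complex.I := fun a b hab => by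
    rw [← log_neg_I_mul_pos (by linarith : 0 < b - a)]; push_cast; ring_nf
  rw [e1, e2, f1 _ _ h₁, f1 _ _ h₃, f1 _ _ (h₁.trans (h₂.trans h₃)), f2 _ _ h₁, f2 _ _ h₃,
    f2 _ _ (h₁.trans (h₂.trans h₃))]
  push_cast
  ring

/-- Rouché's argument: $\gamma'/\gamma$ stays in the unit disk about $1$, so its principal logarithm
is continuous, and it takes equal values at the two ends of the loop. -/
theorem HasWindingNumber.of_close {x y : ℂ} {γ : Path x x} {γ' : Path y y} {k : ℤ}
    (h : HasWindingNumber γ k) (hclose : ∀ τ, ‖γ' τ - γ τ‖ < ‖γ τ‖) : HasWindingNumber γ' k := by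
  obtain ⟨θ, hθ, hΔ⟩ := h
  have h0 : ∀ τ, γ τ ≠ 0 := fun τ => by rw [← hθ]; exact Complex.exp_ne_zero _
  have hslit : ∀ τ, γ' τ / γ τ ∈ Complex.slitPlane := fun τ => by
    have : γ' τ / γ τ = 1 + (γ' τ - γ τ) / γ τ := by field_simp [h0 τ]; ring
    rw [this]
    refine Complex.mem_slitPlane_of_norm_lt_one ?_
    rw [norm_div, div_lt_one (norm_pos_iff.2 (h0 τ))]
    exact hclose τ
  refine ⟨⟨fun τ => θ τ + Complex.log (γ' τ / γ τ), ?_⟩, fun τ => ?_, ?_⟩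
  · refine θ.continuous.add (continuous_iff_continuousAt.2 fun τ => ?_)
    exact ContinuousAt.clog (γ'.continuous.continuousAt.div γ.continuous.continuousAt (h0 τ))
      (hslit τ)
  · show Complex.exp (θ τ + Complex.log (γ' τ / γ τ)) = _
    rw [Complex.exp_add, Complex.exp_log (Complex.slitPlane_ne_zero (hslit τ)), hθ,
      mul_div_cancel₀ _ (h0 τ)]
  · show θ 1 + Complex.log (γ' 1 / γ 1) - (θ 0 + Complex.log (γ' 0 / γ 0)) = _
    rw [Path.target, Path.target, Path.source, Path.source, ← hΔ]
    ring

theorem HasWindingNumber.of_mul {x y : ℂ} {γ : Path x x} {γ' : Path y y} {k : ℤ} {w : ℂ}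
    (h : HasWindingNumber γ k) (hw : w ≠ 0) (hmul : ∀ τ, γ' τ = w * γ τ) :
    HasWindingNumber γ' k := by
  obtain ⟨θ, hθ, hΔ⟩ := h
  refine ⟨⟨fun τ => θ τ + Complex.log w, by fun_prop⟩, fun τ => ?_, ?_⟩
  · show Complex.exp (θ τ + Complex.log w) = _
    rw [Complex.exp_add, Complex.exp_log hw, hθ, hmul, mul_comm]
  · show θ 1 + Complex.log w - (θ 0 + Complex.log w) = _
    rw [← hΔ]; ring

theorem differenceLoop_affine {p₀ p₁ q₀ q₁ p₀' p₁' q₀' q₁' : ℂ} {α : Path p₀ p₁} {β : Path q₀ q₁}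
    {α' : Path p₀' p₁'} {β' : Path q₀' q₁'} {w e : ℂ} (hα : ∀ τ, α' τ = w * α τ + e)
    (hβ : ∀ τ, β' τ = w * β τ + e) (τ : unitInterval) :
    differenceLoop α' β' τ = w * differenceLoop α β τ := by
  have hp₀ : p₀' = w * p₀ + e := by simpa using hα 0
  have hp₁ : p₁' = w * p₁ + e := by simpa using hα 1
  have hq₀ : q₀' = w * q₀ + e := by simpa using hβ 0
  have hq₁ : q₁' = w * q₁ + e := by simpa using hβ 1
  subst hp₀ hp₁ hq₀ hq₁
  simp only [differenceLoop, Path.trans_apply, Path.symm_apply, Path.map_coe, Function.comp_apply,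
    hα, hβ]
  split_ifs <;> ring

theorem HasIntersectionNumber.affine {p₀ p₁ q₀ q₁ p₀' p₁' q₀' q₁' : ℂ} {α : Path p₀ p₁}
    {β : Path q₀ q₁} {k : ℤ} (h : HasIntersectionNumber α β k)
    {α' : Path p₀' p₁'} {β' : Path q₀' q₁'} {w e : ℂ} (hw : w ≠ 0) (hα : ∀ τ, α' τ = w * α τ + e)
    (hβ : ∀ τ, β' τ = w * β τ + e) : HasIntersectionNumber α' β' k :=
  HasWindingNumber.of_mul h hw (differenceLoop_affine hα hβ)

theorem norm_differenceLoop_sub_lt {p₀ p₁ q₀ q₁ p₀' p₁' q₀' q₁' : ℂ} {α : Path p₀ p₁}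
    {β : Path q₀ q₁} {α' : Path p₀' p₁'} {β' : Path q₀' q₁'} {η : ℝ}
    (hα : ∀ τ, ‖α' τ - α τ‖ < η) (hβ : ∀ τ, ‖β' τ - β τ‖ < η) (τ : unitInterval) :
    ‖differenceLoop α' β' τ - differenceLoop α β τ‖ < 2 * η := by
  have hp₀ : ‖p₀' - p₀‖ < η := by simpa using hα 0
  have hp₁ : ‖p₁' - p₁‖ < η := by simpa using hα 1
  have hq₀ : ‖q₀' - q₀‖ < η := by simpa using hβ 0
  have hq₁ : ‖q₁' - q₁‖ < η := by simpa using hβ 1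
  have key : ∀ a b a' b' : ℂ, ‖a' - a‖ < η → ‖b' - b‖ < η → ‖(a' - b') - (a - b)‖ < 2 * η := by
    intro a b a' b' ha hb
    calc ‖(a' - b') - (a - b)‖ = ‖(a' - a) - (b' - b)‖ := by ring_nf
      _ ≤ ‖a' - a‖ + ‖b' - b‖ := norm_sub_le _ _
      _ < 2 * η := by linarith
  simp only [differenceLoop, Path.trans_apply, Path.symm_apply, Path.map_coe, Function.comp_apply]
  split_ifs
  exacts [key _ _ _ _ hp₀ (hβ _), key _ _ _ _ (hα _) hq₁, key _ _ _ _ hp₁ (hβ _),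
    key _ _ _ _ (hα _) hq₀]

theorem exists_pos_lt_norm_of_hasWindingNumber {x : ℂ} {γ : Path x x} {k : ℤ}
    (h : HasWindingNumber γ k) : ∃ η : ℝ, 0 < η ∧ ∀ τ, η ≤ ‖γ τ‖ := by
  obtain ⟨θ, hθ, -⟩ := h
  obtain ⟨τ₀, -, hτ₀⟩ := isCompact_univ.exists_isMinOn univ_nonempty
    (γ.continuous.norm.continuousOn (s := univ))
  refine ⟨‖γ τ₀‖, ?_, fun τ => hτ₀ (mem_univ τ)⟩
  rw [norm_pos_iff, ← hθ]
  exact Complex.exp_ne_zero _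

/-- Move the endpoints of a path by linear interpolation. -/
noncomputable def perturbPath {p₀ p₁ : ℂ} (α : Path p₀ p₁) (p₀' p₁' : ℂ) : Path p₀' p₁' where
  toFun τ := α τ + ((1 - (τ : ℝ) : ℂ) * (p₀' - p₀) + (τ : ℝ) * (p₁' - p₁))
  continuous_toFun := by fun_prop
  source' := by simp
  target' := by simp

theorem norm_perturbPath_sub_lt {p₀ p₁ p₀' p₁' : ℂ} (α : Path p₀ p₁) {η : ℝ}
    (h₀ : ‖p₀' - p₀‖ < η) (h₁ : ‖p₁' - p₁‖ < η) (τ : unitInterval) :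
    ‖perturbPath α p₀' p₁' τ - α τ‖ < η := by
  have h : perturbPath α p₀' p₁' τ - α τ =
      (1 - (τ : ℝ) : ℝ) • (p₀' - p₀) + (τ : ℝ) • (p₁' - p₁) := by
    show α τ + _ - α τ = _
    simp
  rw [h]
  have := (convex_ball (0 : ℂ) η) (x := p₀' - p₀) (y := p₁' - p₁) (by simpa using h₀)
    (by simpa using h₁) (sub_nonneg.2 τ.2.2) τ.2.1 (by ring)
  simpa using this

/-! ## Linked translates -/

/-- There are paths in the interior of `D` and in the interior of `D + c`, with endpoints in
`K ∖ (D + c)` and in `(K + c) ∖ D`, whose algebraic intersection number is not zero. -/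
def Linked (K D : Set ℂ) (c : ℂ) : Prop :=
  ∃ p₀ ∈ K, ∃ p₁ ∈ K, ∃ q₀ ∈ K, ∃ q₁ ∈ K,
    p₀ - c ∉ D ∧ p₁ - c ∉ D ∧ q₀ + c ∉ D ∧ q₁ + c ∉ D ∧
    ∃ (α : Path p₀ p₁) (β : Path q₀ q₁), range α ⊆ interior D ∧ range β ⊆ interior D ∧
      ∃ k : ℤ, k ≠ 0 ∧
        HasIntersectionNumber α (β.map (f := fun x : ℂ => x + c) (by fun_prop)) k

theorem Linked.affine {K D : Set ℂ} {c w : ℂ} (h : Linked K D c) (hw : w ≠ 0) (e : ℂ) :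
    Linked ((fun x => w * x + e) '' K) ((fun x => w * x + e) '' D) (w * c) := by
  obtain ⟨p₀, hp₀, p₁, hp₁, q₀, hq₀, q₁, hq₁, hp₀D, hp₁D, hq₀D, hq₁D, α, β, hα, hβ, k, hk, hn⟩ := h
  have hcont : Continuous fun x : ℂ => w * x + e := by fun_prop
  have hopen : IsOpenMap fun x : ℂ => w * x + e := by
    have := ((Homeomorph.mulLeft₀ w hw).trans (Homeomorph.addRight e)).isOpenMap
    exact this
  have hnot : ∀ x y, y ∉ D → x = w * y + e → x ∉ (fun x => w * x + e) '' D := by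
    rintro x y hy rfl ⟨x', hx', hxy⟩
    have : x' = y := mul_left_cancel₀ hw (add_right_cancel hxy)
    exact hy (this ▸ hx')
  have hint : ∀ x ∈ interior D, w * x + e ∈ interior ((fun x => w * x + e) '' D) := fun x hx =>
    interior_maximal (image_mono interior_subset) (hopen _ isOpen_interior) (mem_image_of_mem _ hx)
  refine ⟨_, mem_image_of_mem _ hp₀, _, mem_image_of_mem _ hp₁, _, mem_image_of_mem _ hq₀, _,
    mem_image_of_mem _ hq₁, hnot _ _ hp₀D (by ring), hnot _ _ hp₁D (by ring),
    hnot _ _ hq₀D (by ring), hnot _ _ hq₁D (by ring), α.map hcont, β.map hcont, ?_, ?_, k, hk,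
    HasIntersectionNumber.affine (w := w) (e := e) hn hw (fun τ => rfl) (fun τ => ?_)⟩
  · rintro _ ⟨τ, rfl⟩; exact hint _ (hα ⟨τ, rfl⟩)
  · rintro _ ⟨τ, rfl⟩; exact hint _ (hβ ⟨τ, rfl⟩)
  · show w * β τ + e + w * c = w * (β τ + c) + e
    ring

theorem exists_thickening_of_range_subset {x y : ℂ} {γ : Path x y} {U : Set ℂ} (hU : IsOpen U)
    (h : range γ ⊆ U) : ∃ η : ℝ, 0 < η ∧ ∀ τ w, ‖w - γ τ‖ < η → w ∈ U := by
  obtain ⟨η, hη, hs⟩ := (isCompact_range γ.continuous).exists_thickening_subset_open hU h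
  refine ⟨η, hη, fun τ w hw => hs (mem_thickening_iff.2 ⟨γ τ, mem_range_self τ, ?_⟩)⟩
  rwa [dist_eq_norm]

/-- Being linked is stable under perturbations of the set and of the translation. -/
theorem Linked.stable {K D : Set ℂ} {c : ℂ} (h : Linked K D c) (hD : IsClosed D) :
    ∃ η : ℝ, 0 < η ∧ ∀ (K' : Set ℂ) (c' : ℂ), (∀ x ∈ K, ∃ y ∈ K', ‖y - x‖ < η) → ‖c' - c‖ < η →
      Linked K' D c' := by
  obtain ⟨p₀, hp₀, p₁, hp₁, q₀, hq₀, q₁, hq₁, hp₀D, hp₁D, hq₀D, hq₁D, α, β, hα, hβ, k, hk, hn⟩ := h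
  have hc : ∀ x, x ∉ D → ∃ η : ℝ, 0 < η ∧ ∀ y, ‖y - x‖ < η → y ∉ D := fun x hx => by
    obtain ⟨η, hη, hs⟩ := Metric.isOpen_iff.1 hD.isOpen_compl x hx
    exact ⟨η, hη, fun y hy => hs (by rwa [mem_ball, dist_eq_norm])⟩
  obtain ⟨η₁, hη₁, h₁⟩ := hc _ hp₀D
  obtain ⟨η₂, hη₂, h₂⟩ := hc _ hp₁D
  obtain ⟨η₃, hη₃, h₃⟩ := hc _ hq₀D
  obtain ⟨η₄, hη₄, h₄⟩ := hc _ hq₁D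
  obtain ⟨η₅, hη₅, h₅⟩ := exists_thickening_of_range_subset isOpen_interior hα
  obtain ⟨η₆, hη₆, h₆⟩ := exists_thickening_of_range_subset isOpen_interior hβ
  obtain ⟨η₇, hη₇, h₇⟩ := exists_pos_lt_norm_of_hasWindingNumber hn
  -- Translated endpoints move by less than $2\eta$, one $\eta$ from the set and one from $c$. The
  -- difference loop compares two paths and so moves by less than $4\eta$.
  obtain ⟨η, hη, l₁, l₂, l₃, l₄, l₅, l₆, l₇⟩ : ∃ η : ℝ, 0 < η ∧ 2 * η ≤ η₁ ∧ 2 * η ≤ η₂ ∧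
      2 * η ≤ η₃ ∧ 2 * η ≤ η₄ ∧ 2 * η ≤ η₅ ∧ 2 * η ≤ η₆ ∧ 4 * η ≤ η₇ := by
    refine ⟨min η₁ (min η₂ (min η₃ (min η₄ (min η₅ (min η₆ η₇))))) / 4, by positivity, ?_⟩
    simp only [← le_div_iff₀' (show (0 : ℝ) < 2 by norm_num),
      ← le_div_iff₀' (show (0 : ℝ) < 4 by norm_num)]
    have hm : 0 < min η₁ (min η₂ (min η₃ (min η₄ (min η₅ (min η₆ η₇))))) := by positivity
    have h : ∀ m : ℝ, 0 < m →
        (m ≤ η₁ ∧ m ≤ η₂ ∧ m ≤ η₃ ∧ m ≤ η₄ ∧ m ≤ η₅ ∧ m ≤ η₆ ∧ m ≤ η₇) →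
        (m / 4 ≤ η₁ / 2 ∧ m / 4 ≤ η₂ / 2 ∧ m / 4 ≤ η₃ / 2 ∧ m / 4 ≤ η₄ / 2 ∧ m / 4 ≤ η₅ / 2 ∧
          m / 4 ≤ η₆ / 2 ∧ m / 4 ≤ η₇ / 4) := by
      rintro m hm ⟨a1, a2, a3, a4, a5, a6, a7⟩
      refine ⟨?_, ?_, ?_, ?_, ?_, ?_, ?_⟩ <;> linarith
    exact h _ hm (by simp only [← le_min_iff]; exact le_rfl)
  refine ⟨η, hη, fun K' c' hK' hc' => ?_⟩
  obtain ⟨p₀', hp₀', hp₀η⟩ := hK' _ hp₀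
  obtain ⟨p₁', hp₁', hp₁η⟩ := hK' _ hp₁
  obtain ⟨q₀', hq₀', hq₀η⟩ := hK' _ hq₀
  obtain ⟨q₁', hq₁', hq₁η⟩ := hK' _ hq₁
  have hsub : ∀ x x', ‖x' - x‖ < η → ‖(x' - c') - (x - c)‖ < 2 * η := fun x x' hx => by
    calc ‖(x' - c') - (x - c)‖ = ‖(x' - x) - (c' - c)‖ := by ring_nf
      _ ≤ ‖x' - x‖ + ‖c' - c‖ := norm_sub_le _ _
      _ < 2 * η := by linarith
  have hadd : ∀ x x', ‖x' - x‖ < η → ‖(x' + c') - (x + c)‖ < 2 * η := fun x x' hx => by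
    calc ‖(x' + c') - (x + c)‖ = ‖(x' - x) + (c' - c)‖ := by ring_nf
      _ ≤ ‖x' - x‖ + ‖c' - c‖ := norm_add_le _ _
      _ < 2 * η := by linarith
  have hαη := norm_perturbPath_sub_lt α hp₀η hp₁η
  have hβη := norm_perturbPath_sub_lt β hq₀η hq₁η
  refine ⟨p₀', hp₀', p₁', hp₁', q₀', hq₀', q₁', hq₁',
    h₁ _ ((hsub _ _ hp₀η).trans_le l₁), h₂ _ ((hsub _ _ hp₁η).trans_le l₂),
    h₃ _ ((hadd _ _ hq₀η).trans_le l₃), h₄ _ ((hadd _ _ hq₁η).trans_le l₄),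
    perturbPath α p₀' p₁', perturbPath β q₀' q₁', ?_, ?_, k, hk, ?_⟩
  · rintro _ ⟨τ, rfl⟩; exact h₅ τ _ ((hαη τ).trans_le (by linarith))
  · rintro _ ⟨τ, rfl⟩; exact h₆ τ _ ((hβη τ).trans_le (by linarith))
  · refine HasWindingNumber.of_close hn fun τ => ?_
    refine (norm_differenceLoop_sub_lt (η := 2 * η) (fun τ => (hαη τ).trans (by linarith))
      (fun τ => hadd _ _ (hβη τ)) τ).trans_le ?_
    linarith [h₇ τ]

/-! ## A compact set with two peaks is linked with a horizontal translate -/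

theorem nonempty_homeomorph_closedBall_of_image_eq {D R : Set ℂ} (e : ℂ ≃ₜ ℂ) (h : e '' D = R)
    (hconv : Convex ℝ R) (hR : IsCompact R) (hne : (interior R).Nonempty) :
    Nonempty (D ≃ₜ closedBall (0 : ℂ) 1) := by
  obtain ⟨e', -, he', -⟩ :=
    exists_homeomorph_image_interior_closure_frontier_eq_unitBall hconv hne hR.isBounded
  rw [hR.isClosed.closure_eq] at he'
  have : (e.trans e') '' D = closedBall 0 1 := by
    rw [← he', ← h, image_image]; rfl
  exact ⟨((e.trans e').image D).trans (Homeomorph.setCongr this)⟩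

/-- The vertical shear `x + i y ↦ x + i (y - φ x)`. -/
noncomputable def shear (φ : ℝ → ℝ) (hφ : Continuous φ) : ℂ ≃ₜ ℂ where
  toFun w := ⟨w.re, w.im - φ w.re⟩
  invFun w := ⟨w.re, w.im + φ w.re⟩
  left_inv w := by simp
  right_inv w := by simp
  continuous_toFun := by
    have : (fun w : ℂ => (⟨w.re, w.im - φ w.re⟩ : ℂ)) =
        fun w : ℂ => (w.re : ℂ) + ((w.im - φ w.re : ℝ) : ℂ) * Complex.I := by
      funext w; apply Complex.ext <;> simp
    rw [this]; fun_prop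
  continuous_invFun := by
    have : (fun w : ℂ => (⟨w.re, w.im + φ w.re⟩ : ℂ)) =
        fun w : ℂ => (w.re : ℂ) + ((w.im + φ w.re : ℝ) : ℂ) * Complex.I := by
      funext w; apply Complex.ext <;> simp
    rw [this]; fun_prop

/-- The part of the strip `|x| ≤ R` between the graphs of `φ - R` and `φ`. -/
def graphDisk (φ : ℝ → ℝ) (R : ℝ) : Set ℂ := {w | |w.re| ≤ R ∧ φ w.re - R ≤ w.im ∧ w.im ≤ φ w.re}

theorem nonempty_homeomorph_graphDisk {φ : ℝ → ℝ} (hφ : Continuous φ) {R : ℝ} (hR : 0 < R) :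
    Nonempty (graphDisk φ R ≃ₜ closedBall (0 : ℂ) 1) := by
  refine nonempty_homeomorph_closedBall_of_image_eq (shear φ hφ)
    (R := Icc (-R) R ×ℂ Icc (-R) 0) ?_ (((convex_Icc _ _).is_linear_preimage Complex.reLm.isLinear).inter
      ((convex_Icc _ _).is_linear_preimage Complex.imLm.isLinear))
    (isCompact_Icc.reProdIm isCompact_Icc) ?_
  · ext w
    constructor
    · rintro ⟨x, ⟨h1, h2, h3⟩, rfl⟩
      rw [Complex.mem_reProdIm]
      refine ⟨abs_le.1 h1, ?_, ?_⟩ <;> simp [shear] <;> linarith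
    · rintro ⟨h1, h2, h3⟩
      refine ⟨(shear φ hφ).symm w, ⟨abs_le.2 h1, ?_, ?_⟩, (shear φ hφ).apply_symm_apply w⟩
      · show φ w.re - R ≤ w.im + φ w.re
        have : -R ≤ w.im := h2
        linarith
      · show w.im + φ w.re ≤ φ w.re
        have : w.im ≤ 0 := h3
        linarith
  · rw [Complex.interior_reProdIm, interior_Icc, interior_Icc]
    exact ⟨⟨0, -R / 2⟩, ⟨by simpa using hR, by simpa using hR⟩,
      by show -R < -R / 2; linarith, by show -R / 2 < 0; linarith⟩

theorem subset_interior_graphDisk {φ : ℝ → ℝ} (hφ : Continuous φ) (R : ℝ) :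
    {w : ℂ | |w.re| < R ∧ φ w.re - R < w.im ∧ w.im < φ w.re} ⊆ interior (graphDisk φ R) := by
  refine interior_maximal (fun w hw => ⟨hw.1.le, hw.2.1.le, hw.2.2.le⟩) ?_
  have h1 : Continuous fun w : ℂ => φ w.re := hφ.comp Complex.continuous_re
  exact (isOpen_lt Complex.continuous_re.abs continuous_const).inter
    ((isOpen_lt (h1.sub continuous_const) Complex.continuous_im).inter
      (isOpen_lt Complex.continuous_im h1))

/-- The points $0,1$ of $K$ and $\sigma+t,1+\sigma+t$ of $K+t$ alternate on the real line. The disk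
is bounded above by a graph that passes over the real points of $K$ but under the four points that
have to stay outside, so the connecting paths run below the line. -/
theorem exists_linked_of_peaks {K : Set ℂ} (hK : IsCompact K) (hKim : ∀ x ∈ K, x.im ≤ 0)
    {σ t : ℝ} (hσ : 0 ≤ σ) (ht : 0 < t) (htσ : t < 1 - σ) (h0 : ((0 : ℝ) : ℂ) ∈ K)
    (h1 : (σ : ℂ) ∈ K) (h2 : ((1 : ℝ) : ℂ) ∈ K) (h3 : ((1 + σ : ℝ) : ℂ) ∈ K)
    (hgap : ∀ x : ℝ, (x : ℂ) ∈ K → (0 ≤ x ∧ x ≤ σ) ∨ (1 ≤ x ∧ x ≤ 1 + σ)) :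
    ∃ D : Set ℂ, Nonempty (D ≃ₜ closedBall (0 : ℂ) 1) ∧ K ⊆ interior D ∧ Linked K D t := by
  -- These are $p_i-t$ for $p_i=0,1$ and $q_i+t$ for $q_i=\sigma,1+\sigma$, the points that must
  -- avoid $D$.
  set F : Set ℝ := {-t, 1 - t, σ + t, 1 + σ + t} with hF
  have hFne : F.Nonempty := ⟨-t, by simp [hF]⟩
  have hFK : ∀ a ∈ F, (a : ℂ) ∉ K := by
    intro a ha haK
    simp only [hF, mem_insert_iff, mem_singleton_iff] at ha
    rcases ha with rfl | rfl | rfl | rfl <;> rcases hgap _ haK with h | h <;> linarith [h.1, h.2]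
  obtain ⟨δ, hδ, hdisj⟩ := Disjoint.exists_thickenings
    (s := (fun a : ℝ => (a : ℂ)) '' F) (t := K)
    (Set.disjoint_left.2 (by rintro _ ⟨a, ha, rfl⟩; exact hFK a ha))
    (((by simp [hF] : F.Finite).image _).isCompact) hK.isClosed
  have hsep : ∀ a ∈ F, ∀ w ∈ K, δ ≤ dist w (a : ℂ) := by
    intro a ha w hw
    by_contra! hlt
    exact Set.disjoint_left.1 hdisj (mem_thickening_iff.2 ⟨a, mem_image_of_mem _ ha, hlt⟩)
      (self_subset_thickening hδ _ hw)
  set η : ℝ := min (δ / 4) (1 / 2) with hη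
  have hη0 : 0 < η := by positivity
  have hηδ : 4 * η ≤ δ := by have := min_le_left (δ / 4) (1 / 2); linarith
  have hη1 : η ≤ 1 / 2 := min_le_right _ _
  -- Equal to $-\eta$ on $F$ and at least $\eta$ at distance $2\eta$ or more from $F$, in particular
  -- at the real points of $K$.
  set φ : ℝ → ℝ := fun x => min (infDist x F) 1 - η with hφ
  have hφc : Continuous φ := ((continuous_infDist_pt F).min continuous_const).sub continuous_const
  have hφ1 : ∀ x, φ x < 1 := fun x => by
    have := min_le_right (infDist x F) 1
    simp only [hφ]; linarith
  have hφη : ∀ x, -η ≤ φ x := fun x => by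
    have : 0 ≤ min (infDist x F) 1 := le_min infDist_nonneg zero_le_one
    simp only [hφ]; linarith
  have hφF : ∀ a ∈ F, φ a < 0 := fun a ha => by
    have : infDist a F = 0 := infDist_zero_of_mem ha
    simp only [hφ, this]; simp [hη0]
  have hφK : ∀ x : ℝ, (x : ℂ) ∈ K → 0 < φ x := fun x hx => by
    have h : 4 * η ≤ infDist x F := (le_infDist hFne).2 fun a ha => hηδ.trans (by
      have := hsep a ha _ hx
      rwa [dist_eq_norm, ← Complex.ofReal_sub, Complex.norm_real, ← dist_eq_norm] at this)
    have : 2 * η ≤ min (infDist x F) 1 := le_min (by linarith) (by linarith)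
    simp only [hφ]; linarith
  obtain ⟨r, hr⟩ := hK.isBounded.exists_norm_le
  have hr1 : 1 + σ ≤ r := by
    have := hr _ h3
    rwa [Complex.norm_real, Real.norm_of_nonneg (by linarith)] at this
  set R : ℝ := r + 2 with hR
  set G : Set ℂ := {w : ℂ | |w.re| < R ∧ φ w.re - R < w.im ∧ w.im < φ w.re} with hG
  have hGD : G ⊆ interior (graphDisk φ R) := subset_interior_graphDisk hφc R
  have hnotD : ∀ a ∈ F, (a : ℂ) ∉ graphDisk φ R := fun a ha h => by
    have h3 := h.2.2
    simp only [Complex.ofReal_im, Complex.ofReal_re] at h3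
    linarith [hφF a ha]
  have hKG : K ⊆ G := fun w hw => by
    have hre := (Complex.abs_re_le_norm w).trans (hr w hw)
    have him := abs_le.1 ((Complex.abs_im_le_norm w).trans (hr w hw))
    refine ⟨by linarith, by linarith [hφ1 w.re], ?_⟩
    -- A point of $K$ whose real part is within $2\eta$ of some $a\in F$ still has distance at least
    -- $4\eta$ from $a$, so it lies at depth more than $2\eta$, below the lowest value $-\eta$ of
    -- $\varphi$.
    by_cases hd : infDist w.re F < 2 * η
    · obtain ⟨a, ha, had⟩ := (infDist_lt_iff hFne).1 hd
      have hd2 := hsep a ha w hw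
      rw [dist_eq_norm] at hd2 had
      have h4 := Complex.norm_le_abs_re_add_abs_im (w - a)
      simp only [Complex.sub_re, Complex.sub_im, Complex.ofReal_re, Complex.ofReal_im,
        sub_zero] at h4
      rw [Real.norm_eq_abs] at had
      rw [abs_of_nonpos (hKim w hw)] at h4
      linarith [hφη w.re]
    · have : 2 * η ≤ min (infDist w.re F) 1 := le_min (by linarith) (by linarith)
      have h5 := hKim w hw
      simp only [hφ]; linarith
  -- The connection descends to height $-1$, runs horizontally, and rises again. Height $-1$ is
  -- below every value of $\varphi$ because $\eta\le 1/2$, and the choice $R=r+2$ keeps it above the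
  -- lower edge.
  have hjoin : ∀ x y : ℝ, (x : ℂ) ∈ K → (y : ℂ) ∈ K →
      JoinedIn (G ∩ {w | w.im ≤ 0}) (x : ℂ) (y : ℂ) := by
    have hvert : ∀ x : ℝ, (x : ℂ) ∈ K →
        JoinedIn (G ∩ {w | w.im ≤ 0}) (x : ℂ) (x - Complex.I) := by
      intro x hx
      have hre := hr _ hx
      rw [Complex.norm_real, Real.norm_eq_abs] at hre
      refine JoinedIn.of_segment_subset ?_
      rintro _ ⟨a, b, ha, hb, hab, rfl⟩
      have e1 : (a • (x : ℂ) + b • ((x : ℂ) - Complex.I)).re = x := by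
        simp only [Complex.add_re, Complex.real_smul, Complex.mul_re, Complex.ofReal_re,
          Complex.ofReal_im, Complex.sub_re, Complex.I_re]
        linear_combination x * hab
      have e2 : (a • (x : ℂ) + b • ((x : ℂ) - Complex.I)).im = -b := by simp
      refine ⟨⟨?_, ?_, ?_⟩, ?_⟩
      · rw [e1]; linarith
      · rw [e1, e2]; linarith [hφ1 x]
      · rw [e1, e2]; linarith [hφK x hx]
      · show Complex.im _ ≤ 0
        rw [e2]; linarith
    intro x y hx hy
    refine ((hvert x hx).trans (JoinedIn.of_segment_subset ?_)).trans (hvert y hy).symm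
    have hxr := hr _ hx
    have hyr := hr _ hy
    rw [Complex.norm_real, Real.norm_eq_abs] at hxr hyr
    rintro _ ⟨a, b, ha, hb, hab, rfl⟩
    have e1 : (a • ((x : ℂ) - Complex.I) + b • ((y : ℂ) - Complex.I)).re = a * x + b * y := by
      simp
    have e2 : (a • ((x : ℂ) - Complex.I) + b • ((y : ℂ) - Complex.I)).im = -1 := by
      simp; linarith
    have e3 : |a * x + b * y| ≤ r := by
      refine (abs_add_le _ _).trans ?_
      rw [abs_mul, abs_mul, abs_of_nonneg ha, abs_of_nonneg hb]
      nlinarith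
    refine ⟨⟨?_, ?_, ?_⟩, ?_⟩
    · rw [e1]; linarith
    · rw [e1, e2]; linarith [hφ1 (a * x + b * y)]
    · rw [e1, e2]; linarith [hφη (a * x + b * y)]
    · show Complex.im _ ≤ 0
      rw [e2]; norm_num
  refine ⟨graphDisk φ R, nonempty_homeomorph_graphDisk hφc (by linarith), hKG.trans hGD, ?_⟩
  have hα := hjoin 0 1 h0 h2
  have hβ := hjoin σ (1 + σ) h1 h3
  have m1 : ((-t : ℝ) : ℂ) ∉ graphDisk φ R := hnotD _ (by simp [hF])
  have m2 : ((1 - t : ℝ) : ℂ) ∉ graphDisk φ R := hnotD _ (by simp [hF])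
  have m3 : ((σ + t : ℝ) : ℂ) ∉ graphDisk φ R := hnotD _ (by simp [hF])
  have m4 : ((1 + σ + t : ℝ) : ℂ) ∉ graphDisk φ R := hnotD _ (by simp [hF])
  have hαD : ∀ τ, hα.somePath τ ∈ interior (graphDisk φ R) := fun τ => hGD (hα.somePath_mem τ).1
  have hβD : ∀ τ, hβ.somePath τ ∈ interior (graphDisk φ R) := fun τ => hGD (hβ.somePath_mem τ).1
  have hne : ∀ {x y : ℂ}, x ∈ interior (graphDisk φ R) → y ∉ graphDisk φ R → x ≠ y := by
    rintro x y hx hy rfl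
    exact hy (interior_subset hx)
  have key : ∀ (x y : ℂ) (β : Path x y), x = ((σ + t : ℝ) : ℂ) → y = ((1 + σ + t : ℝ) : ℂ) →
      (∀ τ, (β τ).im ≤ 0) → (∀ τ, β τ ≠ ((0 : ℝ) : ℂ)) → (∀ τ, β τ ≠ ((1 : ℝ) : ℂ)) →
      HasIntersectionNumber hα.somePath β (-1) := by
    rintro x y β rfl rfl b1 b2 b3
    exact hasIntersectionNumber_of_alternating (by linarith) (by linarith) (by linarith) _ β
      (fun τ => (hα.somePath_mem τ).2) b1 (fun τ => hne (hαD τ) m3) (fun τ => hne (hαD τ) m4) b2 b3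
  refine ⟨_, h0, _, h2, _, h1, _, h3, ?_, ?_, ?_, ?_, hα.somePath, hβ.somePath, ?_, ?_, -1,
    by norm_num, key _ _ _ (by push_cast; ring) (by push_cast; ring) (fun τ => ?_) (fun τ => ?_)
      (fun τ => ?_)⟩
  · rwa [show ((0 : ℝ) : ℂ) - t = ((-t : ℝ) : ℂ) by push_cast; ring]
  · rwa [show ((1 : ℝ) : ℂ) - t = ((1 - t : ℝ) : ℂ) by push_cast; ring]
  · rwa [show (σ : ℂ) + t = ((σ + t : ℝ) : ℂ) by push_cast; ring]
  · rwa [show ((1 + σ : ℝ) : ℂ) + t = ((1 + σ + t : ℝ) : ℂ) by push_cast; ring]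
  · rintro _ ⟨τ, rfl⟩; exact hαD τ
  · rintro _ ⟨τ, rfl⟩; exact hβD τ
  · show (hβ.somePath τ + (t : ℂ)).im ≤ 0
    rw [Complex.add_im, Complex.ofReal_im, add_zero]
    exact (hβ.somePath_mem τ).2
  · show hβ.somePath τ + (t : ℂ) ≠ ((0 : ℝ) : ℂ)
    intro h
    refine hne (hβD τ) m1 ?_
    rw [eq_sub_of_add_eq h]; push_cast; ring
  · show hβ.somePath τ + (t : ℂ) ≠ ((1 : ℝ) : ℂ)
    intro h
    refine hne (hβD τ) m2 ?_
    rw [eq_sub_of_add_eq h]; push_cast; ring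

/-! ## The top face of the convex hull of the limit set -/

/-- The absolute values of the real powers of `z`, the zeroth excepted. -/
noncomputable def realPower (z : ℂ) (j : ℕ) : ℝ :=
  if j = 0 then 0 else if (z ^ j).im = 0 then |(z ^ j).re| else 0

theorem realPower_nonneg (z : ℂ) (j : ℕ) : 0 ≤ realPower z j := by
  unfold realPower; split_ifs <;> positivity

theorem realPower_le (z : ℂ) (j : ℕ) : realPower z j ≤ ‖z‖ ^ j := by
  unfold realPower
  split_ifs
  · positivity
  · rw [← norm_pow]; exact Complex.abs_re_le_norm _
  · positivity

theorem summable_realPower {z : ℂ} (hz : ‖z‖ < 1) : Summable (realPower z) :=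
  Summable.of_nonneg_of_le (realPower_nonneg z) (realPower_le z)
    (summable_geometric_of_lt_one (norm_nonneg z) hz)

theorem dvd_of_im_pow_eq_zero {z : ℂ} (hz : z ≠ 0) {q : ℕ} (hq : 0 < q) (hqim : (z ^ q).im = 0)
    (hmin : ∀ m, 0 < m → m < q → (z ^ m).im ≠ 0) {j : ℕ} (hj : (z ^ j).im = 0) : q ∣ j := by
  have hreal : z ^ q = ((z ^ q).re : ℂ) := Complex.ext rfl (by simpa using hqim)
  have hc : (z ^ q).re ≠ 0 := fun h => by
    rw [h] at hreal
    exact pow_ne_zero q hz (by simpa using hreal)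
  have hsplit : z ^ j = (((z ^ q).re ^ (j / q) : ℝ) : ℂ) * z ^ (j % q) := by
    conv_lhs => rw [← Nat.div_add_mod j q, pow_add, pow_mul, hreal]
    push_cast; rfl
  rw [hsplit, Complex.im_ofReal_mul, mul_eq_zero, or_iff_right (pow_ne_zero _ hc)] at hj
  by_contra hnd
  exact hmin _ (Nat.pos_of_ne_zero fun h => hnd (Nat.dvd_of_mod_eq_zero h)) (Nat.mod_lt _ hq) hj

/-- If $q$ is the least positive exponent with $z^q$ real, the real powers are those with exponents
divisible by $q$. The sum is then at most $r/(1-r)$ with $r=|z|^q<1/2$. -/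
theorem tsum_realPower_lt_one {z : ℂ} (hz0 : z ≠ 0) (hz : ‖z‖ < 1)
    (h : ∀ q, 0 < q → (z ^ q).im = 0 → ‖z‖ ^ q < 1 / 2) : ∑' j, realPower z j < 1 := by
  classical
  by_cases hex : ∃ q, 0 < q ∧ (z ^ q).im = 0
  · obtain ⟨hq, hqim⟩ := Nat.find_spec hex
    set q := Nat.find hex with hqdef
    have hmin : ∀ m, 0 < m → m < q → (z ^ m).im ≠ 0 := fun m hm hmq him =>
      Nat.find_min hex hmq ⟨hm, him⟩
    have hinj : Function.Injective fun k : ℕ => q * (k + 1) := fun k l hkl => by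
      have := Nat.eq_of_mul_eq_mul_left hq hkl
      omega
    have hsupp : Function.support (realPower z) ⊆ range fun k : ℕ => q * (k + 1) := by
      intro j hj
      rw [Function.mem_support] at hj
      unfold realPower at hj
      split_ifs at hj with h1 h2
      · exact absurd rfl hj
      · obtain ⟨m, rfl⟩ := dvd_of_im_pow_eq_zero hz0 hq hqim hmin h2
        refine ⟨m - 1, ?_⟩
        have : m ≠ 0 := by rintro rfl; simp at h1
        show q * (m - 1 + 1) = q * m
        congr 1; omega
      · exact absurd rfl hj
    rw [← hinj.tsum_eq hsupp]
    set r := ‖z‖ ^ q with hr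
    have hr0 : 0 ≤ r := by positivity
    have hr1 : r < 1 / 2 := h q hq hqim
    have hg : HasSum (fun k : ℕ => r * r ^ k) (r * (1 - r)⁻¹) :=
      (hasSum_geometric_of_lt_one hr0 (by linarith)).mul_left r
    have hle : ∀ k : ℕ, realPower z (q * (k + 1)) ≤ r * r ^ k := fun k => by
      refine (realPower_le z _).trans_eq ?_
      rw [pow_mul, ← hr, pow_succ']
    calc ∑' k : ℕ, realPower z (q * (k + 1)) ≤ ∑' k : ℕ, r * r ^ k :=
          ((summable_realPower hz).comp_injective hinj).tsum_le_tsum hle hg.summable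
      _ = r * (1 - r)⁻¹ := hg.tsum_eq
      _ < 1 := by rw [← div_eq_mul_inv, div_lt_one (by linarith)]; linarith
  · push Not at hex
    have : ∀ j, realPower z j = 0 := fun j => by
      unfold realPower
      split_ifs with h1 h2
      · rfl
      · exact absurd h2 (hex j (Nat.pos_of_ne_zero h1))
      · rfl
    simp [this]

/-- The digits of the left end of the top face. -/
noncomputable def leftDigit (z : ℂ) (j : ℕ) : ℂ :=
  if j = 0 then 0 else if 0 < (z ^ j).im ∨ ((z ^ j).im = 0 ∧ (z ^ j).re < 0) then 1 else 0

/-- The digits of the right end of the left half of the top face. -/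
noncomputable def rightDigit (z : ℂ) (j : ℕ) : ℂ :=
  if j = 0 then 0 else if 0 < (z ^ j).im ∨ ((z ^ j).im = 0 ∧ 0 < (z ^ j).re) then 1 else 0

theorem leftDigit_mem (z : ℂ) : leftDigit z ∈ seqIn {0, 1} := fun j => by
  unfold leftDigit; split_ifs <;> simp

theorem rightDigit_mem (z : ℂ) : rightDigit z ∈ seqIn {0, 1} := fun j => by
  unfold rightDigit; split_ifs <;> simp

theorem seqIn_subset_unitSeq : seqIn {0, 1} ⊆ unitSeq := fun d hd j => by
  have := hd j
  simp only [mem_insert_iff, mem_singleton_iff] at this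
  rcases this with h | h <;> simp [h]

/-- Change the digit of index `0` to `1`. -/
def setOne (d : ℕ → ℂ) (j : ℕ) : ℂ := if j = 0 then 1 else d j

theorem setOne_mem {d : ℕ → ℂ} (hd : d ∈ seqIn {0, 1}) : setOne d ∈ seqIn {0, 1} := fun j => by
  unfold setOne; split_ifs
  · simp
  · exact hd j

theorem digitSum_setOne {d : ℕ → ℂ} (hd : d ∈ seqIn {0, 1}) (h0 : d 0 = 0) {z : ℂ}
    (hz : ‖z‖ < 1) : digitSum (setOne d) z = 1 + digitSum d z := by
  rw [digitSum_split (seqIn_subset_unitSeq (setOne_mem hd)) hz 1,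
    digitSum_split (seqIn_subset_unitSeq hd) hz 1]
  simp [setOne, h0]

theorem hasSum_sub_leftDigit {a : ℕ → ℂ} (ha : a ∈ seqIn {0, 1}) {z : ℂ} (hz : ‖z‖ < 1) :
    HasSum (fun j => (a j - leftDigit z j) * z ^ j) (digitSum a z - digitSum (leftDigit z) z) := by
  have h := (summable_digit (seqIn_subset_unitSeq ha) hz).hasSum.sub
    (summable_digit (seqIn_subset_unitSeq (leftDigit_mem z)) hz).hasSum
  simp only [← sub_mul] at h
  exact h

/-- The left digits maximize the imaginary part term by term, so the value they give is a highest
point of the digit set. -/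
theorem im_term_nonpos {a : ℕ → ℂ} (ha : a ∈ seqIn {0, 1}) (z : ℂ) (j : ℕ) :
    ((a j - leftDigit z j) * z ^ j).im ≤ 0 := by
  have := ha j
  simp only [mem_insert_iff, mem_singleton_iff] at this
  unfold leftDigit
  rcases this with h | h <;> rw [h] <;> split_ifs with h1 h2
  all_goals first
    | (subst h1; simp)
    | (simp; rcases h2 with h2 | h2 <;> linarith)
    | (simp at h2 ⊢; linarith [h2.1])
    | simp

/-- On the top face only digits at real powers remain free; there the left digit minimizes the real
part and the freedom is $|z^j|$. At a nonreal power the digit is forced. -/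
theorem re_term_bounds {a : ℕ → ℂ} (ha : a ∈ seqIn {0, 1}) (z : ℂ) {j : ℕ}
    (him : ((a j - leftDigit z j) * z ^ j).im = 0) (hj : j ≠ 0) :
    0 ≤ ((a j - leftDigit z j) * z ^ j).re ∧
      ((a j - leftDigit z j) * z ^ j).re ≤ realPower z j := by
  have := ha j
  simp only [mem_insert_iff, mem_singleton_iff] at this
  by_cases him0 : (z ^ j).im = 0
  · rw [realPower, if_neg hj, if_pos him0, leftDigit, if_neg hj]
    rcases this with h | h <;> rw [h] <;> split_ifs with h2
    · simp only [him0, lt_irrefl, false_or, true_and] at h2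
      simp [h2.le, neg_le_abs]
    · simp
    · simp
    · simp only [him0, lt_irrefl, false_or, true_and, not_lt] at h2
      simp [h2, le_abs_self]
  · have : a j - leftDigit z j = 0 := by
      rw [leftDigit, if_neg hj] at him ⊢
      rcases this with h | h <;> rw [h] at him ⊢ <;> split_ifs at him ⊢ <;>
        simp [him0] at him ⊢
    rw [this, zero_mul]
    exact ⟨le_rfl, realPower_nonneg z j⟩

theorem digitSum_rightDigit {z : ℂ} (hz : ‖z‖ < 1) :
    digitSum (rightDigit z) z - digitSum (leftDigit z) z = ((∑' j, realPower z j : ℝ) : ℂ) := by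
  refine (hasSum_sub_leftDigit (rightDigit_mem z) hz).unique ?_
  convert Complex.hasSum_ofReal.2 (summable_realPower hz).hasSum using 1
  funext j
  by_cases hj : j = 0
  · simp [rightDigit, leftDigit, realPower, hj]
  simp only [rightDigit, leftDigit, realPower, hj, if_false]
  rcases lt_trichotomy (z ^ j).im 0 with him | him | him
  · simp [him.not_gt, him.ne]
  · have hreal : z ^ j = ((z ^ j).re : ℂ) := Complex.ext rfl (by simpa using him)
    simp only [him, lt_irrefl, false_or, true_and, if_true]
    rw [hreal, Complex.ofReal_re]
    rcases lt_trichotomy (z ^ j).re 0 with hre | hre | hre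
    · simp [hre, hre.not_gt, abs_of_neg hre]
    · simp [hre]
    · simp [hre, hre.not_gt, abs_of_pos hre]
  · simp [him, him.ne']

/-- After moving the left end of the top face to $0$, the face meets the digit set inside
$[0,\sigma]\cup[1,1+\sigma]$. The two pieces correspond to the choice of the digit at index $0$, and
$\sigma<1$ separates them. -/
theorem exists_linked_lambdaSet {z : ℂ} (hz0 : z ≠ 0) (hz : ‖z‖ < 1)
    (h : ∀ q, 0 < q → (z ^ q).im = 0 → ‖z‖ ^ q < 1 / 2) :
    ∃ (c : ℂ) (D : Set ℂ), Nonempty (D ≃ₜ closedBall (0 : ℂ) 1) ∧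
      LambdaSet z ⊆ interior D ∧ Linked (LambdaSet z) D c := by
  set σ : ℝ := ∑' j, realPower z j with hσ
  have hσ0 : 0 ≤ σ := tsum_nonneg (realPower_nonneg z)
  have hσ1 : σ < 1 := tsum_realPower_lt_one hz0 hz h
  set P : ℂ := digitSum (leftDigit z) z with hP
  set K : Set ℂ := (fun a => digitSum a z - P) '' seqIn {0, 1} with hK
  have hKc : IsCompact K := (isCompact_seqIn (by simp)).image_of_continuousOn
    (((continuousOn_digitSum_seq hz).mono seqIn_subset_unitSeq).sub continuousOn_const)
  have hw : (1 : ℂ) - z ≠ 0 := one_sub_ne_zero hz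
  have hΛ : (fun x => (1 - z) * x + (1 - z) * P) '' K = LambdaSet z := by
    rw [LambdaSet, limitSet_eq hz (by simp) (by simp), hK, image_image]
    refine image_congr fun a _ => ?_
    ring
  have hmem : ∀ a ∈ seqIn {0, 1}, ∀ x : ℂ, digitSum a z - P = x → x ∈ K := by
    rintro a ha _ rfl
    exact ⟨a, ha, rfl⟩
  have hr := digitSum_rightDigit hz
  -- The shift is half the gap between the two pieces of the face; the arguments that follow locate
  -- the peaks and the gap.
  obtain ⟨D, hD, hKD, hL⟩ := exists_linked_of_peaks (K := K) (σ := σ) (t := (1 - σ) / 2) hKc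
    (by
      rintro _ ⟨a, ha, rfl⟩
      have hs := (Complex.hasSum_iff _ _).1 (hasSum_sub_leftDigit ha hz)
      exact hs.2.nonpos (im_term_nonpos ha z)) hσ0 (by linarith) (by linarith)
    (hmem _ (leftDigit_mem z) _ (by simp [hP]))
    (hmem _ (rightDigit_mem z) _ hr)
    (hmem _ (setOne_mem (leftDigit_mem z)) _ (by
      rw [digitSum_setOne (leftDigit_mem z) (by simp [leftDigit]) hz]; simp [hP]))
    (hmem _ (setOne_mem (rightDigit_mem z)) _ (by
      rw [digitSum_setOne (rightDigit_mem z) (by simp [rightDigit]) hz]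
      push_cast; rw [← hr]; ring))
    (by
      rintro x ⟨a, ha, hax⟩
      have hsum := hasSum_sub_leftDigit ha hz
      simp only at hax
      rw [hax, Complex.hasSum_iff] at hsum
      -- Nonpositive imaginary parts whose sum is zero all vanish.
      have him : ∀ j, ((a j - leftDigit z j) * z ^ j).im = 0 := fun j => by
        have h0 := (hasSum_zero_iff_of_nonneg
          (f := fun j => -((a j - leftDigit z j) * z ^ j).im)
          (fun j => neg_nonneg.2 (im_term_nonpos ha z j))).1 (by simpa using hsum.2.neg)
        exact neg_eq_zero.1 (congrFun h0 j)
      have hre := hsum.1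
      -- Removing the term at index $0$ leaves a real part in $[0,\sigma]$; that term is $0$ or $1$
      -- and selects the piece.
      have hsplit := hasSum_ite_sub_hasSum hre 0
      have hlo : 0 ≤ ((x : ℂ)).re - ((a 0 - leftDigit z 0) * z ^ 0).re := hsplit.nonneg fun j => by
        split_ifs with hj
        exacts [le_rfl, (re_term_bounds ha z (him j) hj).1]
      have hhi : ((x : ℂ)).re - ((a 0 - leftDigit z 0) * z ^ 0).re ≤ σ :=
        hasSum_le (fun j => by
          split_ifs with hj
          exacts [realPower_nonneg z j, (re_term_bounds ha z (him j) hj).2]) hsplit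
          (summable_realPower hz).hasSum
      have ha0 := ha 0
      simp only [mem_insert_iff, mem_singleton_iff] at ha0
      rcases ha0 with ha0 | ha0 <;> simp [ha0, leftDigit] at hlo hhi
      · exact Or.inl ⟨hlo, hhi⟩
      · exact Or.inr ⟨hlo, by linarith⟩)
  have hopen : IsOpenMap fun x : ℂ => (1 - z) * x + (1 - z) * P :=
    ((Homeomorph.mulLeft₀ (1 - z) hw).trans (Homeomorph.addRight ((1 - z) * P))).isOpenMap
  obtain ⟨e⟩ := hD
  refine ⟨_, _, ⟨((((Homeomorph.mulLeft₀ (1 - z) hw).trans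
    (Homeomorph.addRight ((1 - z) * P))).image D).symm).trans e⟩, ?_, hΛ ▸ hL.affine hw ((1 - z) * P)⟩
  rw [← hΛ]
  exact (image_mono hKD).trans (interior_maximal (image_mono interior_subset)
    (hopen _ isOpen_interior))

/-! ## Crossings and traps -/

/-- `Λ_z` and `Λ_z + c` are linked inside a disk that contains a suitable neighbourhood of `Λ_z`. -/
def Crossing (z c : ℂ) : Prop :=
  ∃ D : Set ℂ, Nonempty (D ≃ₜ closedBall (0 : ℂ) 1) ∧ Linked (LambdaSet z) D c ∧
    ∃ ε ε' : ℝ, 0 < ε ∧ ε < ε' ∧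
      (∃ U V : ℕ → Letter, U 0 = Letter.f ∧ V 0 = Letter.g ∧
        dist (codingMap U z) (codingMap V z) < ε) ∧
      thickening (ε' / 2) (LambdaSet z) ⊆ D

theorem codingMap_equicontinuousAt {ω : ℂ} (hω : ‖ω‖ < 1) {η : ℝ} (hη : 0 < η) :
    ∀ᶠ z in 𝓝 ω, ‖z‖ < 1 ∧ ∀ U, ‖codingMap U z - codingMap U ω‖ < η := by
  have hlim : Tendsto (fun z : ℂ => ‖z - ω‖ * (1 - ‖ω‖)⁻¹) (𝓝 ω) (𝓝 (‖ω - ω‖ * (1 - ‖ω‖)⁻¹)) :=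
    Continuous.tendsto (by fun_prop) ω
  rw [sub_self, norm_zero, zero_mul] at hlim
  filter_upwards [digitSum_equicontinuousAt hω (η := η / 4) (by linarith),
    hlim.eventually (gt_mem_nhds (half_pos hη))] with z hz hz2
  refine ⟨hz.1, fun U => ?_⟩
  have hU := centers_mem_unitSeq U
  rw [codingMap_eq hz.1, codingMap_eq hω]
  have h1 : ‖1 - z‖ ≤ 2 := (norm_sub_le _ _).trans (by rw [norm_one]; linarith [hz.1])
  calc ‖(1 - z) * digitSum (centers U) z - (1 - ω) * digitSum (centers U) ω‖
      = ‖(1 - z) * (digitSum (centers U) z - digitSum (centers U) ω) -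
          (z - ω) * digitSum (centers U) ω‖ := by ring_nf
    _ ≤ ‖1 - z‖ * ‖digitSum (centers U) z - digitSum (centers U) ω‖ +
          ‖z - ω‖ * ‖digitSum (centers U) ω‖ := by
        refine (norm_sub_le _ _).trans ?_
        rw [norm_mul, norm_mul]
    _ ≤ 2 * (η / 4) + ‖z - ω‖ * (1 - ‖ω‖)⁻¹ := by
        gcongr
        · exact (hz.2 _ hU).le
        · exact norm_digitSum_le hU hω
    _ < η := by linarith

theorem isClosed_of_homeomorph_closedBall {D : Set ℂ}
    (h : Nonempty (D ≃ₜ closedBall (0 : ℂ) 1)) : IsClosed D := by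
  obtain ⟨e⟩ := h
  have : CompactSpace (closedBall (0 : ℂ) 1) :=
    isCompact_iff_compactSpace.1 (isCompact_closedBall _ _)
  have : CompactSpace D := e.symm.compactSpace
  exact (isCompact_iff_compactSpace.2 this).isClosed

/-- The strict inequalities in `Crossing` leave room: the set moves uniformly little with $z$, so
the same disk, the same $\varepsilon$ and the same pair of infinite words serve, with $\varepsilon'$
replaced by the mean of $\varepsilon$ and $\varepsilon'$. -/
theorem Crossing.eventually {z₀ c₀ : ℂ} (h : Crossing z₀ c₀) (hz₀ : ‖z₀‖ < 1) :
    ∀ᶠ p : ℂ × ℂ in 𝓝 (z₀, c₀), Crossing p.1 p.2 := by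
  obtain ⟨D, hD, hL, ε, ε', hε, hεε', ⟨U, V, hU, hV, hUV⟩, hthick⟩ := h
  obtain ⟨η, hη, hst⟩ := hL.stable (isClosed_of_homeomorph_closedBall hD)
  have hcd := codingMap_equicontinuousAt hz₀ (η := min η
    (min ((ε' - ε) / 4) ((ε - dist (codingMap U z₀) (codingMap V z₀)) / 2)))
    (by have h1 := sub_pos.2 hεε'; have h2 := sub_pos.2 hUV; positivity)
  have hc : ∀ᶠ c in 𝓝 c₀, ‖c - c₀‖ < η := by
    filter_upwards [ball_mem_nhds c₀ hη] with c hc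
    rwa [mem_ball, dist_eq_norm] at hc
  rw [nhds_prod_eq]
  filter_upwards [hcd.prod_mk hc] with p ⟨⟨hp1, hp2⟩, hp3⟩
  simp only [lt_min_iff] at hp2
  refine ⟨D, hD, hst _ _ (fun x hx => ?_) hp3, ε, (ε + ε') / 2, hε, by linarith,
    ⟨U, V, hU, hV, ?_⟩, fun x hx => ?_⟩
  · rw [lambdaSet_eq hz₀] at hx
    obtain ⟨W, rfl⟩ := hx
    exact ⟨_, codingMap_mem_lambdaSet hp1 W, (hp2 W).1⟩
  · have h1 := (hp2 U).2.2
    have h2 := (hp2 V).2.2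
    rw [← dist_eq_norm] at h1 h2
    have := dist_triangle4 (codingMap U p.1) (codingMap U z₀) (codingMap V z₀) (codingMap V p.1)
    rw [dist_comm (codingMap V z₀)] at this
    linarith
  · obtain ⟨y, hy, hxy⟩ := mem_thickening_iff.1 hx
    rw [lambdaSet_eq hp1] at hy
    obtain ⟨W, rfl⟩ := hy
    refine hthick (mem_thickening_iff.2 ⟨_, codingMap_mem_lambdaSet hz₀ W, ?_⟩)
    have h1 := (hp2 W).2.1
    rw [← dist_eq_norm] at h1
    have := dist_triangle x (codingMap W p.1) (codingMap W z₀)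
    simp only at hxy
    linarith

theorem codingMap_eq_wordMap_singleton {z : ℂ} (hz : ‖z‖ < 1) (U : ℕ → Letter) :
    codingMap U z = wordMap z [U 0] (codingMap (fun j => U (1 + j)) z) := by
  have h := digitSum_split (centers_mem_unitSeq U) hz 1
  rw [codingMap_eq hz, codingMap_eq hz, h]
  simp only [wordMap, dilationWord, dilation, List.map_cons, List.map_nil, Finset.range_one,
    Finset.sum_singleton, pow_zero, pow_one, mul_one]
  have e1 : centers U 0 = (U 0).center := rfl
  have e2 : (fun j => centers U (1 + j)) = centers fun j => U (1 + j) := rfl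
  rw [e1, e2]
  ring

/-- The translation that carries `v Λ_z` to `Λ_z` when `u Λ_z` is carried to `Λ_z`, for words `u, v`
of length `m` whose differences of centres are the first `m` terms of `e`. -/
noncomputable def offset (e : ℕ → ℂ) (m : ℕ) (z : ℂ) : ℂ :=
  -((1 - z) * ∑ j ∈ Finset.range m, e j * z ^ j) / z ^ m

theorem head?_wordPrefix (U : ℕ → Letter) {m : ℕ} (hm : 0 < m) :
    (wordPrefix U m).head? = some (U 0) := by
  obtain ⟨k, rfl⟩ := Nat.exists_eq_succ_of_ne_zero hm.ne'
  simp [wordPrefix, List.range_succ_eq_map]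

theorem length_wordPrefix (U : ℕ → Letter) (m : ℕ) : (wordPrefix U m).length = m := by
  simp [wordPrefix]

/-- Here $v(x)=u(x+c)$ with $u$ affine, so $u$ carries the linked pair $\Lambda_z,\Lambda_z+c$ to
$u\Lambda_z,v\Lambda_z$ and preserves the intersection number. -/
theorem hasTrap_of_crossing {z : ℂ} (hz0 : z ≠ 0) (hz : ‖z‖ < 1) {e : ℕ → ℂ}
    (he : e ∈ seqIn signs) (he0 : e 0 = -1) {m : ℕ} (hm : 0 < m)
    (h : Crossing z (offset e m z)) : HasTrap z := by
  obtain ⟨U, V, hUV, hlet⟩ := exists_centerDiff_eq he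
  obtain ⟨D, hD, hL, ε, ε', hε, hεε', ⟨X, Y, hX, hY, hXY⟩, hthick⟩ := h
  have hzm : z ^ m ≠ 0 := pow_ne_zero _ hz0
  set c := offset e m z with hc
  have hu : ∀ x, wordMap z (wordPrefix U m) x = z ^ m * x + wordPoly (wordPrefix U m) z :=
    fun x => by rw [wordMap_eq, length_wordPrefix, mul_comm]
  have hv : ∀ x, wordMap z (wordPrefix V m) x = z ^ m * (x + c) + wordPoly (wordPrefix U m) z :=
    fun x => by
      rw [wordMap_eq, length_wordPrefix, wordPoly_wordPrefix, wordPoly_wordPrefix, mul_add, hc,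
        offset, mul_div_cancel₀ _ hzm, ← hUV]
      simp only [centerDiff, sub_mul, Finset.sum_sub_distrib]
      ring
  have hinj : ∀ x y : ℂ, z ^ m * x + wordPoly (wordPrefix U m) z =
      z ^ m * y + wordPoly (wordPrefix U m) z → x = y := fun x y hxy =>
    mul_left_cancel₀ hzm (add_right_cancel hxy)
  have hcu : Continuous (wordMap z (wordPrefix U m)) := by
    rw [funext hu]; fun_prop
  have hcv : Continuous (wordMap z (wordPrefix V m)) := by
    rw [funext hv]; fun_prop
  obtain ⟨p₀, hp₀, p₁, hp₁, q₀, hq₀, q₁, hq₁, hp₀D, hp₁D, hq₀D, hq₁D, α, β, hα, hβ, k, hk, hn⟩ := hL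
  have hnu : ∀ p, p - c ∉ D → wordMap z (wordPrefix U m) p ∉ wordMap z (wordPrefix V m) '' D := by
    rintro p hp ⟨x, hx, hxp⟩
    rw [hu, hv] at hxp
    exact hp (by rw [← hinj _ _ hxp, add_sub_cancel_right]; exact hx)
  have hnv : ∀ q, q + c ∉ D → wordMap z (wordPrefix V m) q ∉ wordMap z (wordPrefix U m) '' D := by
    rintro q hq ⟨x, hx, hxq⟩
    rw [hu, hv] at hxq
    exact hq (by rw [← hinj _ _ hxq]; exact hx)
  have hmemf : ∀ (W : ℕ → Letter), codingMap W z ∈ wordMap z [W 0] '' LambdaSet z := fun W =>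
    ⟨_, codingMap_mem_lambdaSet hz _, (codingMap_eq_wordMap_singleton hz W).symm⟩
  refine ⟨D, wordPrefix U m, wordPrefix V m, hD, ?_, ?_, ?_, ?_, ε, hε, ?_, ?_⟩
  · exact interior_maximal hthick isOpen_thickening |>.trans' (self_subset_thickening (by linarith) _)
  · rw [head?_wordPrefix U hm, (hlet 0 he0).1]
  · rw [head?_wordPrefix V hm, (hlet 0 he0).2]
  · refine ⟨_, ⟨mem_image_of_mem _ hp₀, hnu _ hp₀D⟩, _, ⟨mem_image_of_mem _ hp₁, hnu _ hp₁D⟩,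
      _, ⟨mem_image_of_mem _ hq₀, hnv _ hq₀D⟩, _, ⟨mem_image_of_mem _ hq₁, hnv _ hq₁D⟩,
      α.map hcu, β.map hcv, ?_, ?_, k, hk,
      HasIntersectionNumber.affine (w := z ^ m) (e := wordPoly (wordPrefix U m) z) hn hzm
        (fun τ => hu _) (fun τ => hv _)⟩
    · rintro _ ⟨τ, rfl⟩; exact mem_image_of_mem _ (interior_subset (hα ⟨τ, rfl⟩))
    · rintro _ ⟨τ, rfl⟩; exact mem_image_of_mem _ (interior_subset (hβ ⟨τ, rfl⟩))
  · exact ⟨_, hX ▸ hmemf X, _, hY ▸ hmemf Y, hXY.le⟩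
  · exact (thickening_mono (by linarith) _).trans hthick

/-- Some crossing for `z` is realized by a pair of words. -/
def IsGood (z : ℂ) : Prop :=
  ∃ e ∈ seqIn signs, ∃ m : ℕ, e 0 = -1 ∧ 0 < m ∧ Crossing z (offset e m z)

theorem IsGood.hasTrap {z : ℂ} (h : IsGood z) (hz0 : z ≠ 0) (hz : ‖z‖ < 1) : HasTrap z := by
  obtain ⟨e, he, m, he0, hm, hc⟩ := h
  exact hasTrap_of_crossing hz0 hz he he0 hm hc

theorem IsGood.eventually {z₀ : ℂ} (h : IsGood z₀) (hz0 : z₀ ≠ 0) (hz : ‖z₀‖ < 1) :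
    ∀ᶠ z in 𝓝 z₀, IsGood z := by
  obtain ⟨e, he, m, he0, hm, hc⟩ := h
  have hcont : ContinuousAt (fun z => (z, offset e m z)) z₀ := by
    refine continuousAt_id.prodMk (ContinuousAt.div ?_ ?_ (pow_ne_zero _ hz0))
    · exact Continuous.continuousAt (by fun_prop)
    · exact Continuous.continuousAt (by fun_prop)
  filter_upwards [hcont.eventually (hc.eventually hz)] with z hz
  exact ⟨e, he, m, he0, hm, hz⟩

/-- A coincidence makes the distance between $f\Lambda_z$ and $g\Lambda_z$ zero, so the closeness
condition holds for whatever collar the linking disk leaves around $\Lambda_z$. -/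
theorem exists_crossing {z : ℂ} (hz0 : z ≠ 0) (hz : ‖z‖ < 1) (hco : IsCoincident z)
    (h : ∀ q, 0 < q → (z ^ q).im = 0 → ‖z‖ ^ q < 1 / 2) : ∃ c, Crossing z c := by
  obtain ⟨c, D, hD, hΛ, hL⟩ := exists_linked_lambdaSet hz0 hz h
  obtain ⟨δ, hδ, hs⟩ := (isCompact_lambdaSet hz).exists_thickening_subset_open isOpen_interior hΛ
  obtain ⟨d, hd, hd0, hdz⟩ := hco
  obtain ⟨U, V, hUV, hlet⟩ := exists_centerDiff_eq hd
  refine ⟨c, D, hD, hL, δ, 2 * δ, hδ, by linarith,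
    ⟨U, V, (hlet 0 hd0).1, (hlet 0 hd0).2, ?_⟩, ?_⟩
  · rw [dist_eq_norm, codingMap_sub_codingMap hz, hUV, hdz, mul_zero, norm_zero]
    exact hδ
  · rw [mul_div_cancel_left₀ _ two_ne_zero]
    exact hs.trans interior_subset

/-! ## Perturbing a coincidence -/

/-- If the power series with digits `d` vanishes at `z₀`, then near `z₀` one can prescribe the value
of its normalized partial sums. -/
theorem exists_partialSum_zero {d : ℕ → ℂ} (hd : d ∈ unitSeq) (hd0 : d 0 ≠ 0) {z₀ : ℂ}
    (hz : ‖z₀‖ < 1) (hdz : digitSum d z₀ = 0) (c : ℂ) {N : Set ℂ} (hN : N ∈ 𝓝 z₀) :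
    ∃ z ∈ N, ∃ m : ℕ, 0 < m ∧ ∑ j ∈ Finset.range m, d j * z ^ j + z ^ m * c = 0 := by
  have han : AnalyticOnNhd ℂ (digitSum d) (ball 0 1) :=
    (differentiableOn_digitSum hd).analyticOnNhd isOpen_ball
  have hz₀ : z₀ ∈ ball (0 : ℂ) 1 := by simpa using hz
  have hiso : ∀ᶠ z in 𝓝[≠] z₀, digitSum d z ≠ 0 := by
    -- A series vanishing identically near $z_0$ would vanish at $0$, contradicting its nonzero
    -- constant term. Hence the zero $z_0$ is isolated.
    rcases (han z₀ hz₀).eventually_eq_zero_or_eventually_ne_zero with h | h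
    · have h0 := han.eqOn_zero_of_preconnected_of_eventuallyEq_zero
        (convex_ball _ _).isPreconnected hz₀ h (x := 0) (by simp)
      exfalso
      refine hd0 ?_
      rw [digitSum_split hd (by simp) 1] at h0
      simpa using h0
    · exact h
  rw [eventually_nhdsWithin_iff] at hiso
  obtain ⟨R, hzR, hR1⟩ := exists_between hz
  obtain ⟨r₀, hr₀, hball⟩ := Metric.mem_nhds_iff.1
    (Filter.inter_mem (Filter.inter_mem hN hiso) (eventually_norm_lt hzR))
  set r := r₀ / 2 with hr
  have hr0 : 0 < r := by positivity
  have hcb : closedBall z₀ r ⊆ ball z₀ r₀ := closedBall_subset_ball (by linarith)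
  have hdc : ContinuousOn (fun z => ‖digitSum d z‖) (sphere z₀ r) := by
    refine ((differentiableOn_digitSum hd).continuousOn.mono fun z hz' => ?_).norm
    have := (hball (hcb (sphere_subset_closedBall hz'))).2
    simp only [mem_ofPred_eq] at this
    simpa using this.trans hR1
  obtain ⟨w, hw, hwmin⟩ := (isCompact_sphere z₀ r).exists_isMinOn
    (NormedSpace.sphere_nonempty.2 hr0.le) hdc
  set η := ‖digitSum d w‖ with hη
  have hη0 : 0 < η := by
    rw [hη, norm_pos_iff]
    refine (hball (hcb (sphere_subset_closedBall hw))).1.2 ?_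
    rintro (h : w = z₀)
    rw [h, mem_sphere, dist_self] at hw
    exact hr0.ne hw
  have hlim : Tendsto (fun m : ℕ => R ^ m * ((1 - R)⁻¹ + ‖c‖)) atTop (𝓝 (0 * ((1 - R)⁻¹ + ‖c‖))) :=
    (tendsto_pow_atTop_nhds_zero_of_lt_one ((norm_nonneg _).trans hzR.le) hR1).mul_const _
  rw [zero_mul] at hlim
  obtain ⟨m, hm, hm0⟩ := ((hlim.eventually (gt_mem_nhds (by positivity : 0 < η / 8))).and
    (eventually_gt_atTop 0)).exists
  set G : ℂ → ℂ := fun z => ∑ j ∈ Finset.range m, d j * z ^ j + z ^ m * c with hG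
  have hclose : ∀ z, ‖z‖ < R → ‖G z - digitSum d z‖ < η / 8 := fun z hzR' => by
    have hz1 := hzR'.trans hR1
    rw [digitSum_split hd hz1 m]
    have e : G z - (∑ j ∈ Finset.range m, d j * z ^ j + z ^ m * digitSum (fun j => d (m + j)) z) =
        z ^ m * (c - digitSum (fun j => d (m + j)) z) := by simp only [hG]; ring
    rw [e, norm_mul, norm_pow]
    refine lt_of_le_of_lt ?_ hm
    have h1 : ‖z‖ ^ m ≤ R ^ m := by gcongr
    have h2 : ‖c - digitSum (fun j => d (m + j)) z‖ ≤ (1 - R)⁻¹ + ‖c‖ := by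
      refine (norm_sub_le _ _).trans ?_
      have h3 := norm_digitSum_le (unitSeq_shift hd m) hz1
      have h4 : (1 - ‖z‖)⁻¹ ≤ (1 - R)⁻¹ := by
        apply inv_anti₀ <;> linarith
      linarith
    exact mul_le_mul h1 h2 (norm_nonneg _) (pow_nonneg ((norm_nonneg _).trans hzR'.le) _)
  have hGd : Differentiable ℂ G := by fun_prop
  have hG0 : ‖G z₀‖ < η / 8 := by simpa [hdz] using hclose z₀ hzR
  -- $G$ is within $\eta/8$ of the series, which has modulus at least $\eta$ on the circle and
  -- vanishes at the centre. The quantitative open mapping theorem then covers the disk of radius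
  -- $\eta/4$ about $G(z_0)$, which contains $0$.
  have hGs : ∀ z ∈ sphere z₀ r, η / 2 ≤ ‖G z - G z₀‖ := fun z hzs => by
    have h1 : η ≤ ‖digitSum d z‖ := hwmin hzs
    have h2 := hclose z (hball (hcb (sphere_subset_closedBall hzs))).2
    have h3 := norm_sub_norm_le (digitSum d z) (digitSum d z - (G z - G z₀))
    rw [sub_sub_cancel] at h3
    have h4 : ‖digitSum d z - (G z - G z₀)‖ ≤ ‖G z - digitSum d z‖ + ‖G z₀‖ := by
      rw [← norm_neg]
      calc ‖-(digitSum d z - (G z - G z₀))‖ = ‖(G z - digitSum d z) - G z₀‖ := by ring_nf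
        _ ≤ _ := norm_sub_le _ _
    linarith
  have hfreq : ∃ᶠ z in 𝓝 z₀, G z ≠ G z₀ := by
    intro hev
    simp only [not_not] at hev
    have hconst := (hGd.differentiableOn.analyticOnNhd isOpen_univ).eqOn_of_preconnected_of_eventuallyEq
      (analyticOnNhd_const (v := G z₀)) isPreconnected_univ (mem_univ z₀) hev
    have := hGs w hw
    rw [hconst (mem_univ w), sub_self, norm_zero] at this
    linarith
  have himg := DiffContOnCl.ball_subset_image_closedBall hGd.diffContOnCl hr0 hGs hfreq
  obtain ⟨z, hz', hGz⟩ := himg (show (0 : ℂ) ∈ ball (G z₀) (η / 2 / 2) by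
    rw [mem_ball, dist_eq_norm, zero_sub, norm_neg]; linarith)
  exact ⟨z, (hball (hcb hz')).1.1, m, hm0, hGz⟩

/-- A coincidence at $z_0$ can be perturbed so that a finite pair of prefixes has an offset close to
that of the crossing at $z_0$; openness of crossings does the rest. -/
theorem exists_isGood_near {z₀ : ℂ} (hz0 : z₀ ≠ 0) (hz : ‖z₀‖ < 1) (hco : IsCoincident z₀)
    (h : ∀ q, 0 < q → (z₀ ^ q).im = 0 → ‖z₀‖ ^ q < 1 / 2) {N : Set ℂ} (hN : N ∈ 𝓝 z₀) :
    ∃ z ∈ N, IsGood z := by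
  obtain ⟨c₀, hc₀⟩ := exists_crossing hz0 hz hco h
  obtain ⟨d, hd, hd0, hdz⟩ := hco
  -- Letting the target translation vary as $(1-z)c_0/(1-z_0)$ cancels the factor $1-z$ in `offset`,
  -- which turns the condition into a zero of a polynomial.
  have hcont : ContinuousAt (fun z : ℂ => (z, (1 - z) * (c₀ / (1 - z₀)))) z₀ :=
    Continuous.continuousAt (by fun_prop)
  have hval : (1 - z₀) * (c₀ / (1 - z₀)) = c₀ := mul_div_cancel₀ _ (one_sub_ne_zero hz)
  have hev : ∀ᶠ z in 𝓝 z₀, Crossing z ((1 - z) * (c₀ / (1 - z₀))) := by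
    have := hc₀.eventually hz
    rw [← hval] at this
    exact hcont.eventually this
  obtain ⟨z, ⟨⟨hzN, hzc⟩, hzp⟩, m, hm, hsum⟩ := exists_partialSum_zero (seqIn_signs_subset hd)
    (by rw [hd0]; norm_num) hz hdz (c₀ / (1 - z₀))
    (Filter.inter_mem (Filter.inter_mem hN hev) (eventually_norm_pos (norm_pos_iff.2 hz0)))
  refine ⟨z, hzN, d, hd, m, hd0, hm, ?_⟩
  have hz0' : z ^ m ≠ 0 := pow_ne_zero _ (norm_pos_iff.1 hzp)
  have : offset d m z = (1 - z) * (c₀ / (1 - z₀)) := by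
    rw [offset, div_eq_iff hz0']
    linear_combination -(1 - z) * hsum
  rw [this]
  exact hzc

/-! ## Asymptotics at a renormalization point -/

/-- It shows $(Z/\omega)^{bn}\to1$: here $x=C\omega^{bn}/\omega$, and $bn|\omega|^{bn}\to0$. -/
theorem norm_one_add_pow_sub_one_le (x : ℂ) (m : ℕ) :
    ‖(1 + x) ^ m - 1‖ ≤ Real.exp (m * ‖x‖) - 1 := by
  have h : ‖(1 + x) ^ m - 1‖ ≤ (1 + ‖x‖) ^ m - 1 := by
    induction m with
    | zero => simp
    | succ m ih =>
      calc ‖(1 + x) ^ (m + 1) - 1‖ = ‖((1 + x) ^ m - 1) * (1 + x) + x‖ := by ring_nf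
        _ ≤ ‖(1 + x) ^ m - 1‖ * ‖1 + x‖ + ‖x‖ := by
          rw [← norm_mul]; exact norm_add_le _ _
        _ ≤ ((1 + ‖x‖) ^ m - 1) * (1 + ‖x‖) + ‖x‖ := by
          gcongr
          · exact (norm_nonneg _).trans ih
          · exact (norm_add_le _ _).trans_eq (by rw [norm_one])
        _ = (1 + ‖x‖) ^ (m + 1) - 1 := by ring
  have h2 : (1 + ‖x‖) ^ m ≤ Real.exp (m * ‖x‖) := by
    rw [Real.exp_nat_mul]
    gcongr
    rw [add_comm]
    exact Real.add_one_le_exp _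
  linarith

/-- The parameter `ω + C ω ^ (b n)`. -/
noncomputable def renormParam (ω : ℂ) (b : ℕ) (p : ℕ × ℂ) : ℂ := ω + p.2 * ω ^ (b * p.1)

theorem tendsto_mul_fst_atTop {b : ℕ} (hb : 0 < b) (l : Filter ℂ) :
    Tendsto (fun p : ℕ × ℂ => b * p.1) (atTop ×ˢ l) atTop :=
  (tendsto_id.const_mul_atTop' hb).comp tendsto_fst

theorem tendsto_renormParam {ω : ℂ} (hω : ‖ω‖ < 1) {b : ℕ} (hb : 0 < b) (C : ℂ) :
    Tendsto (renormParam ω b) (atTop ×ˢ 𝓝 C) (𝓝 ω) := by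
  have h1 : Tendsto (fun p : ℕ × ℂ => ω ^ (b * p.1)) (atTop ×ˢ 𝓝 C) (𝓝 0) :=
    (tendsto_pow_atTop_nhds_zero_of_norm_lt_one hω).comp (tendsto_mul_fst_atTop hb _)
  have h2 := (tendsto_const_nhds (x := ω)).add
    ((tendsto_snd (f := (atTop : Filter ℕ)) (g := 𝓝 C)).mul h1)
  rw [mul_zero, add_zero] at h2
  exact h2

theorem tendsto_renormParam_div_pow {ω : ℂ} (hω0 : ω ≠ 0) (hω : ‖ω‖ < 1) {b : ℕ} (hb : 0 < b)
    (C : ℂ) :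
    Tendsto (fun p => (renormParam ω b p / ω) ^ (b * p.1)) (atTop ×ˢ 𝓝 C) (𝓝 1) := by
  have h1 : Tendsto (fun p : ℕ × ℂ => ((b * p.1 : ℕ) : ℝ) * ‖ω‖ ^ (b * p.1)) (atTop ×ˢ 𝓝 C) (𝓝 0) :=
    (tendsto_self_mul_const_pow_of_lt_one (norm_nonneg _) hω).comp (tendsto_mul_fst_atTop hb _)
  have h2 := h1.mul ((tendsto_snd (f := (atTop : Filter ℕ)) (g := 𝓝 C)).norm.div_const ‖ω‖)
  rw [zero_mul] at h2
  have h3 := ((Real.continuous_exp.tendsto 0).comp h2).sub_const 1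
  rw [Real.exp_zero, sub_self] at h3
  rw [tendsto_iff_norm_sub_tendsto_zero]
  refine squeeze_zero (fun _ => norm_nonneg _) (fun p => ?_) h3
  have e : renormParam ω b p / ω = 1 + p.2 * ω ^ (b * p.1) / ω := by
    rw [renormParam, add_div, div_self hω0]
  rw [e]
  refine (norm_one_add_pow_sub_one_le _ _).trans_eq ?_
  simp only [Function.comp_apply]
  rw [norm_div, norm_mul, norm_pow]
  congr 2
  ring

/-- Write $Q(Z)$ as $Z-\omega=C\omega^{bn}$ times a difference quotient tending to $Q'(\omega)$, and
use $(\omega/Z)^{bn}\to1$. The convergence is joint in $n$ and $C$, which the Baire argument needs.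
-/
theorem tendsto_div_renormParam_pow {ω : ℂ} (hω0 : ω ≠ 0) (hω : ‖ω‖ < 1) {b : ℕ} (hb : 0 < b)
    (C : ℂ) {Q : ℂ → ℂ} (hQ : DifferentiableAt ℂ Q ω) (hQ0 : Q ω = 0) :
    Tendsto (fun p => Q (renormParam ω b p) / renormParam ω b p ^ (b * p.1)) (atTop ×ˢ 𝓝 C)
      (𝓝 (deriv Q ω * C)) := by
  have h1 := (tendsto_renormParam_div_pow hω0 hω hb C).inv₀ one_ne_zero
  have h2 : Tendsto (fun p => dslope Q ω (renormParam ω b p)) (atTop ×ˢ 𝓝 C) (𝓝 (deriv Q ω)) := by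
    have := (continuousAt_dslope_same.2 hQ).tendsto.comp (tendsto_renormParam hω hb C)
    rwa [dslope_same] at this
  have h3 := (h2.mul (tendsto_snd (f := (atTop : Filter ℕ)) (g := 𝓝 C))).mul h1
  rw [inv_one, mul_one] at h3
  refine h3.congr fun p => ?_
  have h4 := sub_smul_dslope Q ω (renormParam ω b p)
  rw [hQ0, sub_zero, smul_eq_mul] at h4
  rw [← h4, div_pow, inv_div]
  have : renormParam ω b p - ω = p.2 * ω ^ (b * p.1) := by rw [renormParam]; ring
  rw [this]
  ring

theorem tendsto_prodMk_atTop (C : ℂ) :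
    Tendsto (fun n : ℕ => (n, C)) atTop (atTop ×ˢ 𝓝 C) :=
  tendsto_id.prodMk tendsto_const_nhds

/-! ## Eventually periodic digits -/

/-- The sequence `δ` of digits is periodic with period `b` from the index `a` on, and its power
series vanishes at `ω`. -/
structure IsRenormDigits (ω : ℂ) (δ : ℕ → ℂ) (a b : ℕ) : Prop where
  ne_zero : ω ≠ 0
  lt_one : ‖ω‖ < 1
  digits : δ ∈ seqIn signs
  pos : 0 < b
  periodic : ∀ j, a ≤ j → δ (j + b) = δ j
  zero : digitSum δ ω = 0

/-- The power series of the periodic part. -/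
noncomputable def tailSum (δ : ℕ → ℂ) (a : ℕ) (z : ℂ) : ℂ := digitSum (fun j => δ (a + j)) z

section

variable {ω : ℂ} {δ : ℕ → ℂ} {a b : ℕ}

theorem IsRenormDigits.periodic_mul (h : IsRenormDigits ω δ a b) (n : ℕ) {j : ℕ} (hj : a ≤ j) :
    δ (j + b * n) = δ j := by
  induction n with
  | zero => simp
  | succ n ih => rw [Nat.mul_succ, ← add_assoc, h.periodic _ (by omega), ih]

theorem IsRenormDigits.unit (h : IsRenormDigits ω δ a b) : δ ∈ unitSeq :=
  seqIn_signs_subset h.digits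

theorem IsRenormDigits.digitSum_eq (h : IsRenormDigits ω δ a b) (n : ℕ) {z : ℂ} (hz : ‖z‖ < 1) :
    digitSum δ z =
      ∑ j ∈ Finset.range (a + b * n), δ j * z ^ j + z ^ (a + b * n) * tailSum δ a z := by
  rw [digitSum_split h.unit hz (a + b * n), tailSum]
  congr 3
  funext j
  rw [show a + b * n + j = (a + j) + b * n by ring, h.periodic_mul n (by omega)]

theorem IsRenormDigits.tendsto_tailSum (h : IsRenormDigits ω δ a b) (C : ℂ) :
    Tendsto (fun p => tailSum δ a (renormParam ω b p)) (atTop ×ˢ 𝓝 C) (𝓝 (tailSum δ a ω)) :=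
  tendsto_digitSum_of_mem h.lt_one (tendsto_renormParam h.lt_one h.pos C) (unitSeq_shift h.unit a)

theorem IsRenormDigits.tendsto_div (h : IsRenormDigits ω δ a b) (C : ℂ) :
    Tendsto (fun p => digitSum δ (renormParam ω b p) / renormParam ω b p ^ (b * p.1))
      (atTop ×ˢ 𝓝 C) (𝓝 (deriv (digitSum δ) ω * C)) :=
  tendsto_div_renormParam_pow h.ne_zero h.lt_one h.pos C (differentiableAt_digitSum h.unit h.lt_one)
    h.zero

/-- The first `n` periods of `δ` cancelled, this is the rescaled difference that the remaining digits
have to compensate. -/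
theorem IsRenormDigits.tendsto_defect (h : IsRenormDigits ω δ a b) (C : ℂ) :
    Tendsto (fun p => tailSum δ a (renormParam ω b p) -
      digitSum δ (renormParam ω b p) / renormParam ω b p ^ (b * p.1) / renormParam ω b p ^ a)
      (atTop ×ˢ 𝓝 C) (𝓝 (tailSum δ a ω - deriv (digitSum δ) ω * C / ω ^ a)) :=
  (h.tendsto_tailSum C).sub ((h.tendsto_div C).div
    ((tendsto_renormParam h.lt_one h.pos C).pow a) (pow_ne_zero _ h.ne_zero))

theorem isCoincident_of_digitSum {e : ℕ → ℂ} (he : e ∈ seqIn signs) {k₀ : ℕ}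
    (h0 : ∀ j < k₀, e j = 0) (hk : e k₀ = -1) {z : ℂ} (hz0 : z ≠ 0) (hz : ‖z‖ < 1)
    (hs : digitSum e z = 0) : IsCoincident z := by
  refine ⟨fun j => e (k₀ + j), fun j => he _, hk, ?_⟩
  rw [digitSum_split (seqIn_signs_subset he) hz k₀,
    Finset.sum_eq_zero fun j hj => by rw [h0 j (Finset.mem_range.1 hj), zero_mul], zero_add] at hs
  exact (mul_eq_zero.1 hs).resolve_left (pow_ne_zero _ hz0)

theorem offset_shift {e : ℕ → ℂ} {k₀ : ℕ} (h0 : ∀ j < k₀, e j = 0) {z : ℂ} (hz0 : z ≠ 0) (m : ℕ) :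
    offset (fun j => e (k₀ + j)) m z = offset e (k₀ + m) z := by
  have hk : z ^ k₀ ≠ 0 := pow_ne_zero _ hz0
  have hm : z ^ m ≠ 0 := pow_ne_zero _ hz0
  have hs : ∑ j ∈ Finset.range k₀, e j * z ^ j = 0 :=
    Finset.sum_eq_zero fun j hj => by rw [h0 j (Finset.mem_range.1 hj), zero_mul]
  rw [offset, offset, Finset.sum_range_add, hs, zero_add, div_eq_div_iff hm (pow_ne_zero _ hz0), pow_add]
  simp only [pow_add, mul_left_comm _ (z ^ k₀), ← Finset.mul_sum]
  ring

/-- Dividing by $z^{a+bn}$ leaves only the defect and the first $k$ digits of $\gamma$, so the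
offset has a limit along the parameters $Z$ for fixed $k$. -/
theorem IsRenormDigits.offset_splice (h : IsRenormDigits ω δ a b) (γ : ℕ → ℂ) (n k : ℕ) {z : ℂ}
    (hz0 : z ≠ 0) (hz : ‖z‖ < 1) :
    offset (splice (a + b * n) δ γ) (a + b * n + k) z =
      (1 - z) * ((tailSum δ a z - digitSum δ z / z ^ (b * n) / z ^ a) -
        ∑ j ∈ Finset.range k, γ j * z ^ j) / z ^ k := by
  have h1 : z ^ k ≠ 0 := pow_ne_zero _ hz0
  have h2 : z ^ a ≠ 0 := pow_ne_zero _ hz0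
  have h3 : z ^ (b * n) ≠ 0 := pow_ne_zero _ hz0
  rw [offset, sum_range_add_splice, h.digitSum_eq n hz, pow_add, pow_add]
  field_simp
  ring

theorem IsRenormDigits.isCoincident (h : IsRenormDigits ω δ a b) {k₀ : ℕ}
    (h0 : ∀ j < k₀, δ j = 0) (hk : δ k₀ = -1) : IsCoincident ω :=
  isCoincident_of_digitSum h.digits h0 hk h.ne_zero h.lt_one h.zero

theorem tendsto_prefix_length {b : ℕ} (hb : 0 < b) (a : ℕ) :
    Tendsto (fun n : ℕ => a + b * n) atTop atTop :=
  tendsto_atTop_mono (fun _ => Nat.le_add_left _ _) (tendsto_id.const_mul_atTop' hb)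

/-- Traps near a renormalization point whose limit set has no overlapping edges. -/
theorem IsRenormDigits.exists_isGood_of_edges (h : IsRenormDigits ω δ a b) {k₀ : ℕ}
    (h0 : ∀ j < k₀, δ j = 0) (hk : δ k₀ = -1) (hQ : deriv (digitSum δ) ω ≠ 0)
    (hq : ∀ q, 0 < q → (ω ^ q).im = 0 → ‖ω‖ ^ q < 1 / 2) {γ : ℕ → ℂ} (hγ : γ ∈ seqIn signs)
    {C : ℂ} (hC : deriv (digitSum δ) ω * C = ω ^ a * (tailSum δ a ω - digitSum γ ω))
    {ε : ℝ} (hε : 0 < ε) :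
    ∃ C', ‖C - C'‖ < ε ∧ ∀ᶠ n : ℕ in atTop, IsGood (ω + C' * ω ^ (b * n)) := by
  obtain ⟨c₀, hc₀⟩ := exists_crossing h.ne_zero h.lt_one (h.isCoincident h0 hk) hq
  set Q' := deriv (digitSum δ) ω with hQ'
  set c := c₀ / (1 - ω) with hc
  have hω1 := one_sub_ne_zero h.lt_one
  have hωa : ω ^ a ≠ 0 := pow_ne_zero _ h.ne_zero
  have hlim : Tendsto (fun k : ℕ => ω ^ a / Q' *
      (∑ j ∈ Finset.range k, γ j * ω ^ j - digitSum γ ω + ω ^ k * c)) atTop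
      (𝓝 (ω ^ a / Q' * (digitSum γ ω - digitSum γ ω + 0 * c))) :=
    (((tendsto_sum_digit (seqIn_signs_subset hγ) h.lt_one).sub_const _).add
      ((tendsto_pow_atTop_nhds_zero_of_norm_lt_one h.lt_one).mul_const c)).const_mul _
  rw [sub_self, zero_mul, add_zero, mul_zero] at hlim
  have hlim2 := hlim.norm
  rw [norm_zero] at hlim2
  obtain ⟨k, hk1⟩ := (hlim2.eventually (gt_mem_nhds hε)).exists
  -- Chosen so that the limiting defect equals $\sum_{j<k}\gamma_j\omega^j+\omega^kc$, which makes
  -- the offset tend to $(1-\omega)c=c_0$. It differs from $C$ by a tail of order $\omega^k$.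
  set C' := ω ^ a / Q' * (tailSum δ a ω - ∑ j ∈ Finset.range k, γ j * ω ^ j - ω ^ k * c) with hC'
  refine ⟨C', ?_, ?_⟩
  · have hCC : C - C' = ω ^ a / Q' *
        (∑ j ∈ Finset.range k, γ j * ω ^ j - digitSum γ ω + ω ^ k * c) := by
      rw [hC', eq_div_of_mul_eq hQ (mul_comm _ _ |>.trans hC)]
      ring
    rwa [hCC]
  have hdef := (h.tendsto_defect C').comp (tendsto_prodMk_atTop C')
  have hZ := (tendsto_renormParam h.lt_one h.pos C').comp (tendsto_prodMk_atTop C')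
  have hsum : Tendsto (fun n : ℕ => ∑ j ∈ Finset.range k,
      γ j * (renormParam ω b (n, C')) ^ j) atTop (𝓝 (∑ j ∈ Finset.range k, γ j * ω ^ j)) :=
    tendsto_finsetSum _ fun j _ => (hZ.pow j).const_mul _
  have hoff := ((hZ.const_sub 1).mul (hdef.sub hsum)).div (hZ.pow k) (pow_ne_zero _ h.ne_zero)
  have hval : (1 - ω) * (tailSum δ a ω - Q' * C' / ω ^ a - ∑ j ∈ Finset.range k, γ j * ω ^ j) /
      ω ^ k = c₀ := by
    have hωk : ω ^ k ≠ 0 := pow_ne_zero _ h.ne_zero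
    rw [hC', hc]
    field_simp
    ring
  rw [← hQ', hval] at hoff
  have hev := (hZ.prodMk_nhds hoff).eventually (hc₀.eventually h.lt_one)
  filter_upwards [hev, hZ.eventually (eventually_norm_lt h.lt_one),
    hZ.eventually (eventually_norm_pos (norm_pos_iff.2 h.ne_zero)),
    (tendsto_prefix_length h.pos a).eventually (eventually_gt_atTop k₀)] with n hn hn1 hn0 hlen
  simp only [Function.comp_apply, Pi.div_apply] at hn hn1 hn0
  have hz0 := norm_pos_iff.1 hn0
  rw [← h.offset_splice γ n k hz0 hn1] at hn
  have hsp0 : ∀ j < k₀, splice (a + b * n) δ γ j = 0 := fun j hj => by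
    rw [splice_of_lt (by omega), h0 j hj]
  -- Leading zero digits mean a common prefix of the two words. Deleting it does not change the
  -- offset and makes the first digit $-1$.
  have hoffk := offset_shift hsp0 hz0 (a + b * n + k - k₀)
  rw [show k₀ + (a + b * n + k - k₀) = a + b * n + k by omega] at hoffk
  refine ⟨fun j => splice (a + b * n) δ γ (k₀ + j),
    fun j => splice_mem h.digits hγ _, a + b * n + k - k₀, ?_, by omega, ?_⟩
  · show splice (a + b * n) δ γ k₀ = -1
    rw [splice_of_lt hlen, hk]
  · show Crossing (renormParam ω b (n, C')) _
    rw [show ω + C' * ω ^ (b * n) = renormParam ω b (n, C') from rfl, hoffk]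
    exact hn

end

/-! ## Digit expansions from coverings -/

/-- Iterating $x=d+zy$ produces the digits; the remainder after $n$ steps is $z^n$ times a point of
the bounded set $W$. -/
theorem exists_digitSum_eq_of_cover {W : Set ℂ} (hW : IsCompact W) {z : ℂ} (hz : ‖z‖ < 1)
    (hcov : ∀ x ∈ W, ∃ d ∈ signs, ∃ y ∈ W, x = d + z * y) {x : ℂ} (hx : x ∈ W) :
    ∃ d ∈ seqIn signs, digitSum d z = x := by
  choose! D hD Y hY hxy using hcov
  have horb : ∀ n, Y^[n] x ∈ W := fun n => by
    induction n with
    | zero => exact hx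
    | succ n ih => rw [Function.iterate_succ_apply']; exact hY _ ih
  have hd : (fun n => D (Y^[n] x)) ∈ seqIn signs := fun n => hD _ (horb n)
  refine ⟨_, hd, ?_⟩
  have hsum : ∀ n, ∑ j ∈ Finset.range n, D (Y^[j] x) * z ^ j = x - z ^ n * Y^[n] x := fun n => by
    induction n with
    | zero => simp
    | succ n ih =>
      rw [Finset.sum_range_succ, ih, Function.iterate_succ_apply']
      have := hxy _ (horb n)
      linear_combination z ^ n * (-this)
  obtain ⟨r, hr⟩ := hW.isBounded.exists_norm_le
  have hlim : Tendsto (fun n => z ^ n * Y^[n] x) atTop (𝓝 0) := by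
    refine squeeze_zero_norm (a := fun n => ‖z‖ ^ n * r) (fun n => ?_) ?_
    · rw [norm_mul, norm_pow]
      gcongr
      exact hr _ (horb n)
    · simpa using (tendsto_pow_atTop_nhds_zero_of_lt_one (norm_nonneg z) hz).mul_const r
  refine tendsto_nhds_unique (tendsto_sum_digit (seqIn_signs_subset hd) hz) ?_
  simp only [hsum]
  simpa using hlim.const_sub x

/-- A covering with room to spare persists when the ratio is perturbed. -/
theorem eventually_cover {W : Set ℂ} (hW : IsCompact W) {ω : ℂ} (hω : ω ≠ 0) {l : ℝ}
    (hl : ∀ y ∈ W, (l : ℂ) * y ∈ interior W)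
    (hcov : ∀ x ∈ W, ∃ d ∈ signs, ∃ y ∈ W, x = d + l * ω * y) :
    ∀ᶠ z in 𝓝 ω, ∀ x ∈ W, ∃ d ∈ signs, ∃ y ∈ W, x = d + z * y := by
  have hK : IsCompact ((fun y => (l : ℂ) * y) '' W) := hW.image (by fun_prop)
  obtain ⟨η, hη, hs⟩ := hK.exists_thickening_subset_open isOpen_interior
    (by rintro _ ⟨y, hy, rfl⟩; exact hl y hy)
  obtain ⟨r, hr⟩ := hK.isBounded.exists_norm_le
  have hlim : Tendsto (fun z : ℂ => ‖ω / z - 1‖ * r) (𝓝 ω) (𝓝 (‖ω / ω - 1‖ * r)) :=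
    (((tendsto_const_nhds.div tendsto_id hω).sub_const 1).norm).mul_const r
  rw [div_self hω, sub_self, norm_zero, zero_mul] at hlim
  filter_upwards [hlim.eventually (gt_mem_nhds hη),
    eventually_norm_pos (norm_pos_iff.2 hω)] with z hz hz0 x hx
  obtain ⟨d, hd, y, hy, rfl⟩ := hcov x hx
  -- As $x=d+z\cdot(\omega/z)\,ly$, it suffices that $(\omega/z)\,ly$ remains in $W$. This holds
  -- because the points $ly$ form a compact subset of the interior.
  refine ⟨d, hd, ω / z * (l * y), interior_subset (hs (mem_thickening_iff.2
    ⟨_, mem_image_of_mem _ hy, ?_⟩)), ?_⟩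
  · rw [dist_eq_norm]
    calc ‖ω / z * (l * y) - l * y‖ = ‖ω / z - 1‖ * ‖l * y‖ := by rw [← norm_mul]; ring_nf
      _ ≤ ‖ω / z - 1‖ * r := by gcongr; exact hr _ (mem_image_of_mem _ hy)
      _ < η := hz
  · have := norm_pos_iff.1 hz0
    field_simp

/-! ## Zonotopes -/

/-- The zonotope `{∑_{j < q} r_j ζ ^ j : |r_j| ≤ A}`. -/
noncomputable def zonotope (ζ : ℂ) (q : ℕ) (A : ℝ) : Set ℂ :=
  (fun r : ℕ → ℝ => ∑ j ∈ Finset.range q, (r j : ℂ) * ζ ^ j) '' (univ.pi fun _ => Icc (-A) A)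

theorem mem_zonotope {ζ : ℂ} {q : ℕ} {A : ℝ} {r : ℕ → ℝ} (hr : ∀ j, |r j| ≤ A) {x : ℂ}
    (hx : x = ∑ j ∈ Finset.range q, (r j : ℂ) * ζ ^ j) : x ∈ zonotope ζ q A :=
  ⟨r, fun j _ => abs_le.1 (hr j), hx.symm⟩

theorem isCompact_zonotope (ζ : ℂ) (q : ℕ) (A : ℝ) : IsCompact (zonotope ζ q A) :=
  (isCompact_univ_pi fun _ => isCompact_Icc).image (by fun_prop)

theorem convex_zonotope (ζ : ℂ) (q : ℕ) (A : ℝ) : Convex ℝ (zonotope ζ q A) := by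
  refine (convex_pi fun _ _ => convex_Icc _ _).is_linear_image ⟨fun r s => ?_, fun c r => ?_⟩
  · simp [add_mul, Finset.sum_add_distrib]
  · simp [Finset.mul_sum, mul_assoc]

theorem zero_mem_interior_zonotope {ζ : ℂ} (hζ : ζ.im ≠ 0) {q : ℕ} (hq : 2 ≤ q) {A : ℝ}
    (hA : 0 < A) : (0 : ℂ) ∈ interior (zonotope ζ q A) := by
  -- Since $\zeta$ is not real, $1$ and $\zeta$ form a real basis, and the first two coordinates
  -- already fill a neighbourhood of $0$.
  have hsub : {w : ℂ | |w.im / ζ.im| < A ∧ |w.re - w.im / ζ.im * ζ.re| < A} ⊆ zonotope ζ q A := by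
    rintro w ⟨h1, h2⟩
    obtain ⟨k, rfl⟩ := Nat.exists_eq_add_of_le hq
    refine mem_zonotope (r := fun j => if j = 0 then w.re - w.im / ζ.im * ζ.re else
      if j = 1 then w.im / ζ.im else 0) (fun j => ?_) ?_
    · split_ifs
      exacts [h2.le, h1.le, by simpa using hA.le]
    · rw [Finset.sum_range_add, Finset.sum_range_succ, Finset.sum_range_one,
        Finset.sum_eq_zero (s := Finset.range k)]
      · apply Complex.ext
        · simp
        · simp [hζ]
      · intro j _
        rw [if_neg (by omega), if_neg (by omega)]
        simp
  refine interior_maximal hsub ?_ (by simpa using hA)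
  have c1 : Continuous fun w : ℂ => |w.im / ζ.im| := by fun_prop
  have c2 : Continuous fun w : ℂ => |w.re - w.im / ζ.im * ζ.re| := by fun_prop
  exact (isOpen_lt c1 continuous_const).inter (isOpen_lt c2 continuous_const)

theorem exists_sign_of_abs_le {x B : ℝ} (hB : 1 / 2 ≤ B) (hx : |x| ≤ 1 + B) :
    ∃ d : ℝ, (d : ℂ) ∈ signs ∧ |x - d| ≤ B := by
  rw [abs_le] at hx
  rcases le_total x (-(1 / 2)) with h | h
  · exact ⟨-1, by simp [signs], abs_le.2 ⟨by linarith, by linarith⟩⟩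
  rcases le_total x (1 / 2) with h' | h'
  · exact ⟨0, by simp [signs], abs_le.2 ⟨by linarith, by linarith⟩⟩
  · exact ⟨1, by simp [signs], abs_le.2 ⟨by linarith, by linarith⟩⟩

theorem abs_re_of_im_eq_zero {z : ℂ} (h : z.im = 0) : |z.re| = ‖z‖ :=
  Complex.abs_re_eq_norm.2 h

/-- Multiplication by $\zeta$ shifts the coordinates and wraps the last one around with the real
factor $\zeta^q$. So only $r_0$ matters: with $A=1+\rho A$, the three translates of $[-\rho A,\rho
A]$ by the digits cover $[-A,A]$ as soon as $\rho A\ge1/2$, which is $\rho\ge1/3$. -/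
theorem zonotope_cover {ζ : ℂ} {q : ℕ} (hq : 0 < q) (him : (ζ ^ q).im = 0)
    (h3 : 1 / 3 ≤ ‖ζ‖ ^ q) (h1 : ‖ζ‖ ^ q < 1) {x : ℂ} (hx : x ∈ zonotope ζ q (1 - ‖ζ‖ ^ q)⁻¹) :
    ∃ d ∈ signs, ∃ y ∈ zonotope ζ q (1 - ‖ζ‖ ^ q)⁻¹, x = d + ζ * y := by
  set ρ := ‖ζ‖ ^ q with hρ
  set A := (1 - ρ)⁻¹ with hA
  have hA' : A = 1 + ρ * A := by
    rw [hA]; have : 1 - ρ ≠ 0 := by linarith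
    field_simp; ring
  have hA0 : 0 < A := inv_pos.2 (by linarith)
  have hB : 1 / 2 ≤ ρ * A := by
    rw [hA, ← div_eq_mul_inv, le_div_iff₀ (by linarith)]; linarith
  set y₀ := (ζ ^ q).re with hy₀
  have hyρ : |y₀| = ρ := by rw [hy₀, abs_re_of_im_eq_zero him, norm_pow]
  have hy0 : y₀ ≠ 0 := fun h => by rw [h, abs_zero] at hyρ; linarith
  have hζq : ζ ^ q = (y₀ : ℂ) := Complex.ext rfl (by simpa using him)
  obtain ⟨r, hr, rfl⟩ := hx
  have hr' : ∀ j, |r j| ≤ A := fun j => abs_le.2 (hr j (mem_univ j))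
  obtain ⟨d, hd, hdr⟩ := exists_sign_of_abs_le hB (hA' ▸ hr' 0)
  obtain ⟨k, rfl⟩ := Nat.exists_eq_succ_of_ne_zero hq.ne'
  refine ⟨d, hd, _, mem_zonotope (r := fun j => if j < k then r (j + 1) else (r 0 - d) / y₀)
    (fun j => ?_) rfl, ?_⟩
  · split_ifs
    · exact hr' _
    · rw [abs_div, hyρ, div_le_iff₀ (by linarith), mul_comm]; exact hdr
  · have hy0' : (y₀ : ℂ) ≠ 0 := by exact_mod_cast hy0
    have e : ∑ j ∈ Finset.range k, (((if j < k then r (j + 1) else (r 0 - d) / y₀ : ℝ)) : ℂ) * ζ ^ j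
        = ∑ j ∈ Finset.range k, (r (j + 1) : ℂ) * ζ ^ j :=
      Finset.sum_congr rfl fun j hj => by rw [if_pos (Finset.mem_range.1 hj)]
    show ∑ j ∈ Finset.range (k + 1), (r j : ℂ) * ζ ^ j = d + ζ * ∑ j ∈ Finset.range (k + 1), _
    rw [Finset.sum_range_succ (fun j => (((if j < k then r (j + 1) else (r 0 - d) / y₀ : ℝ)) : ℂ) *
      ζ ^ j), e, if_neg (lt_irrefl k), Finset.sum_range_succ', mul_add, Finset.mul_sum]
    have e2 : ζ * (((r 0 - d) / y₀ : ℝ) * ζ ^ k) = r 0 - d := by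
      have : ζ * (((r 0 - d) / y₀ : ℝ) * ζ ^ k) = ((r 0 - d) / y₀ : ℝ) * ζ ^ (k + 1) := by ring
      rw [this, hζq]
      push_cast
      field_simp
    rw [e2]
    have e3 : ∀ j, ζ * ((r (j + 1) : ℂ) * ζ ^ j) = r (j + 1) * ζ ^ (j + 1) := fun j => by ring
    simp only [e3]
    ring

/-- The same coordinate shift: the new first coordinate is at most $1+\rho A=A$ in absolute value.
-/
theorem zonotope_invariant {ζ : ℂ} {q : ℕ} (hq : 0 < q) (him : (ζ ^ q).im = 0)
    (h1 : ‖ζ‖ ^ q < 1) {d y : ℂ} (hd : d ∈ signs) (hy : y ∈ zonotope ζ q (1 - ‖ζ‖ ^ q)⁻¹) :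
    d + ζ * y ∈ zonotope ζ q (1 - ‖ζ‖ ^ q)⁻¹ := by
  set ρ := ‖ζ‖ ^ q with hρ
  set A := (1 - ρ)⁻¹ with hA
  have hA' : A = 1 + ρ * A := by
    rw [hA]; have : 1 - ρ ≠ 0 := by linarith
    field_simp; ring
  have hρ0 : 0 ≤ ρ := by positivity
  set y₀ := (ζ ^ q).re with hy₀
  have hyρ : |y₀| = ρ := by rw [hy₀, abs_re_of_im_eq_zero him, norm_pow]
  have hζq : ζ ^ q = (y₀ : ℂ) := Complex.ext rfl (by simpa using him)
  obtain ⟨r, hr, rfl⟩ := hy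
  have hr' : ∀ j, |r j| ≤ A := fun j => abs_le.2 (hr j (mem_univ j))
  obtain ⟨d', rfl, hd'⟩ : ∃ d' : ℝ, (d' : ℂ) = d ∧ |d'| ≤ 1 := by
    simp only [signs, mem_insert_iff, mem_singleton_iff] at hd
    rcases hd with rfl | rfl | rfl
    exacts [⟨-1, by simp, by simp⟩, ⟨0, by simp, by simp⟩, ⟨1, by simp, by simp⟩]
  obtain ⟨k, rfl⟩ := Nat.exists_eq_succ_of_ne_zero hq.ne'
  refine mem_zonotope (r := fun j => if j = 0 then d' + y₀ * r k else r (j - 1)) (fun j => ?_) ?_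
  · split_ifs
    · rw [hA']
      refine (abs_add_le _ _).trans (add_le_add hd' ?_)
      rw [abs_mul, hyρ]
      exact mul_le_mul_of_nonneg_left (hr' k) hρ0
    · exact hr' _
  · show (d' : ℂ) + ζ * ∑ j ∈ Finset.range (k + 1), (r j : ℂ) * ζ ^ j = _
    rw [Finset.sum_range_succ, Finset.sum_range_succ']
    simp only [Nat.add_eq_zero_iff, one_ne_zero, and_false, if_false, if_true, Nat.add_sub_cancel]
    rw [mul_add, Finset.mul_sum]
    have e2 : ζ * ((r k : ℂ) * ζ ^ k) = y₀ * r k := by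
      rw [← hζq, pow_succ]; ring
    have e3 : ∀ j, ζ * ((r j : ℂ) * ζ ^ j) = r j * ζ ^ (j + 1) := fun j => by ring
    simp only [e2, e3]
    push_cast
    ring

theorem digitSum_mem_zonotope {ζ : ℂ} {q : ℕ} (hq : 0 < q) (him : (ζ ^ q).im = 0)
    (h1 : ‖ζ‖ < 1) {d : ℕ → ℂ} (hd : d ∈ seqIn signs) :
    digitSum d ζ ∈ zonotope ζ q (1 - ‖ζ‖ ^ q)⁻¹ := by
  have hq1 : ‖ζ‖ ^ q < 1 := pow_lt_one₀ (norm_nonneg _) h1 hq.ne'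
  have hfin : ∀ (n : ℕ) (e : ℕ → ℂ), e ∈ seqIn signs →
      ∑ j ∈ Finset.range n, e j * ζ ^ j ∈ zonotope ζ q (1 - ‖ζ‖ ^ q)⁻¹ := by
    intro n
    induction n with
    | zero =>
      intro e _
      refine mem_zonotope (r := fun _ => 0) (fun j => ?_) (by simp)
      rw [abs_zero]
      exact inv_nonneg.2 (by linarith)
    | succ n ih =>
      intro e he
      have := zonotope_invariant hq him hq1 (he 0) (ih (fun j => e (j + 1)) fun j => he _)
      convert this using 1
      rw [Finset.sum_range_succ', Finset.mul_sum, add_comm, pow_zero, mul_one]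
      congr 1
      exact Finset.sum_congr rfl fun j _ => by ring
  exact (isCompact_zonotope _ _ _).isClosed.mem_of_tendsto
    (tendsto_sum_digit (seqIn_signs_subset hd) h1) (Eventually.of_forall fun n => hfin n d hd)

/-- Points near `Ĝ_ω` that belong to `Ĝ_z`, robustly, for all `z` near `ω`, where `Ĝ_z` is the set of
values of power series with coefficients in `{-1, 0, 1}` and some power of `ω` is real and large. -/
theorem exists_robust_digitSum {ω : ℂ} (hω1 : ‖ω‖ < 1) (hωim : ω.im ≠ 0) {q : ℕ} (hq : 0 < q)
    (him : (ω ^ q).im = 0) (hq2 : 1 / 2 ≤ ‖ω‖ ^ q) {γ : ℕ → ℂ} (hγ : γ ∈ seqIn signs) {ε : ℝ}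
    (hε : 0 < ε) :
    ∃ x, ‖x - digitSum γ ω‖ < ε ∧ ∃ O ∈ 𝓝 x, ∀ᶠ z in 𝓝 ω, ∀ y ∈ O,
      ∃ d ∈ seqIn signs, digitSum d z = y := by
  have hω0 : ω ≠ 0 := fun h => hωim (by simp [h])
  have hq2' : 2 ≤ q := by
    rcases Nat.lt_or_ge q 2 with h | h
    · obtain rfl : q = 1 := by omega
      rw [pow_one] at him
      exact absurd him hωim
    · exact h
  have hscale : Tendsto (fun l : ℝ => (l : ℂ) * ω) (𝓝 1) (𝓝 ω) := by
    have : Continuous fun l : ℝ => (l : ℂ) * ω := by fun_prop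
    simpa using this.tendsto 1
  have hlim : Tendsto (fun l : ℝ => (l : ℂ) * digitSum γ (l * ω)) (𝓝 1)
      (𝓝 (((1 : ℝ) : ℂ) * digitSum γ ω)) :=
    (Complex.continuous_ofReal.tendsto 1).mul
      (tendsto_digitSum_of_mem hω1 hscale (seqIn_signs_subset hγ))
  rw [Complex.ofReal_one, one_mul] at hlim
  have hpow : Tendsto (fun l : ℝ => ‖(l : ℂ) * ω‖ ^ q) (𝓝 1) (𝓝 (‖ω‖ ^ q)) := hscale.norm.pow q
  have hnear : ∀ᶠ l : ℝ in 𝓝 1, ‖(l : ℂ) * digitSum γ (l * ω) - digitSum γ ω‖ < ε := by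
    filter_upwards [hlim.eventually (ball_mem_nhds _ hε)] with l hl
    rwa [dist_eq_norm] at hl
  -- The slack between $1/2$ and the covering threshold $1/3$ allows $\omega$ to be shrunk to
  -- $\zeta=l\omega$ with $l<1$. This factor $l$ gives the covering its room to spare.
  obtain ⟨l, ⟨⟨⟨hl1, hl2⟩, hl3⟩, hl4⟩⟩ := ((hnear.and (hpow.eventually (lt_mem_nhds
    (by linarith : (1 : ℝ) / 3 < ‖ω‖ ^ q)))).and (lt_mem_nhds (by norm_num : (0 : ℝ) < 1))
    |>.filter_mono nhdsWithin_le_nhds |>.and (self_mem_nhdsWithin (s := Iio (1 : ℝ)))).exists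
  replace hl4 : l < 1 := hl4
  set ζ : ℂ := l * ω with hζ
  have hζ1 : ‖ζ‖ < 1 := by
    rw [hζ, norm_mul, Complex.norm_real, Real.norm_of_nonneg hl3.le]
    nlinarith [norm_nonneg ω]
  have hζim : ζ.im ≠ 0 := by
    rw [hζ, Complex.im_ofReal_mul]
    exact mul_ne_zero hl3.ne' hωim
  have hζq : (ζ ^ q).im = 0 := by
    rw [hζ, mul_pow, ← Complex.ofReal_pow, Complex.im_ofReal_mul, him, mul_zero]
  have hζq1 : ‖ζ‖ ^ q < 1 := pow_lt_one₀ (norm_nonneg _) hζ1 hq.ne'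
  set W := zonotope ζ q (1 - ‖ζ‖ ^ q)⁻¹ with hW
  have hWc : IsCompact W := isCompact_zonotope _ _ _
  have hint : ∀ y ∈ W, (l : ℂ) * y ∈ interior W := fun y hy => by
    have := (convex_zonotope ζ q (1 - ‖ζ‖ ^ q)⁻¹).combo_interior_self_mem_interior
      (zero_mem_interior_zonotope hζim hq2' (inv_pos.2 (by linarith))) hy
      (sub_pos.2 hl4) hl3.le (by ring)
    simpa using this
  refine ⟨l * digitSum γ ζ, hl1, W, mem_interior_iff_mem_nhds.1
    (hint _ (digitSum_mem_zonotope hq hζq hζ1 hγ)), ?_⟩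
  filter_upwards [eventually_cover hWc hω0 hint fun x hx =>
    zonotope_cover hq hζq hl2.le hζq1 hx, eventually_norm_lt hω1] with z hz hz1 y hy
  exact exists_digitSum_eq_of_cover hWc hz1 hz hy

/-! ## Traps near a renormalization point with overlapping edges -/

/-- Rotate $z_0$ slightly: only countably many angles make some positive power real. -/
theorem exists_im_pow_ne_zero_near {z₀ : ℂ} (hz0 : z₀ ≠ 0) {N : Set ℂ} (hN : N ∈ 𝓝 z₀) :
    ∃ z ∈ N, z ≠ 0 ∧ ∀ q : ℕ, 0 < q → (z ^ q).im ≠ 0 := by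
  have hcount : {θ : ℝ | ∃ (q : ℕ) (k : ℤ), 0 < q ∧ θ = k * Real.pi / q - Complex.arg z₀}.Countable := by
    have : {θ : ℝ | ∃ (q : ℕ) (k : ℤ), 0 < q ∧ θ = k * Real.pi / q - Complex.arg z₀} ⊆
        range fun p : ℕ × ℤ => (p.2 : ℝ) * Real.pi / p.1 - Complex.arg z₀ := by
      rintro _ ⟨q, k, -, rfl⟩
      exact ⟨(q, k), rfl⟩
    exact (countable_range _).mono this
  have hcont : Tendsto (fun θ : ℝ => z₀ * Complex.exp (θ * Complex.I)) (𝓝 0) (𝓝 z₀) := by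
    have : Continuous fun θ : ℝ => z₀ * Complex.exp (θ * Complex.I) := by fun_prop
    simpa using this.tendsto 0
  obtain ⟨θ, hθN, hθ⟩ := (hcount.dense_compl ℝ).inter_nhds_nonempty (hcont hN)
  refine ⟨_, hθ, mul_ne_zero hz0 (Complex.exp_ne_zero _), fun q hq him => hθN ?_⟩
  have hpow : (z₀ * Complex.exp (θ * Complex.I)) ^ q = ((‖z₀‖ ^ q : ℝ) : ℂ) *
      Complex.exp (((q * (Complex.arg z₀ + θ) : ℝ) : ℂ) * Complex.I) := by
    conv_lhs => rw [← Complex.norm_mul_exp_arg_mul_I z₀]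
    rw [mul_assoc, ← Complex.exp_add, mul_pow, ← Complex.exp_nat_mul]
    push_cast
    ring_nf
  rw [hpow, Complex.im_ofReal_mul, Complex.exp_ofReal_mul_I_im, mul_eq_zero,
    or_iff_right (pow_ne_zero _ (norm_ne_zero_iff.2 hz0)), Real.sin_eq_zero_iff] at him
  obtain ⟨k, hk⟩ := him
  refine ⟨q, k, hq, ?_⟩
  have hq' : (q : ℝ) ≠ 0 := by positivity
  rw [hk]
  field_simp
  ring

/-- Within an open set of coincidences one may first move to a parameter with no real positive
power, where the edge hypothesis holds vacuously. -/
theorem exists_isGood_near_of_eventually_isCoincident {z₀ : ℂ} (hz0 : z₀ ≠ 0) (hz : ‖z₀‖ < 1)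
    {N : Set ℂ} (hN : N ∈ 𝓝 z₀) (hco : ∀ z ∈ N, IsCoincident z) : ∃ z ∈ N, IsGood z := by
  obtain ⟨z₁, hz₁, hz₁0, hz₁q⟩ := exists_im_pow_ne_zero_near hz0
    (Filter.inter_mem (interior_mem_nhds.2 hN) (eventually_norm_lt hz))
  exact exists_isGood_near hz₁0 hz₁.2 (hco _ (interior_subset hz₁.1))
    (fun q hq him => absurd him (hz₁q q hq)) (mem_interior_iff_mem_nhds.1 hz₁.1)

/-- Overlapping clusters may leave no crossing at $\omega$ itself, but they make coincidences
robust. Good parameters are open and dense among them for each $n$, and one $C'$ works for all large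
$n$ by Baire. -/
theorem IsRenormDigits.exists_isGood_of_overlap {ω : ℂ} {δ : ℕ → ℂ} {a b : ℕ}
    (h : IsRenormDigits ω δ a b) {k₀ : ℕ} (h0 : ∀ j < k₀, δ j = 0) (hk : δ k₀ = -1)
    (hQ : deriv (digitSum δ) ω ≠ 0) (hωim : ω.im ≠ 0) {q : ℕ} (hq : 0 < q)
    (him : (ω ^ q).im = 0) (hq2 : 1 / 2 ≤ ‖ω‖ ^ q) {γ : ℕ → ℂ} (hγ : γ ∈ seqIn signs) {C : ℂ}
    (hC : deriv (digitSum δ) ω * C = ω ^ a * (tailSum δ a ω - digitSum γ ω)) {ε : ℝ} (hε : 0 < ε) :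
    ∃ C', ‖C - C'‖ < ε ∧ ∀ᶠ n : ℕ in atTop, IsGood (ω + C' * ω ^ (b * n)) := by
  set Q' := deriv (digitSum δ) ω with hQ'
  have hωa : ω ^ a ≠ 0 := pow_ne_zero _ h.ne_zero
  have hfac : 0 < ‖ω ^ a / Q'‖ := norm_pos_iff.2 (div_ne_zero hωa hQ)
  obtain ⟨x, hx, O, hO, hOz⟩ := exists_robust_digitSum h.lt_one hωim hq him hq2 hγ
    (show 0 < ε / 2 / ‖ω ^ a / Q'‖ by positivity)
  set C₁ := ω ^ a / Q' * (tailSum δ a ω - x) with hC₁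
  have hCC₁ : ‖C - C₁‖ < ε / 2 := by
    have : C - C₁ = ω ^ a / Q' * (x - digitSum γ ω) := by
      rw [hC₁, eq_div_of_mul_eq hQ (mul_comm _ _ |>.trans hC)]
      ring
    rw [this, norm_mul, mul_comm]
    exact (lt_div_iff₀ hfac).1 hx
  have hx' : tailSum δ a ω - Q' * C₁ / ω ^ a = x := by
    rw [hC₁]; field_simp; ring
  have hdef := h.tendsto_defect C₁
  rw [← hQ', hx'] at hdef
  have hZ := tendsto_renormParam h.lt_one h.pos C₁
  -- Near $C_1$ the defect falls in the open set of values attained at every $z$ close to $\omega$.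
  -- Splicing the digits of that value after $n$ periods of $\delta$ gives a coincidence.
  have hev : ∀ᶠ p : ℕ × ℂ in atTop ×ˢ 𝓝 C₁, renormParam ω b p ≠ 0 ∧ ‖renormParam ω b p‖ < 1 ∧
      IsCoincident (renormParam ω b p) := by
    have hlen := (tendsto_fst (f := (atTop : Filter ℕ)) (g := 𝓝 C₁)).eventually
      ((tendsto_prefix_length h.pos a).eventually (eventually_gt_atTop k₀))
    filter_upwards [hdef.eventually hO, hZ.eventually hOz, hZ.eventually (eventually_norm_lt h.lt_one),
      hZ.eventually (eventually_norm_pos (norm_pos_iff.2 h.ne_zero)), hlen] with p hp hpz hp1 hp0 hlen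
    have hz0 := norm_pos_iff.1 hp0
    refine ⟨hz0, hp1, ?_⟩
    obtain ⟨d, hd, hds⟩ := hpz _ hp
    refine isCoincident_of_digitSum (e := splice (a + b * p.1) δ d) (k₀ := k₀)
      (fun j => splice_mem h.digits hd _) (fun j hj => ?_) ?_ hz0 hp1 ?_
    · rw [splice_of_lt (by omega), h0 j hj]
    · rw [splice_of_lt hlen, hk]
    · rw [digitSum_splice h.unit (seqIn_signs_subset hd) hp1, hds]
      have e1 := h.digitSum_eq p.1 hp1
      have e2 : renormParam ω b p ^ (a + b * p.1) *
          (digitSum δ (renormParam ω b p) / renormParam ω b p ^ (b * p.1) / renormParam ω b p ^ a) =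
          digitSum δ (renormParam ω b p) := by
        rw [pow_add]; field_simp
      rw [mul_sub, e2]
      linear_combination -e1
  obtain ⟨pa, hpa, pb, hpb, hab⟩ := eventually_prod_iff.1 hev
  obtain ⟨n₀, hn₀⟩ := eventually_atTop.1 hpa
  obtain ⟨r, hr, hball⟩ := Metric.mem_nhds_iff.1 (Filter.inter_mem hpb (ball_mem_nhds C₁ (half_pos hε)))
  set B := ball C₁ r with hB
  have hgood : ∀ n, n₀ ≤ n → ∀ C ∈ B, renormParam ω b (n, C) ≠ 0 ∧ ‖renormParam ω b (n, C)‖ < 1 ∧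
      IsCoincident (renormParam ω b (n, C)) := fun n hn C hC => hab (hn₀ n hn) (hball hC).1
  have hcont : ∀ n, Continuous fun C => renormParam ω b (n, C) := fun n => by
    unfold renormParam; fun_prop
  -- Adding the exterior of the ball makes each set dense in the whole plane, so Baire's theorem
  -- applies there; the indices are shifted to start at $n_0$.
  set A : ℕ → Set ℂ := fun n => {C | C ∈ B ∧ IsGood (renormParam ω b (n + n₀, C))} ∪ (closure B)ᶜ
    with hA
  have hAo : ∀ n, IsOpen (A n) := fun n => by
    refine IsOpen.union (isOpen_iff_mem_nhds.2 ?_) isClosed_closure.isOpen_compl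
    rintro C ⟨hCB, hCg⟩
    obtain ⟨g1, g2, -⟩ := hgood (n + n₀) (Nat.le_add_left _ _) C hCB
    filter_upwards [isOpen_ball.mem_nhds hCB,
      (hcont (n + n₀)).continuousAt.eventually (hCg.eventually g1 g2)] with C' h1 h2
    exact ⟨h1, h2⟩
  have hAd : ∀ n, Dense (A n) := fun n => by
    rw [dense_iff_inter_open]
    intro V hV hVne
    by_cases hVB : (V ∩ B).Nonempty
    · obtain ⟨C₂, hC₂V, hC₂B⟩ := hVB
      obtain ⟨g1, g2, -⟩ := hgood (n + n₀) (Nat.le_add_left _ _) C₂ hC₂B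
      have hωn : ω ^ (b * (n + n₀)) ≠ 0 := pow_ne_zero _ h.ne_zero
      have hinv : ∀ C, (renormParam ω b (n + n₀, C) - ω) / ω ^ (b * (n + n₀)) = C := fun C => by
        simp only [renormParam]; field_simp; ring
      have hinv' : ∀ z, renormParam ω b (n + n₀, (z - ω) / ω ^ (b * (n + n₀))) = z := fun z => by
        simp only [renormParam]; field_simp; ring
      have hN : (fun z => (z - ω) / ω ^ (b * (n + n₀))) ⁻¹' (V ∩ B) ∈
          𝓝 (renormParam ω b (n + n₀, C₂)) := by
        have hc : Continuous fun z : ℂ => (z - ω) / ω ^ (b * (n + n₀)) := by fun_prop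
        refine ((hV.inter isOpen_ball).preimage hc).mem_nhds ?_
        rw [mem_preimage, hinv]
        exact ⟨hC₂V, hC₂B⟩
      obtain ⟨z, hzN, hzg⟩ := exists_isGood_near_of_eventually_isCoincident g1 g2 hN fun z hz => by
        have := (hgood (n + n₀) (Nat.le_add_left _ _) _ hz.2).2.2
        rwa [hinv'] at this
      exact ⟨_, hzN.1, Or.inl ⟨hzN.2, by rwa [hinv']⟩⟩
    · obtain ⟨C₂, hC₂⟩ := hVne
      refine ⟨C₂, hC₂, Or.inr fun hcl => hVB ?_⟩
      exact mem_closure_iff.1 hcl V hV hC₂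
  obtain ⟨C', hC'B, hC'A⟩ := (dense_iInter_of_isOpen_nat hAo hAd).inter_open_nonempty B isOpen_ball
    ⟨C₁, mem_ball_self hr⟩
  refine ⟨C', ?_, ?_⟩
  · have h1 := (hball hC'B).2
    rw [mem_ball, dist_comm, dist_eq_norm] at h1
    calc ‖C - C'‖ = ‖(C - C₁) + (C₁ - C')‖ := by ring_nf
      _ ≤ ‖C - C₁‖ + ‖C₁ - C'‖ := norm_add_le _ _
      _ < ε := by linarith
  · filter_upwards [eventually_ge_atTop n₀] with n hn
    obtain ⟨m, rfl⟩ := Nat.exists_eq_add_of_le' hn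
    rcases mem_iInter.1 hC'A m with h1 | h1
    · exact h1.2
    · exact absurd (subset_closure hC'B) h1

/-! ## Parameters without coincidences -/

theorem isCoincident_of_codingMap_eq {z : ℂ} (hz : ‖z‖ < 1) {U V : ℕ → Letter}
    (hU : U 0 = Letter.f) (hV : V 0 = Letter.g) (h : codingMap U z = codingMap V z) :
    IsCoincident z := by
  refine ⟨centerDiff U V, centerDiff_mem U V, ?_, ?_⟩
  · simp [centerDiff, centers, hU, hV, Letter.center]
  · have := codingMap_sub_codingMap hz U V
    rw [h, sub_self, zero_eq_mul] at this
    exact this.resolve_left (one_sub_ne_zero hz)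

/-- $\Lambda_z$ is the union of the nonempty closed sets $f\Lambda_z$ and $g\Lambda_z$, so if it is
connected they share a point. -/
theorem isCoincident_of_isPreconnected {z : ℂ} (hz : ‖z‖ < 1) (h : IsPreconnected (LambdaSet z)) :
    IsCoincident z := by
  have hcl : ∀ c : Letter, IsClosed (wordMap z [c] '' LambdaSet z) := fun c => by
    refine ((isCompact_lambdaSet hz).image ?_).isClosed
    rw [funext (wordMap_eq z [c])]
    fun_prop
  have hcons : ∀ (c : Letter) (W : ℕ → Letter),
      codingMap (fun j => Nat.casesOn j c W) z = wordMap z [c] (codingMap W z) := fun c W => by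
    rw [codingMap_eq_wordMap_singleton hz]
    have : (fun j => (Nat.casesOn (1 + j) c W : Letter)) = W := by
      funext j; rw [add_comm]
    exact congrArg (fun X => wordMap z [c] (codingMap X z)) this
  have hcov : LambdaSet z ⊆ wordMap z [Letter.f] '' LambdaSet z ∪
      wordMap z [Letter.g] '' LambdaSet z := by
    intro x hx
    rw [lambdaSet_eq hz] at hx
    obtain ⟨U, rfl⟩ := hx
    have hmem : codingMap U z ∈ wordMap z [U 0] '' LambdaSet z :=
      ⟨_, codingMap_mem_lambdaSet hz _, (codingMap_eq_wordMap_singleton hz U).symm⟩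
    show codingMap U z ∈ _
    cases hU : U 0 <;> rw [hU] at hmem
    exacts [Or.inl hmem, Or.inr hmem]
  have hne : ∀ c : Letter, (LambdaSet z ∩ wordMap z [c] '' LambdaSet z).Nonempty := fun c =>
    ⟨_, hcons c (fun _ => c) ▸ codingMap_mem_lambdaSet hz _,
      mem_image_of_mem _ (codingMap_mem_lambdaSet hz _)⟩
  obtain ⟨x, -, ⟨y, hy, hyx⟩, ⟨y', hy', hyx'⟩⟩ :=
    isPreconnected_closed_iff.1 h _ _ (hcl .f) (hcl .g) hcov (hne .f) (hne .g)
  rw [lambdaSet_eq hz] at hy hy'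
  obtain ⟨W, rfl⟩ := hy
  obtain ⟨W', rfl⟩ := hy'
  exact isCoincident_of_codingMap_eq hz (U := fun j => Nat.casesOn j .f W)
    (V := fun j => Nat.casesOn j .g W') rfl rfl (by rw [hcons, hcons]; exact hyx.trans hyx'.symm)

theorem exists_pos_le_norm_of_ne {K : Set (ℕ → ℂ)} (hK : IsCompact K) (hKu : K ⊆ unitSeq) {ω : ℂ}
    (hω : ‖ω‖ < 1) {x : ℂ} (h : ∀ d ∈ K, digitSum d ω ≠ x) :
    ∃ η : ℝ, 0 < η ∧ ∀ d ∈ K, η ≤ ‖digitSum d ω - x‖ := by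
  have hcl : IsClosed ((fun d => digitSum d ω) '' K) :=
    (hK.image_of_continuousOn ((continuousOn_digitSum_seq hω).mono hKu)).isClosed
  obtain ⟨η, hη, hball⟩ := Metric.isOpen_iff.1 hcl.isOpen_compl x (by
    rintro ⟨d, hd, hdx⟩; exact h d hd hdx)
  refine ⟨η, hη, fun d hd => ?_⟩
  by_contra! hlt
  exact hball (by rwa [mem_ball, dist_eq_norm]) (mem_image_of_mem (fun d => digitSum d ω) hd)

section

variable {ω : ℂ} {δ : ℕ → ℂ} {a b : ℕ}

/-- A lower bound for the power series whose digits leave `δ` within the first period. -/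
theorem IsRenormDigits.exists_pos_le_norm (h : IsRenormDigits ω δ a b)
    (huniq : ∀ d ∈ seqIn signs, d 0 = -1 → digitSum d ω = 0 → d = δ) :
    ∃ η : ℝ, 0 < η ∧ ∀ d ∈ seqIn signs, d 0 = -1 → (∃ j < a + b, d j ≠ δ j) →
      η ≤ ‖digitSum d ω‖ := by
  -- Writing disagreement at $j$ as membership in the finite set of the other signs makes it a
  -- closed condition, so $K$ is compact.
  set K : Set (ℕ → ℂ) := seqIn signs ∩ ({d | d 0 = -1} ∩
    ⋃ j ∈ Finset.range (a + b), {d | d j ∈ signs \ {δ j}}) with hK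
  have hKc : IsCompact K := by
    refine (isCompact_seqIn signs_finite).inter_right (IsClosed.inter ?_ ?_)
    · exact isClosed_eq (continuous_apply 0) continuous_const
    · exact isClosed_biUnion_finset fun j _ =>
        (signs_finite.sdiff).isClosed.preimage (continuous_apply j)
  obtain ⟨η, hη, hle⟩ := exists_pos_le_norm_of_ne (x := 0) hKc
    (inter_subset_left.trans seqIn_signs_subset) h.lt_one (by
      rintro d ⟨hd, hd0, hdj⟩ hz
      obtain ⟨j, -, hj⟩ := mem_iUnion₂.1 hdj
      exact hj.2 (by rw [huniq d hd hd0 hz]; rfl))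
  refine ⟨η, hη, fun d hd hd0 ⟨j, hj, hne⟩ => ?_⟩
  simpa using hle d ⟨hd, hd0, mem_iUnion₂.2 ⟨j, Finset.mem_range.2 hj, hd j, hne⟩⟩

/-- The digits of a coincidence close to `ω` agree with `δ` for at least `n` periods. -/
theorem IsRenormDigits.eq_of_digitSum_eq_zero (h : IsRenormDigits ω δ a b) (ha : 0 < a)
    (hδ0 : δ 0 = -1) {η : ℝ}
    (hη : ∀ d ∈ seqIn signs, d 0 = -1 → (∃ j < a + b, d j ≠ δ j) → η ≤ ‖digitSum d ω‖) {z : ℂ}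
    (hz0 : z ≠ 0) (hz : ‖z‖ < 1) (hclose : ∀ d ∈ unitSeq, ‖digitSum d z - digitSum d ω‖ < η / 2)
    {n : ℕ} (hsmall : ‖digitSum δ z / z ^ (b * n)‖ < η / 4) {d : ℕ → ℂ} (hd : d ∈ seqIn signs)
    (hd0 : d 0 = -1) (hdz : digitSum d z = 0) : ∀ j < a + b * n, d j = δ j := by
  classical
  have hlow : ∀ e ∈ seqIn signs, e 0 = -1 → (∃ j < a + b, e j ≠ δ j) → η / 2 < ‖digitSum e z‖ := by
    intro e he he0 hej
    have h1 := hη e he he0 hej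
    have h2 := hclose e (seqIn_signs_subset he)
    have h3 := norm_sub_norm_le (digitSum e ω) (digitSum e z)
    rw [norm_sub_rev] at h3
    linarith
  have hη0 : 0 < η := by have := norm_nonneg (digitSum δ z / z ^ (b * n)); linarith
  by_contra! hcon
  obtain ⟨hjlt, hjne⟩ := Nat.find_spec hcon
  set j := Nat.find hcon with hj
  have hagree : ∀ i < j, d i = δ i := fun i hi => by
    by_contra hne
    exact Nat.find_min hcon hi ⟨hi.trans hjlt, hne⟩
  rcases Nat.lt_or_ge j (a + b) with hjab | hjab
  · have := hlow d hd hd0 ⟨j, hjab, hjne⟩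
    rw [hdz, norm_zero] at this
    linarith
  set k := (j - a) / b with hk
  have hk1 : b * k ≤ j - a := Nat.mul_div_le _ _
  have hk2 : j - a < b * k + b := Nat.lt_mul_div_succ _ h.pos
  have hkn : b * k ≤ b * n := by omega
  -- Cut $k$ whole periods out of $d$, so that the first disagreement with $\delta$ falls within the
  -- first $a+b$ digits, where the lower bound applies.
  set d' := splice a δ (fun i => d (a + b * k + i)) with hd'
  have hd'mem : d' ∈ seqIn signs := fun i => splice_mem h.digits (fun i => hd _) i
  have hbig := hlow d' hd'mem (by rw [hd', splice_of_lt ha, hδ0]) ⟨j - b * k, by omega, by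
    have e1 : j - b * k = a + (j - b * k - a) := by omega
    have e2 : a + b * k + (j - b * k - a) = j := by omega
    have e3 : δ (j - b * k) = δ j := by
      rw [← h.periodic_mul k (j := j - b * k) (by omega)]
      congr 1; omega
    rw [e3, hd', e1, splice_add, e2]
    exact hjne⟩
  have hdu := seqIn_signs_subset hd
  have s1 := digitSum_split hdu hz (a + b * k)
  rw [hdz, Finset.sum_congr rfl fun i hi => by
    rw [hagree i (by have := Finset.mem_range.1 hi; omega)]] at s1
  have s2 := h.digitSum_eq k hz
  have s3 := h.digitSum_eq 0 hz
  rw [mul_zero, add_zero] at s3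
  have s4 := digitSum_splice (n := a) h.unit (unitSeq_shift hdu (a + b * k)) hz
  have hzk : z ^ (b * k) ≠ 0 := pow_ne_zero _ hz0
  -- With $d$ vanishing at $z$, the cut series equals $Q(z)-Q(z)/z^{bk}$. Both terms are bounded by
  -- $|Q(z)/z^{bn}|<\eta/4$, contradicting the lower bound $\eta/2$.
  have hval : digitSum d' z = digitSum δ z - digitSum δ z / z ^ (b * k) := by
    apply mul_left_cancel₀ hzk
    rw [mul_sub, mul_div_cancel₀ _ hzk, hd', s4]
    rw [pow_add] at s1 s2
    linear_combination s2 - s1 - z ^ (b * k) * s3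
  have hpow : ‖z‖ ^ (b * n) ≤ ‖z‖ ^ (b * k) := pow_le_pow_of_le_one (norm_nonneg _) hz.le hkn
  have hpn : 0 < ‖z‖ ^ (b * n) := pow_pos (norm_pos_iff.2 hz0) _
  have hpn1 : ‖z‖ ^ (b * n) ≤ 1 := pow_le_one₀ (norm_nonneg _) hz.le
  rw [norm_div, norm_pow] at hsmall
  have b1 : ‖digitSum δ z / z ^ (b * k)‖ ≤ ‖digitSum δ z‖ / ‖z‖ ^ (b * n) := by
    rw [norm_div, norm_pow]
    gcongr
  have b2 : ‖digitSum δ z‖ ≤ ‖digitSum δ z‖ / ‖z‖ ^ (b * n) :=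
    le_div_self (norm_nonneg _) hpn hpn1
  have b3 := norm_sub_le (digitSum δ z) (digitSum δ z / z ^ (b * k))
  rw [hval] at hbig
  linarith

theorem IsRenormDigits.eventually_not_isCoincident (h : IsRenormDigits ω δ a b) (ha : 0 < a)
    (hδ0 : δ 0 = -1) (huniq : ∀ d ∈ seqIn signs, d 0 = -1 → digitSum d ω = 0 → d = δ)
    (hQ : deriv (digitSum δ) ω ≠ 0) :
    ∃ r : ℝ, 0 < r ∧ ∀ C : ℂ,
      (∀ γ ∈ seqIn signs, deriv (digitSum δ) ω * C ≠ ω ^ a * (tailSum δ a ω - digitSum γ ω)) →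
      ‖C‖ < r → ∀ᶠ n : ℕ in atTop, ‖ω + C * ω ^ (b * n)‖ < 1 ∧
        ¬ IsCoincident (ω + C * ω ^ (b * n)) := by
  obtain ⟨η, hη, hηle⟩ := h.exists_pos_le_norm huniq
  set Q' := deriv (digitSum δ) ω with hQ'
  have hQ0 : 0 < ‖Q'‖ := norm_pos_iff.2 hQ
  have hωa : ω ^ a ≠ 0 := pow_ne_zero _ h.ne_zero
  -- This radius makes $|Q'(\omega)C|<\eta/4$, and $Q'(\omega)C$ is the limit of $Q(Z)/Z^{bn}$.
  refine ⟨η / 4 / ‖Q'‖, by positivity, fun C hC hCr => ?_⟩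
  -- Since $C$ satisfies none of the limiting equations, compactness keeps the limiting defect at
  -- distance $\kappa$ from all digit values at $\omega$. Two errors below $\kappa/2$ cannot bridge
  -- this.
  obtain ⟨κ, hκ, hκle⟩ := exists_pos_le_norm_of_ne (x := tailSum δ a ω - Q' * C / ω ^ a)
    (isCompact_seqIn signs_finite) seqIn_signs_subset h.lt_one (fun γ hγ hx => hC γ hγ (by
      rw [hx]; field_simp; ring))
  have hprod := tendsto_prodMk_atTop C
  have hZ := (tendsto_renormParam h.lt_one h.pos C).comp hprod
  have hdiv := ((h.tendsto_div C).comp hprod).norm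
  have hdef := (h.tendsto_defect C).comp hprod
  have hQC : ‖Q' * C‖ < η / 4 := by
    rw [norm_mul, mul_comm]; exact (lt_div_iff₀ hQ0).1 hCr
  filter_upwards [hZ.eventually (digitSum_equicontinuousAt h.lt_one (half_pos hη)),
    hZ.eventually (digitSum_equicontinuousAt h.lt_one (half_pos hκ)),
    hZ.eventually (eventually_norm_pos (norm_pos_iff.2 h.ne_zero)),
    hdiv.eventually (gt_mem_nhds hQC), hdef.eventually (ball_mem_nhds _ (half_pos hκ))]
    with n h1 h2 h3 h4 h5
  simp only [Function.comp_apply] at h1 h2 h3 h4 h5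
  have hz0 := norm_pos_iff.1 h3
  refine ⟨h1.1, ?_⟩
  rintro ⟨d, hd, hd0, hdz⟩
  change digitSum d (renormParam ω b (n, C)) = 0 at hdz
  have hagree := h.eq_of_digitSum_eq_zero ha hδ0 hηle hz0 h1.1 h1.2 h4 hd hd0 hdz
  have hdu := seqIn_signs_subset hd
  set z := renormParam ω b (n, C) with hz
  have s1 := digitSum_split hdu h1.1 (a + b * n)
  rw [hdz, Finset.sum_congr rfl fun i hi => by rw [hagree i (Finset.mem_range.1 hi)]] at s1
  have s2 := h.digitSum_eq n h1.1
  have hz1 : z ^ a ≠ 0 := pow_ne_zero _ hz0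
  have hz2 : z ^ (b * n) ≠ 0 := pow_ne_zero _ hz0
  have hval : tailSum δ a z - digitSum δ z / z ^ (b * n) / z ^ a =
      digitSum (fun j => d (a + b * n + j)) z := by
    rw [pow_add] at s1 s2
    field_simp
    linear_combination s1 - s2
  have hds : (fun j => d (a + b * n + j)) ∈ seqIn signs := fun j => hd _
  have c1 := hκle _ hds
  have c2 := h2.2 _ (seqIn_signs_subset hds)
  rw [hval, dist_eq_norm, ← hQ'] at h5
  have c3 := norm_sub_le_norm_sub_add_norm_sub (digitSum (fun j => d (a + b * n + j)) ω)
    (digitSum (fun j => d (a + b * n + j)) z) (tailSum δ a ω - Q' * C / ω ^ a)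
  rw [norm_sub_rev (digitSum (fun j => d (a + b * n + j)) ω)
    (digitSum (fun j => d (a + b * n + j)) z)] at c3
  linarith

end

/-! ## Renormalization points -/

section

variable {ω : ℂ} {u v s t : List Letter}

theorem periodicWord_add (u s : List Letter) {j : ℕ} (hj : u.length ≤ j) :
    periodicWord u s (j + s.length) = periodicWord u s j := by
  rw [periodicWord, periodicWord, if_neg (by omega), if_neg (by omega)]
  congr 1
  rw [show j + s.length - u.length = (j - u.length) + s.length by omega, Nat.add_mod_right]

theorem wordPrefix_periodicWord (u s : List Letter) :
    wordPrefix (periodicWord u s) u.length = u := by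
  refine List.ext_getElem (by simp [wordPrefix]) fun j h1 h2 => ?_
  simp [wordPrefix, periodicWord, h2]

/-- The differences of the centres of the two words of a renormalization point. -/
def renormDigits (u v s t : List Letter) : ℕ → ℂ :=
  centerDiff (periodicWord u s) (periodicWord v t)

theorem isRenormDigits (h : IsRenormalizationPoint ω u v s t) :
    IsRenormDigits ω (renormDigits u v s t) u.length s.length where
  ne_zero := norm_pos_iff.1 h.pos
  lt_one := h.lt_one
  digits := centerDiff_mem _ _
  pos := h.period_pos
  periodic j hj := by
    have h1 := periodicWord_add u s hj
    have h2 := periodicWord_add v t (h.length_prefix ▸ hj)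
    rw [← h.length_period] at h2
    simp only [renormDigits, centerDiff, centers, h1, h2]
  zero := by
    have := codingMap_sub_codingMap h.lt_one (periodicWord u s) (periodicWord v t)
    rw [h.coincide, sub_self, zero_eq_mul] at this
    exact this.resolve_left (one_sub_ne_zero h.lt_one)

theorem deriv_coincidenceFun (h : IsRenormalizationPoint ω u v s t) :
    deriv (coincidenceFun u v s t) ω = (1 - ω) * deriv (digitSum (renormDigits u v s t)) ω := by
  have hR := isRenormDigits h
  have he : coincidenceFun u v s t =ᶠ[𝓝 ω] fun z => (1 - z) * digitSum (renormDigits u v s t) z := by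
    filter_upwards [eventually_norm_lt h.lt_one] with z hz
    exact codingMap_sub_codingMap hz _ _
  rw [he.deriv_eq]
  have hd := (differentiableAt_digitSum hR.unit h.lt_one).hasDerivAt
  have := (((hasDerivAt_id ω).const_sub 1).mul hd).deriv
  refine this.trans ?_
  rw [hR.zero]
  simp

/-- Because $Q(\omega)=0$, the prefix difference $p_u-p_v$ at $\omega$ is minus the contribution of
the periodic part. The factors $1-\omega$ from $P'$, the prefixes and $\Gamma_\omega$ then cancel.
-/
theorem mem_similaritySet_iff (h : IsRenormalizationPoint ω u v s t)
    (hP : deriv (digitSum (renormDigits u v s t)) ω ≠ 0) {C : ℂ} :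
    C ∈ similaritySet ω u v s t ↔ ∃ γ ∈ seqIn signs,
      deriv (digitSum (renormDigits u v s t)) ω * C =
        ω ^ u.length * (tailSum (renormDigits u v s t) u.length ω - digitSum γ ω) := by
  have hR := isRenormDigits h
  have hω := one_sub_ne_zero h.lt_one
  have hp : wordPoly u ω - wordPoly v ω =
      -((1 - ω) * (ω ^ u.length * tailSum (renormDigits u v s t) u.length ω)) := by
    have e1 := wordPoly_wordPrefix ω (periodicWord u s) u.length
    have e2 := wordPoly_wordPrefix ω (periodicWord v t) v.length
    rw [wordPrefix_periodicWord] at e1 e2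
    have e3 := hR.digitSum_eq 0 h.lt_one
    rw [hR.zero, mul_zero, add_zero] at e3
    rw [e1, e2, ← h.length_prefix, ← mul_sub, ← Finset.sum_sub_distrib]
    simp only [← sub_mul]
    have e4 : ∑ j ∈ Finset.range u.length,
        (centers (periodicWord u s) j - centers (periodicWord v t) j) * ω ^ j =
        ∑ j ∈ Finset.range u.length, renormDigits u v s t j * ω ^ j := rfl
    rw [e4]
    linear_combination (-(1 - ω)) * e3
  rw [similaritySet, gammaSet_eq h.lt_one, image_image, deriv_coincidenceFun h, hp]
  set Q' := deriv (digitSum (renormDigits u v s t)) ω with hQ'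
  set τ := tailSum (renormDigits u v s t) u.length ω with hτ
  have key : ∀ γ : ℕ → ℂ, -(-((1 - ω) * (ω ^ u.length * τ)) / ((1 - ω) * Q')) -
      ω ^ u.length / ((1 - ω) * Q') * ((1 - ω) * digitSum γ ω) = C ↔
      Q' * C = ω ^ u.length * (τ - digitSum γ ω) := fun γ => by
    have : -(-((1 - ω) * (ω ^ u.length * τ)) / ((1 - ω) * Q')) -
      ω ^ u.length / ((1 - ω) * Q') * ((1 - ω) * digitSum γ ω) =
        ω ^ u.length * (τ - digitSum γ ω) / Q' := by
      field_simp
    rw [this, div_eq_iff hP, mul_comm C, eq_comm]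
  simp only [mem_image, key]

theorem IsRenormDigits.neg {δ : ℕ → ℂ} {a b : ℕ} (h : IsRenormDigits ω δ a b) :
    IsRenormDigits ω (fun j => -δ j) a b where
  ne_zero := h.ne_zero
  lt_one := h.lt_one
  digits j := neg_mem_signs (h.digits j)
  pos := h.pos
  periodic j hj := by rw [h.periodic j hj]
  zero := by rw [digitSum_neg, h.zero, neg_zero]

/-- Exchanging the two words negates $\delta$ and $\gamma$ and preserves the equation for $C$, so
the first nonzero digit may be taken to be $-1$. The proof then splits according to whether a real
power of $\omega$ has modulus at least $1/2$. -/
theorem IsRenormDigits.exists_isGood {δ : ℕ → ℂ} {a b : ℕ} (h : IsRenormDigits ω δ a b) {k₀ : ℕ}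
    (h0 : ∀ j < k₀, δ j = 0) (hk : δ k₀ ≠ 0) (hQ : deriv (digitSum δ) ω ≠ 0) (hωim : ω.im ≠ 0)
    {γ : ℕ → ℂ} (hγ : γ ∈ seqIn signs) {C : ℂ}
    (hC : deriv (digitSum δ) ω * C = ω ^ a * (tailSum δ a ω - digitSum γ ω)) {ε : ℝ} (hε : 0 < ε) :
    ∃ C', ‖C - C'‖ < ε ∧ ∀ᶠ n : ℕ in atTop, IsGood (ω + C' * ω ^ (b * n)) := by
  have hmain : ∀ {δ γ : ℕ → ℂ}, IsRenormDigits ω δ a b → (∀ j < k₀, δ j = 0) → δ k₀ = -1 →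
      deriv (digitSum δ) ω ≠ 0 → γ ∈ seqIn signs →
      deriv (digitSum δ) ω * C = ω ^ a * (tailSum δ a ω - digitSum γ ω) →
      ∃ C', ‖C - C'‖ < ε ∧ ∀ᶠ n : ℕ in atTop, IsGood (ω + C' * ω ^ (b * n)) := by
    intro δ γ h h0 hk hQ hγ hC
    by_cases hq : ∃ q, 0 < q ∧ (ω ^ q).im = 0 ∧ 1 / 2 ≤ ‖ω‖ ^ q
    · obtain ⟨q, hq, him, hq2⟩ := hq
      exact h.exists_isGood_of_overlap h0 hk hQ hωim hq him hq2 hγ hC hε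
    · push Not at hq
      exact h.exists_isGood_of_edges h0 hk hQ hq hγ hC hε
  have hsign := h.digits k₀
  simp only [signs, mem_insert_iff, mem_singleton_iff] at hsign
  rcases hsign with h1 | h1 | h1
  · exact hmain h h0 h1 hQ hγ hC
  · exact absurd h1 hk
  · have hd : deriv (digitSum fun j => -δ j) ω = -deriv (digitSum δ) ω := by
      rw [funext (digitSum_neg δ)]; exact deriv.fun_neg
    refine hmain (γ := fun j => -γ j) h.neg (fun j hj => by rw [h0 j hj, neg_zero])
      (by rw [h1]) (by rw [hd]; exact neg_ne_zero.2 hQ) (fun j => neg_mem_signs (hγ j)) ?_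
    have ht : tailSum (fun j => -δ j) a ω = -tailSum δ a ω := digitSum_neg _ _
    rw [hd, ht, digitSum_neg]
    linear_combination -hC

theorem codingMap_shift_eq {z : ℂ} (hz0 : z ≠ 0) (hz : ‖z‖ < 1) {U V : ℕ → Letter}
    (h : codingMap U z = codingMap V z) {k : ℕ} (hk : ∀ j < k, U j = V j) :
    codingMap (fun j => U (k + j)) z = codingMap (fun j => V (k + j)) z := by
  have h1 := codingMap_sub_codingMap hz U V
  rw [h, sub_self, zero_eq_mul] at h1
  have h2 := h1.resolve_left (one_sub_ne_zero hz)
  rw [digitSum_split (seqIn_signs_subset (centerDiff_mem U V)) hz k,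
    Finset.sum_eq_zero fun j hj => by
      simp [centerDiff, centers, hk j (Finset.mem_range.1 hj)], zero_add] at h2
  have h3 := (mul_eq_zero.1 h2).resolve_left (pow_ne_zero _ hz0)
  refine sub_eq_zero.1 ((codingMap_sub_codingMap hz _ _).trans ?_)
  have h4 : centerDiff (fun j => U (k + j)) (fun j => V (k + j)) = fun j => centerDiff U V (k + j) :=
    rfl
  rw [h4, h3, mul_zero]

theorem centerDiff_ne_zero {U V : ℕ → Letter} {j : ℕ} (h : U j ≠ V j) : centerDiff U V j ≠ 0 := by
  unfold centerDiff centers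
  cases hU : U j <;> cases hV : V j <;> simp_all [Letter.center]

/-- If the coincidence is unique, then the two words start with different letters. -/
theorem heads_of_unique (h : IsRenormalizationPoint ω u v s t)
    (huniq : ∀ U V : ℕ → Letter, U 0 = Letter.f → V 0 = Letter.g →
      codingMap U ω = codingMap V ω → U = periodicWord u s ∧ V = periodicWord v t) :
    periodicWord u s 0 = Letter.f ∧ periodicWord v t 0 = Letter.g := by
  classical
  set U := periodicWord u s
  set V := periodicWord v t
  have hω0 := norm_pos_iff.1 h.pos
  have hex : ∃ k, U k ≠ V k := Function.ne_iff.1 h.ne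
  set k := Nat.find hex with hk
  have hkne : U k ≠ V k := Nat.find_spec hex
  have hagree : ∀ j < k, U j = V j := fun j hj => not_not.1 (Nat.find_min hex hj)
  have hshift := codingMap_shift_eq hω0 h.lt_one h.coincide hagree
  have main : ∀ {X Y : ℕ → Letter}, X 0 = Letter.f → Y 0 = Letter.g →
      codingMap X ω = codingMap Y ω → U 0 = Letter.f ∧ V 0 = Letter.g := fun hX hY hXY => by
    obtain ⟨rfl, rfl⟩ := huniq _ _ hX hY hXY
    exact ⟨hX, hY⟩
  cases hU : U k <;> cases hV : V k
  · exact absurd (hU.trans hV.symm) hkne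
  · exact main (X := fun j => U (k + j)) (Y := fun j => V (k + j)) hU hV hshift
  · exact main (X := fun j => V (k + j)) (Y := fun j => U (k + j)) hV hU hshift.symm
  · exact absurd (hU.trans hV.symm) hkne

theorem IsRenormDigits.add_period {δ : ℕ → ℂ} {a b : ℕ} (h : IsRenormDigits ω δ a b) :
    IsRenormDigits ω δ (a + b) b :=
  ⟨h.ne_zero, h.lt_one, h.digits, h.pos, fun j hj => h.periodic j (by omega), h.zero⟩

/-- Counting one period as part of the prefix gives no new values of $C$: put that period in front
of $\gamma$. -/
theorem IsRenormDigits.exists_digits_of_add_period {δ : ℕ → ℂ} {a b : ℕ}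
    (h : IsRenormDigits ω δ a b) {γ : ℕ → ℂ} (hγ : γ ∈ seqIn signs) :
    ∃ γ' ∈ seqIn signs, ω ^ (a + b) * (tailSum δ (a + b) ω - digitSum γ ω) =
      ω ^ a * (tailSum δ a ω - digitSum γ' ω) := by
  have hs : (fun j => δ (a + j)) ∈ seqIn signs := fun j => h.digits _
  refine ⟨splice b (fun j => δ (a + j)) γ, fun j => splice_mem hs hγ j, ?_⟩
  rw [digitSum_splice (seqIn_signs_subset hs) (seqIn_signs_subset hγ) h.lt_one, tailSum, tailSum,
    digitSum_split (seqIn_signs_subset hs) h.lt_one b, pow_add]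
  simp only [add_assoc]
  ring

end

end RenormalizableTraps

open RenormalizableTraps in
theorem mainTheorem4 (ω : ℂ) (u v s t : List Letter)
    (hω : IsRenormalizationPoint ω u v s t)
    (hP : deriv (coincidenceFun u v s t) ω ≠ 0) :
    (ω.im ≠ 0 →
      ∀ C ∈ similaritySet ω u v s t, ∀ ε : ℝ, 0 < ε →
        ∃ C' : ℂ, ‖C - C'‖ < ε ∧
          ∀ᶠ n : ℕ in atTop, HasTrap (ω + C' * ω ^ (s.length * n))) ∧
    ((∀ U V : ℕ → Letter, U 0 = Letter.f → V 0 = Letter.g →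
        codingMap U ω = codingMap V ω → U = periodicWord u s ∧ V = periodicWord v t) →
      ∃ δ : ℝ, 0 < δ ∧ ∀ C : ℂ, C ∉ similaritySet ω u v s t → ‖C‖ < δ →
        ∀ᶠ n : ℕ in atTop, ¬ IsPreconnected (LambdaSet (ω + C * ω ^ (s.length * n)))) := by
  classical
  have hR := isRenormDigits hω
  have hQ : deriv (digitSum (renormDigits u v s t)) ω ≠ 0 := by
    rw [deriv_coincidenceFun hω] at hP
    exact right_ne_zero_of_mul hP
  refine ⟨fun him C hC ε hε => ?_, fun huniq => ?_⟩
  · obtain ⟨γ, hγ, hCγ⟩ := (mem_similaritySet_iff hω hQ).1 hC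
    have hex : ∃ k, renormDigits u v s t k ≠ 0 := by
      obtain ⟨k, hk⟩ := Function.ne_iff.1 hω.ne
      exact ⟨k, centerDiff_ne_zero hk⟩
    obtain ⟨C', hCC', hgood⟩ := hR.exists_isGood (k₀ := Nat.find hex)
      (fun j hj => not_not.1 (Nat.find_min hex hj)) (Nat.find_spec hex) hQ him hγ hCγ hε
    refine ⟨C', hCC', ?_⟩
    have hZ := (tendsto_renormParam hR.lt_one hR.pos C').comp (tendsto_prodMk_atTop C')
    filter_upwards [hgood, hZ.eventually (eventually_norm_lt hR.lt_one),
      hZ.eventually (eventually_norm_pos hω.pos)] with n h1 h2 h3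
    exact h1.hasTrap (norm_pos_iff.1 h3) h2
  · obtain ⟨hU0, hV0⟩ := heads_of_unique hω huniq
    -- The prefix words may be empty; absorbing one period makes the preperiod positive, so that the
    -- digit at index $0$ is kept when periods are cut out.
    obtain ⟨r, hr, hrC⟩ := hR.add_period.eventually_not_isCoincident
      (Nat.add_pos_right _ hR.pos)
      (by simp [renormDigits, centerDiff, centers, hU0, hV0, Letter.center])
      (fun d hd hd0 hdω => by
        obtain ⟨X, Y, rfl, hXY⟩ := exists_centerDiff_eq hd
        have hco : codingMap X ω = codingMap Y ω := sub_eq_zero.1 (by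
          rw [codingMap_sub_codingMap hω.lt_one, hdω, mul_zero])
        obtain ⟨rfl, rfl⟩ := huniq X Y (hXY 0 hd0).1 (hXY 0 hd0).2 hco
        rfl) hQ
    refine ⟨r, hr, fun C hC hCr => ?_⟩
    filter_upwards [hrC C (fun γ hγ hCγ => hC ((mem_similaritySet_iff hω hQ).2 (by
      obtain ⟨γ', hγ', he⟩ := hR.exists_digits_of_add_period hγ
      exact ⟨γ', hγ', hCγ.trans he⟩))) hCr] with n hn hpre
    exact hn.2 (isCoincident_of_isPreconnected hn.1 hpre)
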